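/- Let $B=\mathbb Q[x_1,x_2,\dots]$ and define $S_j(x)\in B$ ($j\in\mathbb Z$) by $\sum_j S_j(x)Z^j=\exp\big(\sum_{n\ge1}x_nZ^n\big)$. For a partition $\lambda$ of length $\ell(\lambda)$ put $S_\lambda(x)=\det\big(S_{\lambda_j-j+i}(x)\big)_{1\le i,j\le \ell(\lambda)}$. Let $\mathcal F$ be the charge-zero fermionic Fock space, with basis the semi-infinite monomials $[X]^\lambda=X^{\lambda_1}\wedge X^{\lambda_2-1}\wedge X^{\lambda_3-2}\wedge\cdots$, $\lambda$ a partition. For $i,j\in\mathbb Z$ let $(X^i\otimes\partial^j)\star S_\lambda(x)\in B$ be the image of $X^i\wedge(\partial^j\lrcorner[X]^\lambda)$ under the boson-fermion correspondence $\mathcal F\to B$, $[X]^\mu\mapsto S_\mu(x)$; this is the action on $B$ of the elementary matrices of $gl(\mathbb Q[X,X^{-1}])$. Let $$\Gamma(z,w)=\exp\Big(\sum_{n\ge1}x_n(z^n-w^n)\Big)\exp\Big(-\sum_{n\ge1}\frac1n\Big(\frac1{z^n}-\frac1{w^n}\Big)\frac{\partial}{\partial x_n}\Big).$$ Let $r\in\{0,1,2,\dots\}\cup\{\infty\}$,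 let $t=(t_1,\dots,t_r)$ (respectively $t=(t_1,t_2,\dots)$ if $r=\infty$), let $s_\lambda(t)$ be the Schur symmetric functions and $p_n(t)=\sum_i t_i^n$ the power sums in these variables, and let $\mathcal P_r$ be the set of partitions of length at most $r$. All series are taken in $B((z))((w))[[t]]$ (Laurent series in $w$ over Laurent series in $z$), where $(1-w/z)^{-1}=\sum_{k\ge0}w^kz^{-k}$, and all infinite sums and exponentials converge coefficientwise: only finitely many terms contribute to the coefficient of each monomial $z^aw^bt^\beta$. Then $$\sum_{\lambda\in\mathcal P_r}\Big(1-\frac wz\Big)^{-1}\Gamma(z,w)S_\lambda(x)\,s_\lambda(t)=\exp\left(\sum_{n\ge1}\left[\frac1n\left(\frac{w^n}{z^n}-\frac{p_n(t)}{z^n}+\frac{p_n(t)}{w^n}\right)+x_n\big(z^n-w^n+p_n(t)\big)\right]\right),$$ and this series is the structural series $\sum_{i,j\in\mathbb Z}\sum_{\lambda\in\mathcal P_r}\big((X^i\otimes\partial^j)\star S_\lambda(x)\big)s_\lambda(t)\,z^iw^{-j}$ of the representation: for all $i,j\in\mathbb Z$ the coefficient of $z^iw^{-j}$ on either side is $\sum_{\lambda\in\mathcal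 P_r}\big((X^i\otimes\partial^j)\star S_\lambda(x)\big)s_\lambda(t)$. -/

import Mathlib

noncomputable section

namespace Bosonic

/-- Partitions: non-increasing sequences `lam 0 ≥ lam 1 ≥ ⋯` of natural numbers with finitely many
non-zero terms. -/
abbrev Ptn : Type := {f : ℕ →₀ ℕ // Antitone f}

/-- The length of a partition, i.e. the number of its non-zero parts. -/
def Ptn.length (lam : Ptn) : ℕ := lam.1.support.card

/-- The ring `B = ℚ[x₁, x₂, …]`. -/
abbrev B : Type := MvPolynomial ℕ+ ℚ

/-! ### Schur basis of `B` -/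

/-- The power series `∑_{n ≥ 1} xₙ Zⁿ` over `B`. -/
def xSeries : PowerSeries B :=
  PowerSeries.mk fun n => if h : 0 < n then MvPolynomial.X ⟨n, h⟩ else 0

/-- `S_j(x)`, defined by `∑_j S_j(x) Zʲ = exp (∑_{n ≥ 1} xₙ Zⁿ)`; it is zero for `j < 0`. -/
def complete (j : ℤ) : B :=
  if 0 ≤ j then PowerSeries.coeff j.toNat ((PowerSeries.exp ℚ).subst xSeries) else 0

/-- The Schur basis element `S_λ(x) = det (S_{λ_j - j + i}(x))`, the size of the determinant being
the length of `λ`. -/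
def schurB (lam : Ptn) : B :=
  Matrix.det (Matrix.of fun i j : Fin lam.length =>
    complete ((lam.1 (j : ℕ) : ℤ) - (j : ℤ) + (i : ℤ)))

/-! ### Schur polynomials and power sums in the variables `t` -/

/-- The alternant `det (t_i ^ {e_j})` in the first `N` of the variables `t₀, t₁, …`. -/
def alternant (N : ℕ) (e : Fin N → ℕ) : MvPolynomial ℕ ℚ :=
  Matrix.det (Matrix.of fun i j : Fin N => MvPolynomial.X (i : ℕ) ^ e j)

theorem sub_dvd_alternant (N : ℕ) (e : Fin N → ℕ) {i j : Fin N} (hij : i ≠ j) :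
    (MvPolynomial.X (i : ℕ) - MvPolynomial.X (j : ℕ) : MvPolynomial ℕ ℚ) ∣ alternant N e := by
  classical
  let φ : MvPolynomial ℕ ℚ →ₐ[ℚ] MvPolynomial ℕ ℚ :=
    MvPolynomial.aeval (fun k => if k = (i : ℕ) then MvPolynomial.X (j : ℕ) else MvPolynomial.X k)
  let I : Ideal (MvPolynomial ℕ ℚ) :=
    Ideal.span {MvPolynomial.X (i : ℕ) - MvPolynomial.X (j : ℕ)}
  have key : (Ideal.Quotient.mkₐ ℚ I).comp φ = Ideal.Quotient.mkₐ ℚ I := by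
    apply MvPolynomial.algHom_ext
    intro k
    by_cases hk : k = (i : ℕ)
    · subst hk
      have : Ideal.Quotient.mk I (MvPolynomial.X (i : ℕ)) =
          Ideal.Quotient.mk I (MvPolynomial.X (j : ℕ)) :=
        Ideal.Quotient.eq.mpr (Ideal.subset_span rfl)
      simp [φ, this]
    · simp [φ, hk]
  have hzero : φ (alternant N e) = 0 := by
    unfold alternant
    rw [AlgHom.map_det]
    apply Matrix.det_zero_of_row_eq hij
    funext k
    have hji : (j : ℕ) ≠ (i : ℕ) := fun h => hij (Fin.ext h.symm)
    simp [φ, hji]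
  have h2 : Ideal.Quotient.mkₐ ℚ I (alternant N e) = 0 := by
    rw [← key, AlgHom.comp_apply, hzero, map_zero]
  exact Ideal.mem_span_singleton.mp (Ideal.Quotient.eq_zero_iff_mem.mp h2)

theorem irreducible_X_sub_X {a b : ℕ} (hab : a ≠ b) :
    Irreducible (MvPolynomial.X a - MvPolynomial.X b : MvPolynomial ℕ ℚ) := by
  have hdeg : (MvPolynomial.X a - MvPolynomial.X b : MvPolynomial ℕ ℚ).totalDegree = 1 := by
    apply le_antisymm
    · exact (MvPolynomial.totalDegree_sub _ _).trans (by simp)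
    · rw [Nat.one_le_iff_ne_zero]
      intro h
      rw [MvPolynomial.totalDegree_eq_zero_iff_eq_C] at h
      have h0 := congrArg (MvPolynomial.eval (fun _ : ℕ => (0 : ℚ))) h
      have h1 := congrArg (MvPolynomial.eval (fun k : ℕ => if k = a then (1 : ℚ) else 0)) h
      simp only [map_sub, MvPolynomial.eval_X, MvPolynomial.eval_C, if_true, if_neg hab.symm] at h0 h1
      linarith
  refine MvPolynomial.irreducible_of_totalDegree_eq_one hdeg fun x hx => ?_
  have hne : (MvPolynomial.X a - MvPolynomial.X b : MvPolynomial ℕ ℚ) ≠ 0 := by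
    intro h
    rw [h] at hdeg
    simp at hdeg
  rw [MvPolynomial.ne_zero_iff] at hne
  obtain ⟨m, hm⟩ := hne
  exact isUnit_iff_ne_zero.mpr fun h0 => hm (zero_dvd_iff.mp (h0 ▸ hx m))

theorem alternant_dvd (N : ℕ) (e : Fin N → ℕ) :
    alternant N (fun j => N - 1 - j) ∣ alternant N e := by
  classical
  have hvand : alternant N (fun j => N - 1 - j) =
      ∏ i : Fin N, ∏ j ∈ Finset.Ioi i,
        ((MvPolynomial.X (i : ℕ) - MvPolynomial.X (j : ℕ)) : MvPolynomial ℕ ℚ) := by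
    have h := Matrix.det_projVandermonde (fun _ : Fin N => (1 : MvPolynomial ℕ ℚ))
      (fun i : Fin N => MvPolynomial.X (i : ℕ))
    simp only [one_mul] at h
    rw [← h, alternant]
    congr 1
    ext1 i j
    have hj : N - 1 - (j : ℕ) = N - (j + 1) := by omega
    simp [Matrix.projVandermonde_apply, Fin.val_rev, hj]
  rw [hvand, Finset.prod_sigma']
  apply Finset.prod_dvd_of_isRelPrime
  · rintro ⟨a, b⟩ hab ⟨c, d⟩ hcd hne
    simp only [Finset.coe_sigma, Set.mem_sigma_iff, Finset.mem_coe, Finset.mem_univ, Finset.mem_Ioi,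
      true_and] at hab hcd
    refine (irreducible_X_sub_X (fun h => hab.ne (Fin.ext h))).isRelPrime_iff_not_dvd.mpr ?_
    rintro ⟨q, hq⟩
    have h := congrArg (MvPolynomial.eval
      (fun k : ℕ => if k = (a : ℕ) ∨ k = (b : ℕ) then (0 : ℚ) else (k : ℚ) + 1)) hq
    have hc : ((c : ℕ) : ℚ) + 1 ≠ 0 := by positivity
    have hd : ((d : ℕ) : ℚ) + 1 ≠ 0 := by positivity
    have hcd' : ((c : ℕ) : ℚ) ≠ ((d : ℕ) : ℚ) := by
      exact_mod_cast fun h => hcd.ne (Fin.ext h)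
    simp only [map_sub, map_mul, MvPolynomial.eval_X, true_or, or_true, if_true, sub_self,
      zero_mul] at h
    by_cases h1 : (c : ℕ) = a ∨ (c : ℕ) = b <;> by_cases h2 : (d : ℕ) = a ∨ (d : ℕ) = b
    · apply hne
      have hca : c = a ∧ d = b := by
        simp only [← Fin.ext_iff] at h1 h2
        rcases h1 with rfl | rfl <;> rcases h2 with rfl | rfl
        · exact absurd hcd (lt_irrefl _)
        · exact ⟨rfl, rfl⟩
        · exact absurd hcd (lt_asymm hab)
        · exact absurd hcd (lt_irrefl _)
      obtain ⟨rfl, rfl⟩ := hca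
      rfl
    · rw [if_pos h1, if_neg h2, zero_sub, neg_eq_zero] at h
      exact hd h
    · rw [if_neg h1, if_pos h2, sub_zero] at h
      exact hc h
    · rw [if_neg h1, if_neg h2] at h
      exact hcd' (by linarith)
  · rintro ⟨a, b⟩ hab
    simp only [Finset.mem_sigma, Finset.mem_univ, Finset.mem_Ioi, true_and] at hab
    exact sub_dvd_alternant N e hab.ne

/-- The Schur polynomial `s_λ(t₀, …, t_{N-1})` of a partition of length at most `N`: the quotient of
`det (t_i ^ {λ_j + N - 1 - j})` by the Vandermonde determinant `det (t_i ^ {N - 1 - j})`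
(indices starting from zero). -/
def schurPoly (N : ℕ) (lam : Ptn) : MvPolynomial ℕ ℚ :=
  (alternant_dvd N (fun j => lam.1 (j : ℕ) + (N - 1 - j))).choose

theorem schurPoly_spec (N : ℕ) (lam : Ptn) :
    alternant N (fun j => lam.1 (j : ℕ) + (N - 1 - j)) =
      alternant N (fun j => N - 1 - j) * schurPoly N lam :=
  (alternant_dvd N (fun j => lam.1 (j : ℕ) + (N - 1 - j))).choose_spec

/-- The Schur function `s_λ` in infinitely many variables `t₀, t₁, …`: its coefficient at a monomial
is the one in the Schur polynomial in `t₀, …, t_{N-1}`, where `N` is so large that it is at least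
the length of `λ` and that only `t₀, …, t_{N-1}` occur in the monomial. -/
def schurInfinite (lam : Ptn) : MvPowerSeries ℕ ℚ :=
  fun β => MvPolynomial.coeff β (schurPoly (max lam.length (β.support.sup Nat.succ)) lam)

/-- The Schur function `s_λ(t)` in the `r` variables `t_i`, `i < r`, where `r` is finite or
infinite. -/
def schurT (r : ℕ∞) (lam : Ptn) : MvPowerSeries ℕ ℚ :=
  if r = ⊤ then schurInfinite lam else (schurPoly r.toNat lam : MvPowerSeries ℕ ℚ)

open scoped Classical in
/-- The power sum `p_n(t) = ∑_{i < r} t_iⁿ` in the `r` variables `t_i`, `i < r`, where `r` is finite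
or infinite. -/
def powerSum (r : ℕ∞) (n : ℕ+) : MvPowerSeries ℕ ℚ :=
  fun β => if ∃ i : ℕ, (i : ℕ∞) < r ∧ β = Finsupp.single i (n : ℕ) then 1 else 0

/-! ### Formal series in `z`, `w` and `t` -/

/-- The ring `B((z))((w))`; the inner variable is `z` and the outer one is `w`. In this ring
`1 - w / z` is invertible and its inverse is the geometric series in `w / z`. -/
abbrev L : Type := LaurentSeries (LaurentSeries B)

/-- The monomial `b zⁱ wʲ`. -/
def mono (b : B) (i j : ℤ) : L := HahnSeries.single j (HahnSeries.single i b)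

/-- The ring `B((z))((w))⟦t₀, t₁, …⟧`. -/
abbrev R : Type := MvPowerSeries ℕ L

/-- The coefficient of `zⁱ wʲ` in an element of `B((z))((w))`. -/
def coeffL (F : L) (i j : ℤ) : B := (F.coeff j).coeff i

/-- The coefficient of `zⁱ wʲ t^β` in an element of `B((z))((w))⟦t₀, t₁, …⟧`. -/
def coeffR (F : R) (i j : ℤ) (β : ℕ →₀ ℕ) : B := coeffL (MvPowerSeries.coeff β F) i j

/-- Power series in `t` with rational coefficients, as elements of `B((z))((w))⟦t₀, t₁, …⟧`. -/
def ofT (s : MvPowerSeries ℕ ℚ) : R := MvPowerSeries.map (algebraMap ℚ L) s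

/-- `g` is the sum of the family `f`, coefficient by coefficient: for each monomial only finitely
many members of the family contribute, and the coefficient of `g` is the sum of theirs. -/
def FormalHasSum {ι : Type*} (f : ι → R) (g : R) : Prop :=
  ∀ (i j : ℤ) (β : ℕ →₀ ℕ), {k | coeffR (f k) i j β ≠ 0}.Finite ∧
    coeffR g i j β = ∑ᶠ k, coeffR (f k) i j β

/-- `g = exp f = ∑_k f^k / k!`, the sum being taken coefficient by coefficient. -/
def FormalHasExp (f g : R) : Prop :=
  FormalHasSum (fun k : ℕ => ((k.factorial : ℚ)⁻¹) • f ^ k) g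

/-! ### The vertex operator -/

/-- A power series in two variables `Z`, `W` over `B` as a series in `z`, `w`. -/
def ofPowerSeriesZW (F : MvPowerSeries (Fin 2) B) : L :=
  HahnSeries.ofPowerSeries ℤ _ (PowerSeries.mk fun j =>
    HahnSeries.ofPowerSeries ℤ _ (PowerSeries.mk fun i =>
      MvPowerSeries.coeff (Finsupp.single 0 i + Finsupp.single 1 j) F))

/-- `exp (∑_{n ≥ 1} xₙ (zⁿ - wⁿ))`. -/
def expMultiplication : L :=
  ofPowerSeriesZW ((PowerSeries.exp ℚ).subst
    (xSeries.subst (MvPowerSeries.X 0 : MvPowerSeries (Fin 2) B) -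
      xSeries.subst (MvPowerSeries.X 1 : MvPowerSeries (Fin 2) B)))

/-- The ring `B[z⁻¹, w⁻¹]`. The variables `Sum.inl n` are the `xₙ`, and `Sum.inr 0`, `Sum.inr 1` are
`z⁻¹`, `w⁻¹`. -/
abbrev BInv : Type := MvPolynomial (ℕ+ ⊕ Fin 2) ℚ

/-- The differential operator `-∑_{n ≥ 1} (1/n) (z⁻ⁿ - w⁻ⁿ) ∂/∂xₙ` on `B[z⁻¹, w⁻¹]`: a derivation
`D` with `D z⁻¹ = D w⁻¹ = 0` is `∑ₙ D(xₙ) ∂/∂xₙ`. -/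
def diffOp : Derivation ℚ BInv BInv :=
  MvPolynomial.mkDerivation ℚ (Sum.elim
    (fun n : ℕ+ => -((1 / (n : ℚ)) •
      ((MvPolynomial.X (Sum.inr 0) : BInv) ^ (n : ℕ) - MvPolynomial.X (Sum.inr 1) ^ (n : ℕ))))
    (fun _ => 0))

theorem diffOp_eventually_zero (f : BInv) : ∃ N, ∀ k, N ≤ k → (⇑diffOp)^[k] f = 0 := by
  have hlin : ∀ (k : ℕ) (f g : BInv),
      (⇑diffOp)^[k] (f + g) = (⇑diffOp)^[k] f + (⇑diffOp)^[k] g := by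
    intro k
    induction k with
    | zero => intro f g; rfl
    | succ k ih => intro f g; simp only [Function.iterate_succ_apply, map_add, ih]
  have hz : ∀ k : ℕ, (⇑diffOp)^[k] (0 : BInv) = 0 := fun k =>
    Function.iterate_fixed (map_zero diffOp) k
  have hX : ∀ a, diffOp (diffOp (MvPolynomial.X a)) = 0 := by
    intro a
    rcases a with n | b
    · simp [diffOp, MvPolynomial.mkDerivation_X, Derivation.leibniz_pow]
    · simp [diffOp, MvPolynomial.mkDerivation_X]
  have hmul : ∀ (k : ℕ) (f x : BInv), diffOp (diffOp x) = 0 →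
      (⇑diffOp)^[k + 1] (f * x) = (⇑diffOp)^[k + 1] f * x +
        ((k + 1 : ℕ) : BInv) * ((⇑diffOp)^[k] f * diffOp x) := by
    intro k f x hx
    induction k with
    | zero =>
      simp only [zero_add, Function.iterate_one, Function.iterate_zero, id_eq, Nat.cast_one, one_mul,
        Derivation.leibniz, smul_eq_mul]
      ring
    | succ k ih =>
      rw [Function.iterate_succ_apply', ih, Function.iterate_succ_apply' _ (k + 1),
        Function.iterate_succ_apply' _ k]
      simp [Derivation.leibniz, hx]
      ring
  induction f using MvPolynomial.induction_on with
  | C a =>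
    refine ⟨1, fun k hk => ?_⟩
    obtain ⟨m, rfl⟩ := Nat.exists_eq_add_of_le' hk
    rw [Function.iterate_succ_apply]
    have : diffOp (MvPolynomial.C a) = 0 := by simp [diffOp]
    rw [this, hz]
  | add p q hp hq =>
    obtain ⟨a, ha⟩ := hp
    obtain ⟨b, hb⟩ := hq
    refine ⟨max a b, fun k hk => ?_⟩
    rw [hlin, ha k (le_trans (le_max_left _ _) hk), hb k (le_trans (le_max_right _ _) hk), add_zero]
  | mul_X p a hp =>
    obtain ⟨N, hN⟩ := hp
    refine ⟨N + 1, fun k hk => ?_⟩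
    obtain ⟨m, rfl⟩ := Nat.exists_eq_add_of_le' (le_trans (Nat.le_add_left 1 N) hk)
    rw [hmul _ _ _ (hX a), hN _ (by omega), hN _ (by omega)]
    simp

/-- `exp (-∑_{n ≥ 1} (1/n) (z⁻ⁿ - w⁻ⁿ) ∂/∂xₙ) f` for `f ∈ B`, an element of `B[z⁻¹, w⁻¹]`.
The sum is finite since the operator is locally nilpotent. -/
def expDiffOp (f : B) : BInv :=
  ∑ᶠ k : ℕ, ((k.factorial : ℚ)⁻¹) • (⇑diffOp)^[k] (MvPolynomial.rename Sum.inl f)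

/-- The inclusion of `B[z⁻¹, w⁻¹]` into `B((z))((w))`. -/
def ofBInv : BInv →ₐ[ℚ] L :=
  MvPolynomial.aeval (Sum.elim (fun n => mono (MvPolynomial.X n) 0 0)
    ![mono 1 (-1) 0, mono 1 0 (-1)])

/-- The vertex operator
`Γ(z, w) = exp (∑ xₙ (zⁿ - wⁿ)) exp (-∑ (1/n) (z⁻ⁿ - w⁻ⁿ) ∂/∂xₙ)` on `B`. -/
def vertexOp (f : B) : L := expMultiplication * ofBInv (expDiffOp f)

/-- `(1 - w / z)⁻¹ = ∑_{k ≥ 0} wᵏ z⁻ᵏ`. -/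
def geom : L := HahnSeries.ofPowerSeries ℤ _ (PowerSeries.mk fun k => HahnSeries.single (-(k : ℤ)) 1)

theorem one_sub_mul_geom_aux (K : Type*) [CommRing K] :
    (1 - HahnSeries.single (1 : ℤ) (HahnSeries.single (-1 : ℤ) (1 : K))) *
      HahnSeries.ofPowerSeries ℤ (LaurentSeries K)
        (PowerSeries.mk fun k => HahnSeries.single (-(k : ℤ)) 1) = 1 := by
  have h1 : HahnSeries.single (1 : ℤ) (HahnSeries.single (-1 : ℤ) (1 : K)) =
      HahnSeries.ofPowerSeries ℤ (LaurentSeries K)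
      (PowerSeries.C (HahnSeries.single (-1 : ℤ) (1 : K)) * PowerSeries.X) := by
    rw [map_mul, HahnSeries.ofPowerSeries_C, HahnSeries.ofPowerSeries_X, HahnSeries.C_apply,
      HahnSeries.single_mul_single]
    simp
  rw [h1, ← map_one (HahnSeries.ofPowerSeries ℤ (LaurentSeries K)), ← map_sub, ← map_mul]
  congr 1
  ext1 n
  rw [sub_mul, one_mul, map_sub, mul_assoc, PowerSeries.coeff_C_mul]
  rcases n with _ | n
  · simp
  · rw [PowerSeries.coeff_succ_X_mul, PowerSeries.coeff_mk, PowerSeries.coeff_mk,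
      HahnSeries.single_mul_single, PowerSeries.coeff_one, if_neg (Nat.succ_ne_zero n), mul_one,
      sub_eq_zero]
    congr 2
    push_cast
    ring

theorem one_sub_mul_geom : (1 - mono 1 (-1) 1) * geom = 1 := by
  exact one_sub_mul_geom_aux B

/-! ### The fermionic Fock space and the action of `gl(ℚ[X, X⁻¹])` -/

/-- Sets of integers that differ from `{0, -1, -2, …}` by a finite set. Such a set
`{m₀ > m₁ > ⋯}` stands for the semi-infinite monomial `X^{m₀} ∧ X^{m₁} ∧ ⋯`. -/
abbrev Maya : Type := {M : Set ℤ // (symmDiff M (Set.Iic 0)).Finite}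

/-- The fermionic Fock space (of all charges), with the semi-infinite monomials as a basis. -/
abbrev Fock : Type := Maya →₀ ℚ

theorem Maya.finite_erase (M : Maya) (j : ℤ) : (symmDiff (M.1 \ {j}) (Set.Iic 0)).Finite := by
  refine (M.2.union (Set.finite_singleton j)).subset ?_
  intro a ha
  simp only [Set.mem_symmDiff, Set.mem_union, Set.mem_sdiff, Set.mem_singleton_iff] at ha ⊢
  tauto

theorem Maya.finite_insert (M : Maya) (i : ℤ) :
    (symmDiff (insert i M.1) (Set.Iic 0)).Finite := by
  refine (M.2.union (Set.finite_singleton i)).subset ?_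
  intro a ha
  simp only [Set.mem_symmDiff, Set.mem_union, Set.mem_insert_iff, Set.mem_singleton_iff] at ha ⊢
  tauto

/-- Remove `j`. -/
def Maya.erase (M : Maya) (j : ℤ) : Maya := ⟨M.1 \ {j}, M.finite_erase j⟩

/-- Add `i`. -/
def Maya.insert (M : Maya) (i : ℤ) : Maya := ⟨Insert.insert i M.1, M.finite_insert i⟩

/-- The number of elements of `M` that are larger than `i`. -/
def Maya.above (M : Maya) (i : ℤ) : ℕ := (M.1 ∩ Set.Ioi i).ncard

open scoped Classical in
/-- The contraction `∂ʲ ⌟`: if `Xʲ` is a factor of the monomial, it is removed, with the sign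
`(-1)^a` where `a` is the number of factors that precede it; otherwise the result is zero. -/
def contract (j : ℤ) : Fock →ₗ[ℚ] Fock :=
  Finsupp.linearCombination ℚ fun M : Maya =>
    if j ∈ M.1 then Finsupp.single (M.erase j) ((-1 : ℚ) ^ M.above j) else 0

open scoped Classical in
/-- The operator `Xⁱ ∧`: it is zero on a monomial with a factor `Xⁱ`; otherwise `Xⁱ` is put in front
and then moved past the factors with larger exponent, each of which contributes a sign. -/
def wedge (i : ℤ) : Fock →ₗ[ℚ] Fock :=
  Finsupp.linearCombination ℚ fun M : Maya =>
    if i ∈ M.1 then 0 else Finsupp.single (M.insert i) ((-1 : ℚ) ^ M.above i)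

/-- The set of exponents of `X^{λ₁} ∧ X^{λ₂ - 1} ∧ X^{λ₃ - 2} ∧ ⋯`. -/
def Ptn.exponents (lam : Ptn) : Set ℤ := Set.range fun k : ℕ => (lam.1 k : ℤ) - (k : ℤ)

theorem Ptn.exponents_finite (lam : Ptn) :
    (symmDiff lam.exponents (Set.Iic 0)).Finite := by
  obtain ⟨N, hN⟩ : ∃ N : ℕ, ∀ k, N ≤ k → lam.1 k = 0 := by
    refine ⟨lam.1.support.sup Nat.succ, fun k hk => ?_⟩
    by_contra h
    have := Finset.le_sup (f := Nat.succ) (Finsupp.mem_support_iff.mpr h)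
    simp only [Nat.succ_eq_add_one] at this hk
    omega
  refine (Set.finite_Icc (-(N : ℤ)) (lam.1 0 : ℤ)).subset ?_
  intro a ha
  rw [Set.mem_symmDiff] at ha
  simp only [Ptn.exponents, Set.mem_range, Set.mem_Iic, not_le] at ha
  rw [Set.mem_Icc]
  rcases ha with ⟨⟨k, rfl⟩, h⟩ | ⟨h, h'⟩
  · have := lam.2 (Nat.zero_le k)
    omega
  · constructor
    · by_contra hlt
      apply h'
      refine ⟨(-a).toNat, ?_⟩
      rw [hN _ (by omega)]
      omega
    · omega

/-- The exponents of a partition as an index of a basis vector. -/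
def Ptn.maya (lam : Ptn) : Maya := ⟨lam.exponents, lam.exponents_finite⟩

theorem Ptn.maya_injective : Function.Injective Ptn.maya := by
  intro lam mu h
  have hr : lam.exponents = mu.exponents := congrArg Subtype.val h
  have anti : ∀ nu : Ptn, StrictMono (fun k : ℕ => OrderDual.toDual ((nu.1 k : ℤ) - (k : ℤ))) := by
    intro nu a b hab
    rw [OrderDual.toDual_lt_toDual]
    have := nu.2 hab.le
    omega
  have := (StrictMono.range_inj (anti lam) (anti mu)).mp (by
    exact hr)
  apply Subtype.ext
  ext k
  have hk := congrArg OrderDual.ofDual (congrFun this k)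
  simp at hk
  exact hk

/-- `[X]^λ = X^{λ₁} ∧ X^{λ₂ - 1} ∧ X^{λ₃ - 2} ∧ ⋯`. These vectors are the basis of the Fock space of
charge zero. -/
def fockVec (lam : Ptn) : Fock := Finsupp.single lam.maya 1

open scoped Classical in
/-- The boson-fermion correspondence `[X]^λ ↦ S_λ(x)`, extended by zero to the monomials of non-zero
charge (those that are not of the form `[X]^λ`). -/
def bosonize : Fock →ₗ[ℚ] B :=
  Finsupp.linearCombination ℚ fun M : Maya =>
    if h : ∃ lam : Ptn, lam.maya = M then schurB h.choose else 0

/-- `(Xⁱ ⊗ ∂ʲ) ⋆ S_λ(x)`, the element of `B` that corresponds to `Xⁱ ∧ (∂ʲ ⌟ [X]^λ)`. -/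
def glAct (i j : ℤ) (lam : Ptn) : B := bosonize (wedge i (contract j (fockVec lam)))

/-- The `n`-th term
`(1/n) (wⁿ/zⁿ - p_n(t)/zⁿ + p_n(t)/wⁿ) + xₙ (zⁿ - wⁿ + p_n(t))`. -/
def exponentTerm (r : ℕ∞) (n : ℕ+) : R :=
  (1 / (n : ℚ)) • (MvPowerSeries.C (mono 1 (-(n : ℤ)) (n : ℤ))
      - MvPowerSeries.C (mono 1 (-(n : ℤ)) 0) * ofT (powerSum r n)
      + MvPowerSeries.C (mono 1 0 (-(n : ℤ))) * ofT (powerSum r n))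
    + MvPowerSeries.C (mono (MvPolynomial.X n) 0 0) *
      (MvPowerSeries.C (mono 1 (n : ℤ) 0) - MvPowerSeries.C (mono 1 0 (n : ℤ))
        + ofT (powerSum r n))

end Bosonic

end

/-!
The theorem identifies three descriptions of one series `E` in `B((z))((w))⟦t⟧`, each of which is
linked to the next by a classical fact.

*The Cauchy identity.* `∑_λ S_λ(x) s_λ(t) = ∏_i ∑_j S_j(x) t_iʲ`, and each factor on the right is
`exp (∑ xₙ t_iⁿ)`, so that the product is `exp (∑ xₙ p_n(t))`. It is proved in `cauchy_identity`, for
finitely many `t_i`: both sides are multiplied by the Vandermonde determinant, which turns the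
coefficients of the left hand side into alternating sums and those of the right hand side into
determinants `det (S_{c_j + i})`, and sorting the columns of such a determinant gives some `S_λ`
up to sign (`hdet_eq_sum_alternant`).

*The vertex operator is a substitution followed by a multiplication.* By Taylor's formula, the
exponential of the differential operator is the ring homomorphism
`xₙ ↦ xₙ - (1/n) (z⁻ⁿ - w⁻ⁿ)` (`doubleShift`, `vertexOp_eq`). Applied to the Cauchy product it yields
`exp (∑ p_n(t) (xₙ - (1/n) (z⁻ⁿ - w⁻ⁿ)))`, while `(1 - w/z)⁻¹ = exp (∑ (1/n) wⁿ z⁻ⁿ)`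
(`geomInv_eq_exp`). Hence `E` is the exponential of the sum of the terms `exponentTerm r n`.
Exponentials in rings of series are handled uniformly by filtrations (`MulFiltration.IsExp`), in which
they are characterized by their partial sums; the exponential of a sum is a product by
`MulFiltration.IsExp.add`. In `B((z))((w))⟦t⟧` the filtration is by the weight `i + 2j + 3|β|` of the
monomial `zⁱ wʲ t^β`, for which all terms of the exponent are of positive weight. Since there are
coefficients of arbitrarily negative weight, step zero is not the whole ring.

*Bosonization.* The coefficient of `zⁱ w⁻ʲ` in `(1 - w/z)⁻¹ Γ(z, w) S_λ` is `(Xⁱ ⊗ ∂ʲ) ⋆ S_λ`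
(`coeffL_geom_mul_vertexOp`). With the factor `(1 - w/z)⁻¹` in front, the vertex operator becomes the
composite of an operator in `w` and an operator in `z` (`geom_mul_expMultiplication`). On the
determinants `det (S_{c_j + i})`, which represent semi-infinite monomials with exponents `c_j`, the
first one removes a factor (`coeff_sigmaInv_mul_shift`) and the second one puts a factor in front
(`coeff_sigma_mul_shift`). Both are row or column operations on determinants.

For infinitely many `t_i`, each coefficient of the series in question agrees with the one for
sufficiently many variables (`rank`), because power sums, Schur functions and the exponent are
stable.
-/

noncomputable section

namespace Bosonic

/-! ### Exponentials in filtered algebras -/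

/-- A decreasing multiplicative filtration `F₀ ⊇ F₁ ⊇ ⋯` of a commutative `ℚ`-algebra by
additive subgroups that are stable under rational scalars; `F₀` need not be the whole algebra. -/
structure MulFiltration (A : Type*) [CommRing A] [Algebra ℚ A] where
  /-- The steps of the filtration. -/
  step : ℕ → AddSubgroup A
  antitone : Antitone step
  one_mem : 1 ∈ step 0
  algebraMap_mul_mem : ∀ {n : ℕ} (q : ℚ) {x : A}, x ∈ step n → algebraMap ℚ A q * x ∈ step n
  mul_mem : ∀ {m n : ℕ} {x y : A}, x ∈ step m → y ∈ step n → x * y ∈ step (m + n)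

theorem map_algebraMap_rat {A A' : Type*} [CommRing A] [CommRing A'] [Algebra ℚ A] [Algebra ℚ A']
    (φ : A →+* A') (q : ℚ) : φ (algebraMap ℚ A q) = algebraMap ℚ A' q :=
  RingHom.congr_fun (RingHom.ext_rat (φ.comp (algebraMap ℚ A)) (algebraMap ℚ A')) q

namespace MulFiltration

variable {A : Type*} [CommRing A] [Algebra ℚ A] (F : MulFiltration A)

theorem pow_mem {f : A} (hf : f ∈ F.step 1) (k : ℕ) : f ^ k ∈ F.step k := by
  induction k with
  | zero => simpa using F.one_mem
  | succ k ih => rw [pow_succ]; exact F.mul_mem ih hf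

/-- The sum of the first `n` terms of the exponential series of `f`. -/
def expSum (f : A) (n : ℕ) : A :=
  ∑ k ∈ Finset.range n, algebraMap ℚ A (k.factorial : ℚ)⁻¹ * f ^ k

/-- `E` is the exponential of `f`, an element of positive filtration: the partial sums of the
exponential series converge to `E` in the topology of the filtration. -/
def IsExp (f E : A) : Prop := f ∈ F.step 1 ∧ ∀ n, E - expSum f n ∈ F.step n

variable {F}

theorem expTerm_add (f g : A) (n : ℕ) :
    algebraMap ℚ A (n.factorial : ℚ)⁻¹ * (f + g) ^ n = ∑ p ∈ Finset.HasAntidiagonal.antidiagonal n,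
      (algebraMap ℚ A (p.1.factorial : ℚ)⁻¹ * f ^ p.1) *
        (algebraMap ℚ A (p.2.factorial : ℚ)⁻¹ * g ^ p.2) := by
  have h := congrArg (PowerSeries.coeff n) (PowerSeries.exp_mul_exp_eq_exp_add f g)
  simp only [PowerSeries.coeff_mul, PowerSeries.coeff_rescale, PowerSeries.coeff_exp] at h
  rw [← one_div, mul_comm, ← h]
  refine Finset.sum_congr rfl fun p _ => ?_
  rw [one_div, one_div]
  ring

theorem expSum_mem {f : A} (hf : f ∈ F.step 1) (n : ℕ) : expSum f n ∈ F.step 0 :=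
  sum_mem fun k _ => F.algebraMap_mul_mem _ (F.antitone (Nat.zero_le k) (F.pow_mem hf k))

theorem expSum_sub_mem {f : A} (hf : f ∈ F.step 1) {m n : ℕ} (h : m ≤ n) :
    expSum f n - expSum f m ∈ F.step m := by
  rw [expSum, expSum, Finset.sum_range_sub_sum_range h]
  refine sum_mem fun k hk => F.algebraMap_mul_mem _ ?_
  exact F.antitone (Finset.mem_filter.mp hk).2 (F.pow_mem hf k)

/-- In the product of two partial sums, the terms of total degree less than `n` add up to the partial
sum for `f + g`. -/
theorem expSum_mul_sub_mem {f g : A} (hf : f ∈ F.step 1) (hg : g ∈ F.step 1) (n : ℕ) :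
    expSum f n * expSum g n - expSum (f + g) n ∈ F.step n := by
  have h1 : expSum (f + g) n = ∑ p ∈ (Finset.range n ×ˢ Finset.range n) with p.1 + p.2 < n,
      (algebraMap ℚ A (p.1.factorial : ℚ)⁻¹ * f ^ p.1) *
        (algebraMap ℚ A (p.2.factorial : ℚ)⁻¹ * g ^ p.2) := by
    unfold expSum
    simp_rw [expTerm_add]
    rw [Finset.sum_sigma']
    refine Finset.sum_bij' (fun x _ => x.2) (fun p _ => ⟨p.1 + p.2, p⟩) ?_ ?_ ?_ ?_ ?_
    · rintro ⟨k, a, b⟩ h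
      simp only [Finset.mem_sigma, Finset.mem_range, Finset.HasAntidiagonal.mem_antidiagonal] at h
      simp only [Finset.mem_filter, Finset.mem_product, Finset.mem_range]
      omega
    · rintro ⟨a, b⟩ h
      simp only [Finset.mem_filter, Finset.mem_product, Finset.mem_range] at h
      simp only [Finset.mem_sigma, Finset.mem_range, Finset.HasAntidiagonal.mem_antidiagonal]
      exact ⟨h.2, trivial⟩
    · rintro ⟨k, a, b⟩ h
      simp only [Finset.mem_sigma, Finset.mem_range, Finset.HasAntidiagonal.mem_antidiagonal] at h
      obtain ⟨_, rfl⟩ := h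
      rfl
    · intros; rfl
    · intros; rfl
  rw [h1, expSum, expSum, Finset.sum_mul_sum, ← Finset.sum_product',
    ← Finset.sum_filter_add_sum_filter_not _ (fun p : ℕ × ℕ => p.1 + p.2 < n), add_sub_cancel_left]
  refine sum_mem fun p hp => ?_
  refine F.antitone (not_lt.mp (Finset.mem_filter.mp hp).2) (F.mul_mem ?_ ?_)
  · exact F.algebraMap_mul_mem _ (F.pow_mem hf _)
  · exact F.algebraMap_mul_mem _ (F.pow_mem hg _)

theorem IsExp.mem {f E : A} (h : F.IsExp f E) : E ∈ F.step 0 := by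
  simpa [expSum] using h.2 0

theorem IsExp.add {f g E G : A} (hE : F.IsExp f E) (hG : F.IsExp g G) :
    F.IsExp (f + g) (E * G) := by
  refine ⟨add_mem hE.1 hG.1, fun n => ?_⟩
  have e : E * G - expSum (f + g) n = (E - expSum f n) * G + expSum f n * (G - expSum g n) +
      (expSum f n * expSum g n - expSum (f + g) n) := by ring
  rw [e]
  refine add_mem (add_mem ?_ ?_) (expSum_mul_sub_mem hE.1 hG.1 n)
  · simpa using F.mul_mem (hE.2 n) hG.mem
  · simpa using F.mul_mem (expSum_mem hE.1 n) (hG.2 n)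

theorem isExp_zero : F.IsExp 0 1 := by
  refine ⟨zero_mem _, fun n => ?_⟩
  rcases n with _ | n
  · simpa [expSum] using F.one_mem
  · have : expSum (0 : A) (n + 1) = 1 := by
      rw [expSum, Finset.sum_eq_single 0] <;> simp +contextual
    rw [this, sub_self]
    exact zero_mem _

theorem IsExp.sum {ι : Type*} (s : Finset ι) {f E : ι → A} (h : ∀ i ∈ s, F.IsExp (f i) (E i)) :
    F.IsExp (∑ i ∈ s, f i) (∏ i ∈ s, E i) := by
  classical
  induction s using Finset.induction_on with
  | empty => simpa using isExp_zero
  | insert a s ha ih =>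
    rw [Finset.sum_insert ha, Finset.prod_insert ha]
    exact (h a (Finset.mem_insert_self _ _)).add (ih fun i hi => h i (Finset.mem_insert_of_mem hi))

theorem IsExp.unique (hF : ∀ x, (∀ n, x ∈ F.step n) → x = 0) {f E G : A} (hE : F.IsExp f E)
    (hG : F.IsExp f G) : E = G := by
  refine sub_eq_zero.mp (hF _ fun n => ?_)
  have := sub_mem (hE.2 n) (hG.2 n)
  simpa using this

end MulFiltration

/-! ### Exponentials of power series -/

section PowerSeriesExp

variable {τ : Type*} {A : Type*} [CommRing A] [Algebra ℚ A]

/-- The filtration of a ring of power series by the order. -/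
def orderFiltration (τ A : Type*) [CommRing A] [Algebra ℚ A] :
    MulFiltration (MvPowerSeries τ A) where
  step n :=
    { carrier := {f | (n : ℕ∞) ≤ f.order}
      add_mem' := fun {a b} ha hb => le_trans (le_min ha hb) MvPowerSeries.min_order_le_add
      zero_mem' := by simp
      neg_mem' := fun {a} ha => by simpa using ha }
  algebraMap_mul_mem q x hx := by
    rw [← Algebra.smul_def]
    refine MvPowerSeries.nat_le_order fun d hd => ?_
    rw [map_rat_smul (MvPowerSeries.coeff d), MvPowerSeries.coeff_of_lt_order, smul_zero]
    exact lt_of_lt_of_le (by exact_mod_cast hd) hx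
  antitone m n h x hx := by
    have hx' : (n : ℕ∞) ≤ x.order := hx
    change (m : ℕ∞) ≤ x.order
    exact le_trans (by exact_mod_cast h) hx'
  one_mem := by simp
  mul_mem {m n x y} hx hy := by
    refine le_trans ?_ MvPowerSeries.le_order_mul
    rw [Nat.cast_add]
    exact add_le_add hx hy

theorem mem_orderFiltration {n : ℕ} {f : MvPowerSeries τ A} :
    f ∈ (orderFiltration τ A).step n ↔ (n : ℕ∞) ≤ f.order := Iff.rfl

theorem orderFiltration_separated (x : MvPowerSeries τ A)
    (hx : ∀ n, x ∈ (orderFiltration τ A).step n) : x = 0 := by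
  ext d
  rw [MvPowerSeries.coeff_of_lt_order, map_zero]
  refine lt_of_lt_of_le ?_ (mem_orderFiltration.mp (hx (d.degree + 1)))
  exact_mod_cast Nat.lt_succ_self _

theorem one_le_order_iff {g : MvPowerSeries τ A} :
    g ∈ (orderFiltration τ A).step 1 ↔ MvPowerSeries.constantCoeff g = 0 := by
  rw [mem_orderFiltration, Nat.cast_one]
  constructor
  · intro h
    rw [← MvPowerSeries.coeff_zero_eq_constantCoeff_apply]
    refine MvPowerSeries.coeff_of_lt_order (lt_of_lt_of_le ?_ h)
    simp
  · intro h
    rw [← Nat.cast_one]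
    refine (MvPowerSeries.nat_le_order fun d hd => ?_)
    have : d = 0 := by rwa [Nat.lt_one_iff, Finsupp.degree_eq_zero_iff] at hd
    rw [this, MvPowerSeries.coeff_zero_eq_constantCoeff_apply, h]

theorem isExp_subst {g : MvPowerSeries τ A} (hg : MvPowerSeries.constantCoeff g = 0) :
    (orderFiltration τ A).IsExp g ((PowerSeries.exp ℚ).subst g) := by
  have hg1 := one_le_order_iff.mpr hg
  refine ⟨hg1, fun n => ?_⟩
  refine mem_orderFiltration.mpr (MvPowerSeries.nat_le_order fun d hd => ?_)
  have hs : PowerSeries.HasSubst g := PowerSeries.HasSubst.of_constantCoeff_zero hg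
  rw [map_sub, PowerSeries.coeff_subst hs, MulFiltration.expSum, map_sum,
    finsum_eq_sum_of_support_subset (s := Finset.range n), sub_eq_zero]
  · refine Finset.sum_congr rfl fun k _ => ?_
    rw [← Algebra.smul_def, map_rat_smul (MvPowerSeries.coeff d), PowerSeries.coeff_exp, one_div]
    rfl
  · intro k hk
    rw [Finset.coe_range, Set.mem_Iio]
    by_contra h
    refine hk ?_
    dsimp only
    rw [MvPowerSeries.coeff_of_lt_order, smul_zero]
    refine lt_of_lt_of_le ?_ ((orderFiltration τ A).pow_mem hg1 k)
    exact_mod_cast lt_of_lt_of_le hd (not_lt.mp h)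

theorem IsExp.eq_subst {g E : MvPowerSeries τ A} (h : (orderFiltration τ A).IsExp g E) :
    (PowerSeries.exp ℚ).subst g = E :=
  (isExp_subst (one_le_order_iff.mp h.1)).unique orderFiltration_separated h

theorem exp_subst_add {f g : MvPowerSeries τ A} (hf : MvPowerSeries.constantCoeff f = 0)
    (hg : MvPowerSeries.constantCoeff g = 0) :
    (PowerSeries.exp ℚ).subst (f + g) =
      (PowerSeries.exp ℚ).subst f * (PowerSeries.exp ℚ).subst g :=
  IsExp.eq_subst ((isExp_subst hf).add (isExp_subst hg))

theorem exp_subst_zero : (PowerSeries.exp ℚ).subst (0 : MvPowerSeries τ A) = 1 :=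
  IsExp.eq_subst MulFiltration.isExp_zero

/-- Ring homomorphisms that do not lower the order commute with the exponential. -/
theorem map_exp_subst_of_order {τ' A' : Type*} [CommRing A'] [Algebra ℚ A']
    (Φ : MvPowerSeries τ A →+* MvPowerSeries τ' A')
    (hΦ : ∀ (n : ℕ) (x : MvPowerSeries τ A), (n : ℕ∞) ≤ x.order → (n : ℕ∞) ≤ (Φ x).order)
    {g : MvPowerSeries τ A} (hg : MvPowerSeries.constantCoeff g = 0) :
    Φ ((PowerSeries.exp ℚ).subst g) = (PowerSeries.exp ℚ).subst (Φ g) := by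
  symm
  have h := isExp_subst hg
  refine IsExp.eq_subst ⟨hΦ 1 g h.1, fun n => ?_⟩
  have e : MulFiltration.expSum (Φ g) n = Φ (MulFiltration.expSum g n) := by
    rw [MulFiltration.expSum, MulFiltration.expSum, map_sum]
    refine Finset.sum_congr rfl fun k _ => ?_
    rw [← map_pow, map_mul, map_algebraMap_rat]
  rw [e, ← map_sub]
  exact hΦ n _ (h.2 n)

theorem map_exp_subst {A' : Type*} [CommRing A'] [Algebra ℚ A'] (φ : A →+* A')
    {g : MvPowerSeries τ A} (hg : MvPowerSeries.constantCoeff g = 0) :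
    MvPowerSeries.map φ ((PowerSeries.exp ℚ).subst g) =
      (PowerSeries.exp ℚ).subst (MvPowerSeries.map φ g) := by
  refine map_exp_subst_of_order _ (fun n x hx => MvPowerSeries.nat_le_order fun d hd => ?_) hg
  rw [MvPowerSeries.coeff_map, MvPowerSeries.coeff_of_lt_order, map_zero]
  exact lt_of_lt_of_le (by exact_mod_cast hd) hx

theorem rescale_exp_subst (a : A) {g : PowerSeries A} (hg : PowerSeries.constantCoeff g = 0) :
    PowerSeries.rescale a ((PowerSeries.exp ℚ).subst g) =
      (PowerSeries.exp ℚ).subst (PowerSeries.rescale a g) := by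
  refine map_exp_subst_of_order (PowerSeries.rescale a)
    (fun n x hx => MvPowerSeries.nat_le_order fun d hd => ?_) hg
  obtain ⟨k, rfl⟩ : ∃ k, d = Finsupp.single () k := ⟨d (), by ext; simp⟩
  have h1 : MvPowerSeries.coeff (Finsupp.single () k) x = 0 :=
    MvPowerSeries.coeff_of_lt_order (lt_of_lt_of_le (by exact_mod_cast hd) hx)
  change PowerSeries.coeff k (PowerSeries.rescale a x) = 0
  rw [PowerSeries.coeff_rescale]
  change a ^ k * MvPowerSeries.coeff (Finsupp.single () k) x = 0
  rw [h1, mul_zero]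

theorem exp_subst_subst_X {σ : Type*} (s : σ) {g : PowerSeries A}
    (hg : PowerSeries.constantCoeff g = 0) :
    PowerSeries.subst (MvPowerSeries.X s : MvPowerSeries σ A)
        (PowerSeries.subst g (PowerSeries.exp ℚ) : PowerSeries A) =
      (PowerSeries.exp ℚ).subst (g.subst (MvPowerSeries.X s : MvPowerSeries σ A)) := by
  classical
  have hs : PowerSeries.HasSubst (MvPowerSeries.X s : MvPowerSeries σ A) := PowerSeries.HasSubst.X s
  have key := map_exp_subst_of_order
    ((PowerSeries.substAlgHom (R := A) hs).toRingHom : MvPowerSeries Unit A →+* MvPowerSeries σ A)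
    (fun n x hx => MvPowerSeries.nat_le_order fun d hd => ?_) hg
  · simpa [PowerSeries.coe_substAlgHom] using key
  · change MvPowerSeries.coeff d (PowerSeries.substAlgHom hs x) = 0
    rw [PowerSeries.coe_substAlgHom, PowerSeries.coeff_subst_single]
    split_ifs with h
    · refine MvPowerSeries.coeff_of_lt_order (lt_of_lt_of_le ?_ hx)
      rw [h] at hd
      simpa using hd
    · rfl

/-- `∑_{n ≥ 1} Zⁿ / n`, the logarithm of `(1 - Z)⁻¹`. -/
def logSeries (A : Type*) [CommRing A] [Algebra ℚ A] : PowerSeries A :=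
  PowerSeries.mk fun n => algebraMap ℚ A (n : ℚ)⁻¹

theorem constantCoeff_logSeries : PowerSeries.constantCoeff (logSeries A) = 0 := by
  rw [← PowerSeries.coeff_zero_eq_constantCoeff_apply, logSeries, PowerSeries.coeff_mk]
  simp

theorem exp_subst_logSeries : (PowerSeries.exp ℚ).subst (logSeries A) =
    PowerSeries.mk fun _ => (1 : A) := by
  suffices h : (PowerSeries.exp ℚ).subst (logSeries ℚ) = PowerSeries.mk fun _ => (1 : ℚ) by
    have h2 := congrArg (PowerSeries.map (algebraMap ℚ A)) h
    have h3 : PowerSeries.map (algebraMap ℚ A) ((PowerSeries.exp ℚ).subst (logSeries ℚ)) =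
      (PowerSeries.exp ℚ).subst (PowerSeries.map (algebraMap ℚ A) (logSeries ℚ)) :=
      map_exp_subst (τ := Unit) (algebraMap ℚ A) constantCoeff_logSeries
    rw [h3] at h2
    have h4 : PowerSeries.map (algebraMap ℚ A) (logSeries ℚ) = logSeries A := by
      ext n
      simp [logSeries]
    rw [h4] at h2
    rw [h2]
    ext n
    simp
  have hs : PowerSeries.HasSubst (logSeries ℚ) :=
    PowerSeries.HasSubst.of_constantCoeff_zero constantCoeff_logSeries
  have hder : PowerSeries.derivative ℚ (logSeries ℚ) = PowerSeries.mk fun _ => (1 : ℚ) := by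
    ext n
    rw [PowerSeries.coeff_derivative, logSeries, PowerSeries.coeff_mk, PowerSeries.coeff_mk]
    simp only [Algebra.algebraMap_self, RingHom.id_apply]
    push_cast
    field_simp
  have hgeo : (PowerSeries.mk fun _ => (1 : ℚ)) * (1 - PowerSeries.X) = 1 :=
    PowerSeries.mk_one_mul_one_sub_eq_one ℚ
  set f := (PowerSeries.exp ℚ).subst (logSeries ℚ) with hf
  have hfd : PowerSeries.derivative ℚ f = f * PowerSeries.mk fun _ => (1 : ℚ) := by
    rw [hf, PowerSeries.derivative_subst hs, PowerSeries.derivative_exp, hder]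
  have h1 : f * (1 - PowerSeries.X) = 1 := by
    apply PowerSeries.derivative.ext
    · rw [Derivation.leibniz, hfd, map_sub, PowerSeries.derivative_X]
      simp only [smul_eq_mul, Derivation.map_one_eq_zero]
      linear_combination f * hgeo
    · have h0 := PowerSeries.constantCoeff_subst hs (PowerSeries.exp ℚ)
      rw [map_mul, hf]
      change MvPowerSeries.constantCoeff _ * _ = _
      rw [h0, finsum_eq_single _ 0]
      · simp
      · intro n hn
        rw [map_pow]
        have : MvPowerSeries.constantCoeff (logSeries ℚ) = 0 := constantCoeff_logSeries
        rw [this, zero_pow hn, smul_zero]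
  calc f = f * ((PowerSeries.mk fun _ => (1 : ℚ)) * (1 - PowerSeries.X)) := by rw [hgeo, mul_one]
    _ = f * (1 - PowerSeries.X) * (PowerSeries.mk fun _ => (1 : ℚ)) := by ring
    _ = _ := by rw [h1, one_mul]

end PowerSeriesExp

/-! ### Partitions -/

namespace Ptn

theorem apply_eq_zero (lam : Ptn) {k : ℕ} (h : lam.length ≤ k) : lam.1 k = 0 := by
  by_contra h0
  have hsub : Finset.range (k + 1) ⊆ lam.1.support := by
    intro a ha
    rw [Finset.mem_range] at ha
    have := lam.2 (show a ≤ k by omega)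
    rw [Finsupp.mem_support_iff]
    omega
  have := Finset.card_le_card hsub
  rw [Finset.card_range] at this
  unfold Ptn.length at h
  omega

theorem length_le {lam : Ptn} {N : ℕ} (h : lam.1 N = 0) : lam.length ≤ N := by
  have hsub : lam.1.support ⊆ Finset.range N := by
    intro a ha
    rw [Finset.mem_range]
    by_contra hN
    have := lam.2 (not_lt.mp hN)
    rw [Finsupp.mem_support_iff] at ha
    omega
  simpa [Ptn.length] using Finset.card_le_card hsub

/-- The sum of the parts of a partition. -/
def size (lam : Ptn) : ℕ := lam.1.degree

theorem length_le_size (lam : Ptn) : lam.length ≤ lam.size := by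
  unfold Ptn.length Ptn.size
  rw [Finsupp.degree_apply, Finset.card_eq_sum_ones]
  refine Finset.sum_le_sum fun i hi => ?_
  have := Finsupp.mem_support_iff.mp hi
  omega

theorem size_eq_sum {lam : Ptn} {N : ℕ} (h : lam.length ≤ N) :
    lam.size = ∑ j : Fin N, lam.1 j := by
  unfold Ptn.size
  rw [Finsupp.degree_apply, Fin.sum_univ_eq_sum_range (fun j => lam.1 j)]
  refine Finset.sum_subset ?_ ?_
  · intro a ha
    rw [Finset.mem_range]
    by_contra hN
    exact Finsupp.mem_support_iff.mp ha (lam.apply_eq_zero (h.trans (not_lt.mp hN)))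
  · intro a _ ha
    simpa using ha

theorem finite_size_le (d : ℕ) : {lam : Ptn | lam.size ≤ d}.Finite := by
  refine Set.Finite.of_finite_image (f := Subtype.val) ?_ Subtype.val_injective.injOn
  refine (Set.finite_Iic (∑ k ∈ Finset.range d, Finsupp.single k d : ℕ →₀ ℕ)).subset ?_
  rintro _ ⟨lam, h, rfl⟩
  rw [Set.mem_Iic]
  intro k
  have h' : lam.size ≤ d := h
  rw [Finsupp.finsetSum_apply]
  by_cases hk : k < d
  · rw [Finset.sum_eq_single k (fun b _ hb => Finsupp.single_eq_of_ne hb.symm)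
      (fun hn => absurd (Finset.mem_range.mpr hk) hn), Finsupp.single_eq_same]
    exact (Finsupp.le_degree k lam.1).trans h'
  · rw [lam.apply_eq_zero (lam.length_le_size.trans (h'.trans (not_lt.mp hk)))]
    exact Nat.zero_le _

/-- A strictly decreasing sequence `c₀ > ⋯ > c_{N-1} > -N` has the form `c_j = λ_j - j`. -/
theorem exists_of_strictAnti {N : ℕ} (c : Fin N → ℤ) (hc : StrictAnti c)
    (hlow : ∀ j, 1 - (N : ℤ) ≤ c j) :
    ∃ lam : Ptn, lam.length ≤ N ∧ ∀ j : Fin N, c j = (lam.1 (j : ℕ) : ℤ) - (j : ℕ) := by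
  classical
  have hpos : ∀ j : Fin N, 0 ≤ c j + (j : ℕ) := by
    intro j
    by_contra hneg
    -- the `N - j` values `c_j > ⋯ > c_{N-1}` do not fit between `1 - N` and `-j - 1`
    have key : ∀ m : ℕ, ∀ h : (j : ℕ) + m < N, c ⟨j + m, h⟩ ≤ c j - m := by
      intro m
      induction m with
      | zero => intro h; simp
      | succ m ih =>
        intro h
        have h1 := ih (by omega)
        have h2 : c ⟨j + (m + 1), h⟩ < c ⟨j + m, by omega⟩ := hc (by simp [Fin.lt_def])
        push_cast
        omega
    have hj := j.2
    have h1 := key (N - 1 - j) (by omega)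
    have h2 := hlow ⟨j + (N - 1 - j), by omega⟩
    push_cast [show (j : ℕ) ≤ N - 1 by omega, show 1 ≤ N by omega] at h1 h2
    omega
  have hanti : Antitone fun k : ℕ => if h : k < N then (c ⟨k, h⟩ + k).toNat else 0 := by
    refine antitone_nat_of_succ_le fun k => ?_
    by_cases h : k + 1 < N
    · have h2 : c ⟨k + 1, h⟩ < c ⟨k, by omega⟩ := hc (by simp [Fin.lt_def])
      simp only [h, show k < N by omega, dif_pos]
      push_cast
      omega
    · simp [h]
  refine ⟨⟨Finsupp.onFinset (Finset.range N)
    (fun k : ℕ => if h : k < N then (c ⟨k, h⟩ + k).toNat else 0) ?_, hanti⟩, ?_, ?_⟩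
  · intro k hk
    rw [Finset.mem_range]
    by_contra h
    simp [h] at hk
  · apply length_le
    simp
  · intro j
    have := hpos j
    simp only [Finsupp.onFinset_apply, j.2, dif_pos, Fin.eta]
    omega

theorem ext_of_length_le {lam mu : Ptn} {N : ℕ} (hl : lam.length ≤ N) (hm : mu.length ≤ N)
    (h : ∀ j : Fin N, lam.1 j = mu.1 j) : lam = mu := by
  apply Subtype.ext
  ext k
  by_cases hk : k < N
  · exact h ⟨k, hk⟩
  · rw [lam.apply_eq_zero (hl.trans (not_lt.mp hk)), mu.apply_eq_zero (hm.trans (not_lt.mp hk))]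

end Ptn

/-! ### Determinants in the complete functions -/

theorem complete_of_neg {j : ℤ} (h : j < 0) : complete j = 0 := by
  rw [complete, if_neg (not_le.mpr h)]

/-- The generating series `∑_j S_j(x) Zʲ = exp (∑ xₙ Zⁿ)`. -/
def completeSeries : PowerSeries B := (PowerSeries.exp ℚ).subst xSeries

theorem constantCoeff_xSeries : PowerSeries.constantCoeff xSeries = 0 := by
  rw [← PowerSeries.coeff_zero_eq_constantCoeff_apply, xSeries, PowerSeries.coeff_mk]
  simp

theorem complete_natCast (n : ℕ) : complete n = PowerSeries.coeff n completeSeries := by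
  rw [complete, if_pos (Int.natCast_nonneg n), Int.toNat_natCast, completeSeries]

theorem constantCoeff_exp_subst {A : Type*} [CommRing A] [Algebra ℚ A] {g : PowerSeries A}
    (hg : PowerSeries.constantCoeff g = 0) :
    PowerSeries.constantCoeff ((PowerSeries.exp ℚ).subst g : PowerSeries A) = 1 := by
  have hs : PowerSeries.HasSubst g := PowerSeries.HasSubst.of_constantCoeff_zero' hg
  have h0 := PowerSeries.constantCoeff_subst hs (PowerSeries.exp ℚ)
  change MvPowerSeries.constantCoeff _ = _
  rw [h0, finsum_eq_single _ 0]
  · simp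
  · intro n hn
    rw [map_pow]
    have : MvPowerSeries.constantCoeff g = 0 := hg
    rw [this, zero_pow hn, smul_zero]

theorem complete_zero : complete 0 = 1 := by
  have := complete_natCast 0
  rw [Nat.cast_zero] at this
  rw [this, PowerSeries.coeff_zero_eq_constantCoeff_apply, completeSeries,
    constantCoeff_exp_subst constantCoeff_xSeries]

/-- The determinant `det (S_{c_j + i})` with `N` rows and columns. It represents the semi-infinite
monomial `X^{c₀} ∧ ⋯ ∧ X^{c_{N-1}} ∧ X^{-N} ∧ X^{-N-1} ∧ ⋯`. -/
def hdet (N : ℕ) (c : Fin N → ℤ) : B :=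
  Matrix.det (Matrix.of fun i j : Fin N => complete (c j + (i : ℤ)))

theorem hdet_succ {N : ℕ} (c : Fin (N + 1) → ℤ) (h : c (Fin.last N) = -N) :
    hdet (N + 1) c = hdet N (fun j => c j.castSucc) := by
  unfold hdet
  rw [Matrix.det_succ_column _ (Fin.last N), Finset.sum_eq_single (Fin.last N)]
  · simp only [Matrix.of_apply, h, Fin.val_last, neg_add_cancel, complete_zero, mul_one]
    rw [← two_mul, pow_mul, neg_one_sq, one_pow, one_mul]
    congr 1
    ext i j
    simp [Fin.succAbove_last]
  · intro i _ hi
    have : (i : ℕ) < N := Fin.val_lt_last hi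
    simp only [Matrix.of_apply, h]
    rw [complete_of_neg (by omega)]
    ring
  · simp

theorem hdet_perm {N : ℕ} (c : Fin N → ℤ) (σ : Equiv.Perm (Fin N)) :
    hdet N (fun j => c (σ j)) = (Equiv.Perm.sign σ : ℤ) * hdet N c := by
  have := Matrix.det_permute' σ (Matrix.of fun i j : Fin N => complete (c j + (i : ℤ)))
  unfold hdet
  rw [← this]
  rfl

theorem hdet_of_eq {N : ℕ} (c : Fin N → ℤ) {i j : Fin N} (hij : i ≠ j) (h : c i = c j) :
    hdet N c = 0 :=
  Matrix.det_zero_of_column_eq hij fun k => by simp [h]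

theorem schurB_eq_hdet {lam : Ptn} {N : ℕ} (h : lam.length ≤ N) :
    schurB lam = hdet N (fun j => (lam.1 (j : ℕ) : ℤ) - (j : ℕ)) := by
  induction N, h using Nat.le_induction with
  | base => rfl
  | succ N hN ih =>
    rw [hdet_succ, ih]
    · rfl
    · simp [lam.apply_eq_zero hN]

/-! ### Alternants as power series -/

/-- The exponent vector with entries `e₀, …, e_{N-1}, 0, 0, …`. -/
def expVec {N : ℕ} (e : Fin N → ℕ) : ℕ →₀ ℕ := ∑ i : Fin N, Finsupp.single (i : ℕ) (e i)

theorem expVec_apply {N : ℕ} (e : Fin N → ℕ) (i : Fin N) : expVec e i = e i := by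
  rw [expVec, Finsupp.finsetSum_apply, Finset.sum_eq_single i, Finsupp.single_eq_same]
  · intro j _ hj
    exact Finsupp.single_eq_of_ne fun h => hj (Fin.ext h.symm)
  · simp

theorem expVec_apply_of_le {N : ℕ} (e : Fin N → ℕ) {k : ℕ} (hk : N ≤ k) : expVec e k = 0 := by
  rw [expVec, Finsupp.finsetSum_apply]
  exact Finset.sum_eq_zero fun j _ => Finsupp.single_eq_of_ne (by have := j.2; omega)

theorem expVec_injective {N : ℕ} : Function.Injective (expVec (N := N)) := fun e f h => by
  funext i
  rw [← expVec_apply e, ← expVec_apply f, h]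

theorem degree_expVec {N : ℕ} (e : Fin N → ℕ) : (expVec e).degree = ∑ i, e i := by
  rw [expVec, map_sum]
  simp

theorem eq_expVec {N : ℕ} {β : ℕ →₀ ℕ} (h : ∀ k, N ≤ k → β k = 0) :
    β = expVec fun i : Fin N => β i := by
  ext k
  by_cases hk : k < N
  · exact (expVec_apply (fun i : Fin N => β i) ⟨k, hk⟩).symm
  · rw [h k (not_lt.mp hk), expVec_apply_of_le _ (not_lt.mp hk)]

/-- The staircase `(N - 1, …, 1, 0)`. -/
def staircase (N : ℕ) (j : Fin N) : ℕ := N - 1 - j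

theorem staircase_injective (N : ℕ) : Function.Injective (staircase N) := fun i j h => by
  have hi := i.2
  have hj := j.2
  unfold staircase at h
  ext
  omega

section Alternant

variable (A : Type*) [CommRing A] [Algebra ℚ A]

/-- Polynomials in `t` with rational coefficients, as power series over a `ℚ`-algebra. -/
def toSeries : MvPolynomial ℕ ℚ →+* MvPowerSeries ℕ A :=
  (MvPowerSeries.map (algebraMap ℚ A)).comp MvPolynomial.coeToMvPowerSeries.ringHom

theorem coeff_toSeries (p : MvPolynomial ℕ ℚ) (β : ℕ →₀ ℕ) :
    MvPowerSeries.coeff β (toSeries A p) = algebraMap ℚ A (p.coeff β) := by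
  simp [toSeries]

theorem alternant_eq_sum (N : ℕ) (e : Fin N → ℕ) :
    alternant N e = ∑ σ : Equiv.Perm (Fin N), (Equiv.Perm.sign σ : ℤ) •
      ∏ i : Fin N, (MvPolynomial.X (i : ℕ) : MvPolynomial ℕ ℚ) ^ e (σ i) := by
  rw [alternant, ← Matrix.det_transpose, Matrix.det_apply]
  rfl

theorem coeff_alternant (N : ℕ) (e : Fin N → ℕ) (β : ℕ →₀ ℕ) :
    (alternant N e).coeff β = ∑ σ : Equiv.Perm (Fin N), (Equiv.Perm.sign σ : ℤ) •
      if β = expVec (fun i => e (σ i)) then (1 : ℚ) else 0 := by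
  classical
  rw [alternant_eq_sum, MvPolynomial.coeff_sum]
  refine Finset.sum_congr rfl fun σ _ => ?_
  rw [MvPolynomial.coeff_smul]
  congr 1
  have : ∏ i : Fin N, (MvPolynomial.X (i : ℕ) : MvPolynomial ℕ ℚ) ^ e (σ i) =
      MvPolynomial.monomial (expVec fun i => e (σ i)) 1 := by
    simp_rw [MvPolynomial.X_pow_eq_monomial]
    rw [← MvPolynomial.monomial_sum_one]
    rfl
  rw [this, MvPolynomial.coeff_monomial]
  simp only [eq_comm]

theorem coeff_alternant_of_degree {N : ℕ} {e : Fin N → ℕ} {β : ℕ →₀ ℕ}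
    (h : β.degree ≠ ∑ i, e i) : (alternant N e).coeff β = 0 := by
  rw [coeff_alternant]
  refine Finset.sum_eq_zero fun σ _ => ?_
  rw [if_neg, smul_zero]
  rintro rfl
  apply h
  rw [degree_expVec]
  exact Equiv.sum_comp σ e

theorem coeff_alternant_self {N : ℕ} {e : Fin N → ℕ} (he : Function.Injective e) :
    (alternant N e).coeff (expVec e) = 1 := by
  rw [coeff_alternant, Finset.sum_eq_single 1]
  · simp
  · intro σ _ hσ
    rw [if_neg, smul_zero]
    intro h
    apply hσ
    ext i
    have := congrFun (expVec_injective h) i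
    rw [Equiv.Perm.one_apply, ← he this]
  · simp

variable [NoZeroDivisors A] [Nontrivial A]

/-- Division by the Vandermonde determinant lowers all degrees by the degree of the staircase. -/
theorem coeff_eq_zero_of_alternant_mul {N d : ℕ} {x : MvPowerSeries ℕ A}
    (h : ∀ β : ℕ →₀ ℕ, β.degree < d + ∑ i, staircase N i →
      MvPowerSeries.coeff β (toSeries A (alternant N (staircase N)) * x) = 0)
    {β : ℕ →₀ ℕ} (hβ : β.degree < d) : MvPowerSeries.coeff β x = 0 := by
  have h1 := MvPowerSeries.nat_le_order h
  rw [MvPowerSeries.order_mul] at h1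
  have h2 : (toSeries A (alternant N (staircase N))).order ≤ ((∑ i, staircase N i : ℕ) : ℕ∞) := by
    rw [← degree_expVec]
    apply MvPowerSeries.order_le
    rw [coeff_toSeries, coeff_alternant_self (staircase_injective N), map_one]
    exact one_ne_zero
  apply MvPowerSeries.coeff_of_lt_order
  refine lt_of_lt_of_le (Nat.cast_lt.mpr hβ) ?_
  rw [Nat.cast_add, add_comm] at h1
  exact (ENat.add_le_add_iff_left (ENat.natCast_ne_top _)).mp (h1.trans (add_le_add_left h2 _))

end Alternant

/-! ### The Cauchy identity -/

/-- The Schur polynomial of `λ` has no terms of degree less than `|λ|`. -/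
theorem coeff_schurPoly_eq_zero {N : ℕ} {lam : Ptn} (hl : lam.length ≤ N) {β : ℕ →₀ ℕ}
    (hβ : β.degree < lam.size) : (schurPoly N lam).coeff β = 0 := by
  have h := coeff_eq_zero_of_alternant_mul ℚ (N := N) (d := lam.size)
    (x := toSeries ℚ (schurPoly N lam)) (fun γ hγ => by
      rw [← map_mul]
      have := schurPoly_spec N lam
      change _ = alternant N (staircase N) * _ at this
      rw [← this, coeff_toSeries, coeff_alternant_of_degree, map_zero]
      rw [Finset.sum_add_distrib, ← Ptn.size_eq_sum hl]
      exact hγ.ne) hβ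
  rwa [coeff_toSeries] at h

theorem coeff_prod_subst {A : Type*} [CommRing A] {N : ℕ} (f : Fin N → PowerSeries A)
    (β : ℕ →₀ ℕ) [Decidable (∀ k, N ≤ k → β k = 0)] :
    MvPowerSeries.coeff β
      (∏ i : Fin N, (f i).subst (MvPowerSeries.X (i : ℕ) : MvPowerSeries ℕ A)) =
      if ∀ k, N ≤ k → β k = 0 then ∏ i : Fin N, PowerSeries.coeff (β i) (f i) else 0 := by
  classical
  rw [MvPowerSeries.coeff_prod]
  have hzero : ∀ l ∈ Finset.finsuppAntidiag (Finset.univ : Finset (Fin N)) β,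
      ∏ i, MvPowerSeries.coeff (l i)
        ((f i).subst (MvPowerSeries.X (i : ℕ) : MvPowerSeries ℕ A)) ≠ 0 →
      ∀ i, l i = Finsupp.single (i : ℕ) (β i) := by
    intro l hl h0
    have h1 : ∀ i, l i = Finsupp.single (i : ℕ) (l i i) := by
      intro i
      by_contra hne
      refine h0 (Finset.prod_eq_zero (Finset.mem_univ i) ?_)
      rw [PowerSeries.coeff_subst_single, if_neg hne]
    have hsum := (Finset.mem_finsuppAntidiag.mp hl).1
    intro i
    rw [h1 i]
    congr 1
    rw [← hsum, Finsupp.finsetSum_apply, Finset.sum_eq_single i]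
    · intro j _ hj
      rw [h1 j]
      exact Finsupp.single_eq_of_ne fun h => hj (Fin.ext h.symm)
    · simp
  split_ifs with hβ
  · rw [Finset.sum_eq_single
      (Finsupp.equivFunOnFinite.symm fun i : Fin N => Finsupp.single (i : ℕ) (β i))]
    · refine Finset.prod_congr rfl fun i _ => ?_
      rw [PowerSeries.coeff_subst_single]
      simp
    · intro l hl hne
      by_contra h0
      apply hne
      ext1 i
      rw [hzero l hl h0 i]
      rfl
    · intro hn
      refine absurd (Finset.mem_finsuppAntidiag.mpr ⟨?_, Finset.subset_univ _⟩) hn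
      exact (eq_expVec hβ).symm
  · refine Finset.sum_eq_zero fun l hl => ?_
    by_contra h0
    apply hβ
    have h1 := hzero l hl h0
    have hsum := (Finset.mem_finsuppAntidiag.mp hl).1
    intro k hk
    rw [← hsum, Finsupp.finsetSum_apply]
    refine Finset.sum_eq_zero fun j _ => ?_
    rw [h1 j]
    exact Finsupp.single_eq_of_ne (by have := j.2; omega)

theorem coeff_X_pow_mul_completeSeries (m n : ℕ) :
    PowerSeries.coeff n (PowerSeries.X ^ m * completeSeries) = complete ((n : ℤ) - m) := by
  rw [PowerSeries.coeff_X_pow_mul']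
  split_ifs with h
  · rw [← complete_natCast, Nat.cast_sub h]
  · rw [complete_of_neg (by omega)]

/-- The coefficients of the product of the Vandermonde determinant with `∏ᵢ ∑_j S_j(x) tᵢʲ`. -/
theorem coeff_alternant_mul_prod (N : ℕ) (β : ℕ →₀ ℕ) [Decidable (∀ k, N ≤ k → β k = 0)] :
    MvPowerSeries.coeff β (toSeries B (alternant N (staircase N)) *
      ∏ i : Fin N, completeSeries.subst (MvPowerSeries.X (i : ℕ) : MvPowerSeries ℕ B)) =
      if ∀ k, N ≤ k → β k = 0 then hdet N (fun i => (β i : ℤ) - N + 1) else 0 := by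
  rw [alternant_eq_sum, map_sum, Finset.sum_mul, map_sum]
  have hterm : ∀ σ : Equiv.Perm (Fin N),
      MvPowerSeries.coeff β (toSeries B ((Equiv.Perm.sign σ : ℤ) •
        ∏ i : Fin N, (MvPolynomial.X (i : ℕ) : MvPolynomial ℕ ℚ) ^ staircase N (σ i)) *
        ∏ i : Fin N, completeSeries.subst (MvPowerSeries.X (i : ℕ) : MvPowerSeries ℕ B)) =
      if ∀ k, N ≤ k → β k = 0 then (Equiv.Perm.sign σ : ℤ) •
        ∏ i : Fin N, complete ((β i : ℤ) - N + 1 + (σ i : ℕ)) else 0 := by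
    intro σ
    rw [map_zsmul, smul_mul_assoc, map_zsmul, map_prod, ← Finset.prod_mul_distrib]
    have : ∀ i : Fin N, toSeries B ((MvPolynomial.X (i : ℕ)) ^ staircase N (σ i)) *
        completeSeries.subst (MvPowerSeries.X (i : ℕ) : MvPowerSeries ℕ B) =
        (PowerSeries.X ^ staircase N (σ i) * completeSeries).subst
          (MvPowerSeries.X (i : ℕ) : MvPowerSeries ℕ B) := by
      intro i
      have hs : PowerSeries.HasSubst (MvPowerSeries.X (i : ℕ) : MvPowerSeries ℕ B) :=
        PowerSeries.HasSubst.X _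
      rw [PowerSeries.subst_mul hs, PowerSeries.subst_pow hs, PowerSeries.subst_X hs]
      simp [toSeries]
    rw [Finset.prod_congr rfl fun i _ => this i, coeff_prod_subst]
    split_ifs
    · congr 1
      refine Finset.prod_congr rfl fun i _ => ?_
      rw [coeff_X_pow_mul_completeSeries]
      congr 1
      have := (σ i).2
      unfold staircase
      omega
    · simp
  rw [Finset.sum_congr rfl fun σ _ => hterm σ]
  split_ifs
  · rw [hdet, Matrix.det_apply]
    refine Finset.sum_congr rfl fun σ _ => ?_
    rfl
  · simp

open scoped Classical in
/-- The partitions of length at most `N` and size at most `d`. -/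
def boundedPtns (N d : ℕ) : Finset Ptn :=
  (Ptn.finite_size_le d).toFinset.filter fun lam => lam.length ≤ N

theorem mem_boundedPtns {N d : ℕ} {lam : Ptn} :
    lam ∈ boundedPtns N d ↔ lam.size ≤ d ∧ lam.length ≤ N := by
  simp [boundedPtns]

/-- Up to sign, `det (S_{β_i - N + 1 + k})` is `S_λ(x)` for the partition `λ` with
`λ + (N - 1, …, 0)` a rearrangement of `β`. -/
theorem hdet_eq_sum_alternant {N d : ℕ} {β : ℕ →₀ ℕ} (hβ : ∀ k, N ≤ k → β k = 0)
    (hd : β.degree ≤ d + ∑ i, staircase N i) :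
    hdet N (fun i => (β i : ℤ) - N + 1) = ∑ lam ∈ boundedPtns N d,
      (alternant N (fun j => lam.1 j + staircase N j)).coeff β • schurB lam := by
  classical
  set e : Fin N → ℕ := fun i => β i with he
  have hβe : β = expVec e := eq_expVec hβ
  have hstrict : ∀ lam : Ptn, StrictAnti fun j : Fin N => lam.1 j + staircase N j := by
    intro lam i j hij
    have h1 := lam.2 (show (i : ℕ) ≤ j from hij.le)
    have h2 := j.2
    have h3 : (i : ℕ) < j := hij
    simp only [staircase]
    omega
  by_cases hinj : Function.Injective e
  · -- sort the exponents in decreasing order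
    set σ : Equiv.Perm (Fin N) := Fin.revPerm.trans (Tuple.sort e) with hσ
    have hmono : StrictMono (e ∘ Tuple.sort e) :=
      (Tuple.monotone_sort e).strictMono_of_injective (hinj.comp (Tuple.sort e).injective)
    have hanti : StrictAnti fun j => e (σ j) := by
      intro i j hij
      exact hmono (Fin.rev_lt_rev.mpr hij)
    obtain ⟨mu, hmu, hmue⟩ := Ptn.exists_of_strictAnti (fun j => (e (σ j) : ℤ) - N + 1)
      (fun i j hij => by have := hanti hij; simp only at this ⊢; omega) (fun j => by omega)
    have hemu : ∀ j, e (σ j) = mu.1 j + staircase N j := by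
      intro j
      have := hmue j
      have h2 := j.2
      unfold staircase
      omega
    have hsize : mu.size ≤ d := by
      rw [hβe, degree_expVec, ← Equiv.sum_comp σ, Finset.sum_congr rfl fun j _ => hemu j,
        Finset.sum_add_distrib, ← Ptn.size_eq_sum hmu] at hd
      omega
    have huniq : ∀ (lam : Ptn) (τ : Equiv.Perm (Fin N)), lam.length ≤ N →
        β = expVec (fun i => lam.1 (τ i) + staircase N (τ i)) → lam = mu ∧ τ = σ.symm := by
      intro lam τ hlam h
      have h1 : ∀ i, e i = lam.1 (τ i) + staircase N (τ i) := by
        intro i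
        rw [hβe] at h
        exact congrFun (expVec_injective h) i
      have h2 : ∀ j, lam.1 (τ (σ j)) + staircase N (τ (σ j)) = mu.1 j + staircase N j :=
        fun j => by rw [← h1, hemu]
      have h3 : StrictMono fun j => τ (σ j) := by
        intro i j hij
        by_contra hn
        have a1 := (hstrict lam).antitone (not_lt.mp hn)
        have a2 := hstrict mu hij
        have b1 := h2 i
        have b2 := h2 j
        dsimp only at a1 a2
        omega
      have h4 : ∀ j, τ (σ j) = j := by
        intro j
        have hr : Set.range (fun j => τ (σ j)) = Set.range (id : Fin N → Fin N) := by
          rw [Set.range_id]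
          exact ((τ : Equiv.Perm (Fin N)).surjective.comp σ.surjective).range_eq
        have := (StrictMono.range_inj h3 strictMono_id).mp hr
        exact congrFun this j
      refine ⟨Ptn.ext_of_length_le hlam hmu fun j => ?_, ?_⟩
      · have := h2 j
        rw [h4] at this
        omega
      · ext i
        have := h4 (σ.symm i)
        rw [Equiv.apply_symm_apply] at this
        rw [this]
    have hcoeff : (alternant N (fun j => mu.1 j + staircase N j)).coeff β =
        ((Equiv.Perm.sign σ : ℤ) : ℚ) := by
      rw [coeff_alternant, Finset.sum_eq_single σ.symm]
      · rw [if_pos, Equiv.Perm.sign_symm]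
        · simp
        · rw [hβe]
          congr 1
          funext i
          rw [← hemu, Equiv.apply_symm_apply]
      · intro τ _ hτ
        rw [if_neg fun h => hτ (huniq mu τ hmu h).2, smul_zero]
      · simp
    rw [Finset.sum_eq_single mu]
    · rw [hcoeff, schurB_eq_hdet hmu]
      have h1 := hdet_perm (fun i => (e i : ℤ) - N + 1) σ
      simp only [hmue] at h1
      rw [h1]
      rcases Int.units_eq_one_or (Equiv.Perm.sign σ) with h | h <;> simp [h, he]
    · intro lam hlam hne
      rw [coeff_alternant, Finset.sum_eq_zero, zero_smul]
      intro τ _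
      rw [if_neg fun h => hne (huniq lam τ (mem_boundedPtns.mp hlam).2 h).1, smul_zero]
    · intro h
      exact absurd (mem_boundedPtns.mpr ⟨hsize, hmu⟩) h
  · have hinj' := hinj
    rw [Function.not_injective_iff] at hinj'
    obtain ⟨i, j, hij, hne⟩ := hinj'
    have h0 : hdet N (fun i => (β i : ℤ) - N + 1) = 0 :=
      hdet_of_eq _ hne (by simp only [he] at hij; rw [hij])
    rw [h0]
    symm
    refine Finset.sum_eq_zero fun lam _ => ?_
    rw [coeff_alternant, Finset.sum_eq_zero, zero_smul]
    intro τ _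
    rw [if_neg, smul_zero]
    intro h
    apply hinj
    rw [hβe] at h
    rw [expVec_injective h]
    exact (hstrict lam).injective.comp τ.injective

/-- The Cauchy identity `∏_{i < N} (∑_j S_j(x) tᵢʲ) = ∑_λ S_λ(x) s_λ(t)`, coefficient by
coefficient. -/
theorem cauchy_identity (N : ℕ) (β : ℕ →₀ ℕ) {d : ℕ} (hd : β.degree ≤ d) :
    MvPowerSeries.coeff β
      (∏ i : Fin N, completeSeries.subst (MvPowerSeries.X (i : ℕ) : MvPowerSeries ℕ B)) =
      ∑ lam ∈ boundedPtns N d, (schurPoly N lam).coeff β • schurB lam := by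
  classical
  set P := ∏ i : Fin N, completeSeries.subst (MvPowerSeries.X (i : ℕ) : MvPowerSeries ℕ B)
  set S := ∑ lam ∈ boundedPtns N d, MvPowerSeries.C (schurB lam) * toSeries B (schurPoly N lam)
    with hS
  have hC : ∀ (b : B) (p : MvPolynomial ℕ ℚ) (γ : ℕ →₀ ℕ),
      MvPowerSeries.coeff γ (MvPowerSeries.C b * toSeries B p) = p.coeff γ • b := by
    intro b p γ
    rw [MvPowerSeries.coeff_C_mul, coeff_toSeries, Algebra.smul_def, mul_comm]
  have h := coeff_eq_zero_of_alternant_mul B (N := N) (d := d + 1) (x := P - S) (fun γ hγ => by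
    rw [mul_sub, map_sub, coeff_alternant_mul_prod, sub_eq_zero, hS, Finset.mul_sum, map_sum]
    have hterm : ∀ lam : Ptn, MvPowerSeries.coeff γ (toSeries B (alternant N (staircase N)) *
        (MvPowerSeries.C (schurB lam) * toSeries B (schurPoly N lam))) =
        (alternant N (fun j => lam.1 j + staircase N j)).coeff γ • schurB lam := by
      intro lam
      rw [mul_left_comm, ← map_mul]
      have := schurPoly_spec N lam
      change alternant N (fun j => lam.1 j + staircase N j) = alternant N (staircase N) * _ at this
      rw [← this, hC]
    rw [Finset.sum_congr rfl fun lam _ => hterm lam]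
    split_ifs with hsupp
    · exact hdet_eq_sum_alternant hsupp (by omega)
    · symm
      refine Finset.sum_eq_zero fun lam _ => ?_
      rw [coeff_alternant, Finset.sum_eq_zero, zero_smul]
      intro τ _
      rw [if_neg, smul_zero]
      rintro rfl
      exact hsupp fun k hk => expVec_apply_of_le _ hk) (β := β) (by omega)
  rw [map_sub, sub_eq_zero] at h
  rw [h, hS, map_sum]
  exact Finset.sum_congr rfl fun lam _ => hC _ _ _

/-! ### Stability of Schur polynomials -/

/-- Setting `t_N = 0`. -/
def killVar (N : ℕ) : MvPolynomial ℕ ℚ →ₐ[ℚ] MvPolynomial ℕ ℚ :=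
  MvPolynomial.aeval fun k => if k = N then 0 else MvPolynomial.X k

theorem coeff_killVar {N : ℕ} (p : MvPolynomial ℕ ℚ) {β : ℕ →₀ ℕ} (h : β N = 0) :
    (killVar N p).coeff β = p.coeff β := by
  classical
  induction p using MvPolynomial.induction_on' with
  | add p q hp hq => rw [map_add, MvPolynomial.coeff_add, MvPolynomial.coeff_add, hp, hq]
  | monomial γ a =>
    rw [killVar, MvPolynomial.aeval_monomial]
    by_cases hγ : γ N = 0
    · have : (γ.prod fun k n => (if k = N then 0 else MvPolynomial.X k : MvPolynomial ℕ ℚ) ^ n) =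
          γ.prod fun k n => MvPolynomial.X k ^ n := by
        refine Finset.prod_congr rfl fun k hk => ?_
        dsimp only
        rw [if_neg]
        rintro rfl
        exact Finsupp.mem_support_iff.mp hk hγ
      rw [this, MvPolynomial.monomial_eq]
      rfl
    · have : (γ.prod fun k n => (if k = N then 0 else MvPolynomial.X k : MvPolynomial ℕ ℚ) ^ n) =
          0 := by
        refine Finset.prod_eq_zero (Finsupp.mem_support_iff.mpr hγ) ?_
        dsimp only
        rw [if_pos rfl, zero_pow hγ]
      rw [this, mul_zero, MvPolynomial.coeff_zero, MvPolynomial.coeff_monomial, if_neg]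
      rintro rfl
      exact hγ h

/-- The row of `t_N` becomes `(0, …, 0, 1)`. -/
theorem killVar_alternant {N : ℕ} {f : ℕ → ℕ} (h : f N = 0) :
    killVar N (alternant (N + 1) (fun j => f j + staircase (N + 1) j)) =
      (∏ i : Fin N, MvPolynomial.X (i : ℕ)) *
        alternant N (fun j => f j + staircase N j) := by
  rw [alternant, AlgHom.map_det, Matrix.det_succ_row _ (Fin.last N),
    Finset.sum_eq_single (Fin.last N)]
  · have hlast : f N + staircase (N + 1) (Fin.last N) = 0 := by simp [h, staircase]
    simp only [AlgHom.mapMatrix_apply, Matrix.map_apply, Matrix.of_apply, Fin.val_last, hlast,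
      pow_zero, map_one, mul_one]
    rw [← two_mul, pow_mul, neg_one_sq, one_pow, one_mul, alternant, ← Matrix.det_mul_column]
    congr 1
    ext1 i j
    have hi := i.2
    have hj := j.2
    have hexp : f j + staircase (N + 1) j.castSucc = f j + staircase N j + 1 := by
      simp only [staircase, Fin.val_castSucc]
      omega
    simp only [Matrix.submatrix_apply, Matrix.map_apply, Matrix.of_apply, Fin.succAbove_last,
      Fin.val_castSucc, hexp, map_pow]
    rw [killVar, MvPolynomial.aeval_X, if_neg (by omega), pow_succ']
  · intro j _ hj
    have hj' : (j : ℕ) < N := Fin.val_lt_last hj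
    simp only [AlgHom.mapMatrix_apply, Matrix.map_apply, Matrix.of_apply, Fin.val_last, map_pow]
    rw [killVar, MvPolynomial.aeval_X, if_pos rfl, zero_pow (by simp only [staircase]; omega)]
    ring
  · simp

theorem killVar_schurPoly {N : ℕ} {lam : Ptn} (h : lam.length ≤ N) :
    killVar N (schurPoly (N + 1) lam) = schurPoly N lam := by
  have h1 := congrArg (killVar N) (schurPoly_spec (N + 1) lam)
  have h2 := schurPoly_spec N lam
  change killVar N (alternant (N + 1) (fun j => lam.1 j + staircase (N + 1) j)) =
    killVar N (alternant (N + 1) (staircase (N + 1)) * _) at h1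
  change alternant N (fun j => lam.1 j + staircase N j) = alternant N (staircase N) * _ at h2
  have h3 := killVar_alternant (N := N) (f := fun _ => 0) rfl
  simp only [zero_add] at h3
  rw [map_mul, killVar_alternant (f := lam.1) (lam.apply_eq_zero h), h2] at h1
  change _ = killVar N (alternant (N + 1) fun j => staircase (N + 1) j) * _ at h1
  rw [h3, ← mul_assoc] at h1
  refine (mul_left_cancel₀ ?_ h1).symm
  refine mul_ne_zero (Finset.prod_ne_zero_iff.mpr fun i _ => MvPolynomial.X_ne_zero _) ?_
  intro h0
  have := coeff_alternant_self (staircase_injective N)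
  rw [show alternant N (staircase N) = 0 from h0, MvPolynomial.coeff_zero] at this
  exact zero_ne_one this

/-- Schur polynomials are stable under adjoining variables that do not occur in `t^β`. -/
theorem coeff_schurPoly_stable {M N : ℕ} {lam : Ptn} {β : ℕ →₀ ℕ} (hMN : M ≤ N)
    (hlam : lam.length ≤ M) (hβ : ∀ k, M ≤ k → β k = 0) :
    (schurPoly N lam).coeff β = (schurPoly M lam).coeff β := by
  induction N, hMN using Nat.le_induction with
  | base => rfl
  | succ N hN ih => rw [← ih, ← killVar_schurPoly (hlam.trans hN), coeff_killVar _ (hβ N hN)]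

/-! ### The exponential of the differential operator -/

theorem diffOp_diffOp_X (a : ℕ+ ⊕ Fin 2) : diffOp (diffOp (MvPolynomial.X a)) = 0 := by
  rcases a with n | b
  · simp [diffOp, MvPolynomial.mkDerivation_X, Derivation.leibniz_pow]
  · simp [diffOp, MvPolynomial.mkDerivation_X]

theorem iterate_diffOp_mul (k : ℕ) (f x : BInv) (hx : diffOp (diffOp x) = 0) :
    (⇑diffOp)^[k + 1] (f * x) = (⇑diffOp)^[k + 1] f * x +
      ((k + 1 : ℕ) : BInv) * ((⇑diffOp)^[k] f * diffOp x) := by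
  induction k with
  | zero =>
    simp only [zero_add, Function.iterate_one, Function.iterate_zero, id_eq, Nat.cast_one, one_mul,
      Derivation.leibniz, smul_eq_mul]
    ring
  | succ k ih =>
    rw [Function.iterate_succ_apply', ih, Function.iterate_succ_apply' _ (k + 1),
      Function.iterate_succ_apply' _ k]
    simp [Derivation.leibniz, hx]
    ring

theorem iterate_diffOp_add (k : ℕ) (f g : BInv) :
    (⇑diffOp)^[k] (f + g) = (⇑diffOp)^[k] f + (⇑diffOp)^[k] g := by
  induction k generalizing f g with
  | zero => rfl
  | succ k ih => simp only [Function.iterate_succ_apply, map_add, ih]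

/-- The `k`-th partial sum of `exp D`. -/
def diffSum (k : ℕ) (f : BInv) : BInv :=
  ∑ i ∈ Finset.range k, ((i.factorial : ℚ)⁻¹) • (⇑diffOp)^[i] f

theorem diffSum_add (k : ℕ) (f g : BInv) : diffSum k (f + g) = diffSum k f + diffSum k g := by
  simp only [diffSum, iterate_diffOp_add, smul_add, Finset.sum_add_distrib]

theorem diffSum_mul (k : ℕ) (f x : BInv) (hx : diffOp (diffOp x) = 0) :
    diffSum (k + 1) (f * x) = diffSum (k + 1) f * x + diffSum k f * diffOp x := by
  unfold diffSum
  rw [Finset.sum_range_succ', Finset.sum_range_succ' _ k]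
  have h : ∀ i, (((i + 1).factorial : ℚ)⁻¹) • (⇑diffOp)^[i + 1] (f * x) =
      (((i + 1).factorial : ℚ)⁻¹) • (⇑diffOp)^[i + 1] f * x +
        ((i.factorial : ℚ)⁻¹) • (⇑diffOp)^[i] f * diffOp x := by
    intro i
    rw [iterate_diffOp_mul i f x hx, smul_add, smul_mul_assoc, smul_mul_assoc]
    congr 1
    rw [← nsmul_eq_mul, ← Nat.cast_smul_eq_nsmul ℚ, smul_smul]
    congr 1
    rw [Nat.factorial_succ]
    push_cast
    field_simp
  rw [Finset.sum_congr rfl fun i _ => h i, Finset.sum_add_distrib, ← Finset.sum_mul,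
    ← Finset.sum_mul]
  simp only [Nat.factorial_zero, Nat.cast_one, inv_one, one_smul, Function.iterate_zero, id_eq]
  ring

/-- `exp D` is the substitution `X ↦ X + D X`, since `D² X = 0` for the variables. -/
theorem diffSum_eq_aeval (f : BInv) : ∃ N, ∀ k, N ≤ k → diffSum k f =
    MvPolynomial.aeval (R := ℚ) (fun a => MvPolynomial.X a + diffOp (MvPolynomial.X a)) f := by
  induction f using MvPolynomial.induction_on with
  | C a =>
    refine ⟨1, fun k hk => ?_⟩
    have h0 : diffOp (MvPolynomial.C a) = 0 := by simp [diffOp]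
    rw [diffSum, Finset.sum_eq_single 0]
    · simp [MvPolynomial.algebraMap_eq]
    · intro i _ hi
      obtain ⟨j, rfl⟩ := Nat.exists_eq_succ_of_ne_zero hi
      rw [Function.iterate_succ_apply, h0, Function.iterate_fixed (map_zero diffOp), smul_zero]
    · intro h
      exact absurd (Finset.mem_range.mpr hk) h
  | add p q hp hq =>
    obtain ⟨a, ha⟩ := hp
    obtain ⟨b, hb⟩ := hq
    refine ⟨max a b, fun k hk => ?_⟩
    rw [diffSum_add, ha k (le_trans (le_max_left _ _) hk), hb k (le_trans (le_max_right _ _) hk),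
      map_add]
  | mul_X p a hp =>
    obtain ⟨N, hN⟩ := hp
    refine ⟨N + 1, fun k hk => ?_⟩
    obtain ⟨m, rfl⟩ := Nat.exists_eq_add_of_le' (le_trans (Nat.le_add_left 1 N) hk)
    rw [diffSum_mul _ _ _ (diffOp_diffOp_X a), hN _ (by omega), hN _ (by omega), map_mul,
      MvPolynomial.aeval_X, mul_add]

theorem expDiffOp_eq_aeval (f : B) : expDiffOp f = MvPolynomial.aeval (R := ℚ)
    (fun a => MvPolynomial.X a + diffOp (MvPolynomial.X a)) (MvPolynomial.rename Sum.inl f) := by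
  obtain ⟨N, hN⟩ := diffSum_eq_aeval (MvPolynomial.rename Sum.inl f)
  obtain ⟨M, hM⟩ := diffOp_eventually_zero (MvPolynomial.rename Sum.inl f)
  rw [← hN (max M N) (le_max_right _ _), expDiffOp, diffSum]
  refine finsum_eq_sum_of_support_subset _ fun k hk => ?_
  rw [Finset.coe_range, Set.mem_Iio]
  by_contra h
  refine hk ?_
  dsimp only
  rw [hM k (by omega), smul_zero]

/-! ### Shifts of the variables -/

/-- The ring `B((z))`. -/
abbrev K : Type := LaurentSeries B

/-- The element `z⁻¹` of `B((z))`. -/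
def zInv : K := HahnSeries.single (-1 : ℤ) 1

theorem zInv_pow (n : ℕ) : zInv ^ n = HahnSeries.single (-(n : ℤ)) 1 := by
  rw [zInv, HahnSeries.single_pow]
  simp

/-- The substitution `xₙ ↦ xₙ + (ε / n) z⁻ⁿ`. -/
def shift (ε : ℚ) : B →+* K :=
  MvPolynomial.eval₂Hom (algebraMap ℚ K) fun n : ℕ+ =>
    HahnSeries.C (MvPolynomial.X n) + algebraMap ℚ K (ε / n) * HahnSeries.single (-(n : ℤ)) 1

theorem shift_X (ε : ℚ) (n : ℕ+) : shift ε (MvPolynomial.X n) =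
    HahnSeries.C (MvPolynomial.X n) + algebraMap ℚ K (ε / n) * HahnSeries.single (-(n : ℤ)) 1 := by
  simp [shift]

/-- The extension of a ring homomorphism to Laurent series, coefficient by coefficient. -/
def mapLaurent {A A' : Type*} [CommRing A] [CommRing A'] (φ : A →+* A') :
    LaurentSeries A →+* LaurentSeries A' where
  toFun x := x.map φ
  map_one' := by
    ext i
    rw [HahnSeries.map_coeff, HahnSeries.coeff_one, HahnSeries.coeff_one]
    split_ifs <;> simp
  map_mul' x y := HahnSeries.map_mul (φ : A →ₙ+* A')
  map_zero' := by ext; simp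
  map_add' x y := HahnSeries.map_add (φ : A →+ A')

theorem mapLaurent_coeff {A A' : Type*} [CommRing A] [CommRing A'] (φ : A →+* A')
    (x : LaurentSeries A) (i : ℤ) : (mapLaurent φ x).coeff i = φ (x.coeff i) := rfl

theorem mapLaurent_single {A A' : Type*} [CommRing A] [CommRing A'] (φ : A →+* A') (i : ℤ) (a : A) :
    mapLaurent φ (HahnSeries.single i a) = HahnSeries.single i (φ a) := by
  ext j
  rw [mapLaurent_coeff]
  by_cases h : j = i
  · rw [h, HahnSeries.coeff_single_same, HahnSeries.coeff_single_same]
  · rw [HahnSeries.coeff_single_of_ne h, HahnSeries.coeff_single_of_ne h, map_zero]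

/-- The substitution `xₙ ↦ xₙ - (1/n) (z⁻ⁿ - w⁻ⁿ)`. The shift by `w⁻ⁿ / n` comes first; its Laurent
variable becomes the outer one when the shift by `-z⁻ⁿ / n` is applied to the coefficients. -/
def doubleShift : B →+* L := (mapLaurent (shift (-1))).comp (shift 1)

/-- The rational scalars of `L` act on coefficients, and agree with those of the `ℚ`-algebra `L`
because an additive group has at most one structure of a rational vector space. -/
theorem L_smul_eq (q : ℚ) (x : L) : q • x = algebraMap ℚ L q * x := by
  rw [← Algebra.smul_def]
  exact map_rat_smul (_instM := inferInstance) (_instM₂ := Algebra.toModule) (AddMonoidHom.id L) q x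

theorem doubleShift_X (n : ℕ+) : doubleShift (MvPolynomial.X n) =
    mono (MvPolynomial.X n) 0 0 -
      (1 / (n : ℚ)) • (mono 1 (-(n : ℤ)) 0 - mono 1 0 (-(n : ℤ))) := by
  rw [doubleShift, RingHom.comp_apply, shift_X, map_add, map_mul, mapLaurent_single,
    HahnSeries.C_apply, mapLaurent_single, shift_X]
  have h : mapLaurent (shift (-1)) (algebraMap ℚ K (1 / n)) = algebraMap ℚ L (1 / n) :=
    map_algebraMap_rat _ _
  have h2 : (HahnSeries.single (0 : ℤ) (algebraMap ℚ K (-1 / n)) : L) =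
      algebraMap ℚ L (-1 / n) :=
    map_algebraMap_rat (A := K) (A' := L) HahnSeries.C _
  have hr : (1 / (n : ℚ)) • (mono 1 (-(n : ℤ)) 0 - mono 1 0 (-(n : ℤ))) =
      algebraMap ℚ L (1 / n) * (mono 1 (-(n : ℤ)) 0 - mono 1 0 (-(n : ℤ))) := by
    exact L_smul_eq _ _
  have h3 : (HahnSeries.single (0 : ℤ) (algebraMap ℚ K (-1 / n) *
      HahnSeries.single (-(n : ℤ)) 1) : L) =
      algebraMap ℚ L (-1 / n) * mono 1 (-(n : ℤ)) 0 := by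
    rw [← h2, mono, HahnSeries.single_mul_single, add_zero]
  rw [hr, h, HahnSeries.single_add, h3, map_one, neg_div, map_neg]
  simp only [mono, HahnSeries.C_apply]
  have h4 : (HahnSeries.single (-(n : ℤ)) (1 : K) : L) =
      HahnSeries.single (-(n : ℤ)) (HahnSeries.single 0 1) := rfl
  rw [h4]
  ring

theorem ofBInv_expDiffOp (f : B) : ofBInv (expDiffOp f) = doubleShift f := by
  rw [expDiffOp_eq_aeval, MvPolynomial.aeval_rename]
  have h : (ofBInv.toRingHom.comp (MvPolynomial.aeval (R := ℚ) ((fun a : ℕ+ ⊕ Fin 2 =>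
      (MvPolynomial.X a + diffOp (MvPolynomial.X a) : BInv)) ∘ Sum.inl)).toRingHom) =
      doubleShift := by
    refine MvPolynomial.ringHom_ext (fun q => ?_) fun n => ?_
    · have : (MvPolynomial.C q : B) = algebraMap ℚ B q := rfl
      rw [this]
      exact (map_algebraMap_rat (A := B) (A' := L) _ q).trans
        (map_algebraMap_rat (A := B) (A' := L) _ q).symm
    · rw [doubleShift_X]
      simp only [AlgHom.toRingHom_eq_coe, RingHom.coe_comp, RingHom.coe_coe, Function.comp_apply,
        MvPolynomial.aeval_X, map_add]
      rw [diffOp, MvPolynomial.mkDerivation_X]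
      have hs : ∀ (q : ℚ) (x : BInv), ofBInv (q • x) = q • ofBInv x := fun q x =>
        map_rat_smul (ofBInv : BInv →+* L) q x
      rw [Sum.elim_inl, map_neg, hs, map_sub, map_pow, map_pow]
      simp only [ofBInv, MvPolynomial.aeval_X, Sum.elim_inl, Sum.elim_inr, Matrix.cons_val_zero,
        Matrix.cons_val_one]
      rw [← sub_eq_add_neg]
      congr 3 <;> simp [mono, HahnSeries.single_pow]
  exact RingHom.congr_fun h f

theorem vertexOp_eq (f : B) : vertexOp f = expMultiplication * doubleShift f := by
  rw [vertexOp, ofBInv_expDiffOp]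

/-! ### Generating series in one variable -/

theorem coeff_ofPowerSeries {A : Type*} [CommRing A] (f : PowerSeries A) (i : ℤ) :
    (HahnSeries.ofPowerSeries ℤ A f).coeff i =
      if 0 ≤ i then PowerSeries.coeff i.toNat f else 0 := by
  rw [PowerSeries.coeff_coe]
  split_ifs with h1 h2 h2
  · omega
  · rfl
  · rw [show i.natAbs = i.toNat by omega]
  · omega

/-- `exp (∑ xₙ zⁿ)` as a Laurent series. -/
def sigma : K := HahnSeries.ofPowerSeries ℤ B completeSeries

/-- `exp (-∑ xₙ Zⁿ)`. -/
def completeInv : PowerSeries B := (PowerSeries.exp ℚ).subst (-xSeries)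

/-- `exp (-∑ xₙ zⁿ)` as a Laurent series. -/
def sigmaInv : K := HahnSeries.ofPowerSeries ℤ B completeInv

theorem completeInv_mul : completeInv * completeSeries = 1 := by
  have h := exp_subst_add (τ := Unit) (f := -xSeries) (g := xSeries)
    (by rw [map_neg]; exact neg_eq_zero.mpr constantCoeff_xSeries) constantCoeff_xSeries
  rw [neg_add_cancel, exp_subst_zero] at h
  exact h.symm

theorem sigmaInv_mul : sigmaInv * sigma = 1 := by
  rw [sigmaInv, sigma, ← map_mul, completeInv_mul, map_one]

theorem sigma_coeff (i : ℤ) : sigma.coeff i = complete i := by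
  rw [sigma, coeff_ofPowerSeries, complete]
  rfl

theorem map_shift_xSeries (ε : ℚ) : PowerSeries.map (shift ε) xSeries =
    PowerSeries.map (HahnSeries.C : B →+* K) xSeries + PowerSeries.C (algebraMap ℚ K ε) *
      PowerSeries.rescale zInv (logSeries K) := by
  ext1 n
  rw [map_add, PowerSeries.coeff_C_mul, PowerSeries.coeff_rescale, PowerSeries.coeff_map,
    PowerSeries.coeff_map, xSeries, logSeries, PowerSeries.coeff_mk, PowerSeries.coeff_mk]
  split_ifs with h
  · have e := shift_X ε ⟨n, h⟩
    rw [PNat.mk_coe, div_eq_mul_inv, map_mul] at e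
    refine e.trans ?_
    rw [zInv_pow]
    ring
  · obtain rfl : n = 0 := by omega
    simp

/-- The geometric series `∑ z⁻ⁿ Zⁿ`. -/
def geomInv : PowerSeries K :=
  PowerSeries.rescale zInv (PowerSeries.mk fun _ => 1)

theorem one_sub_mul_geomInv :
    (1 - PowerSeries.C zInv * PowerSeries.X) * geomInv = 1 := by
  have h := congrArg (PowerSeries.rescale zInv)
    (PowerSeries.mk_one_mul_one_sub_eq_one K)
  rw [map_mul, map_sub, map_one, PowerSeries.rescale_X, mul_comm] at h
  exact h

theorem constantCoeff_rescale_logSeries (a : K) :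
    PowerSeries.constantCoeff (PowerSeries.rescale a (logSeries K)) = 0 := by
  rw [← PowerSeries.coeff_zero_eq_constantCoeff_apply, PowerSeries.coeff_rescale,
    PowerSeries.coeff_zero_eq_constantCoeff_apply, constantCoeff_logSeries, mul_zero]

theorem constantCoeff_map_xSeries {A : Type*} [CommRing A] (φ : B →+* A) :
    PowerSeries.constantCoeff (PowerSeries.map φ xSeries) = 0 := by
  rw [← PowerSeries.coeff_zero_eq_constantCoeff_apply, PowerSeries.coeff_map,
    PowerSeries.coeff_zero_eq_constantCoeff_apply, constantCoeff_xSeries, map_zero]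

theorem map_completeSeries {A : Type*} [CommRing A] [Algebra ℚ A] (φ : B →+* A) :
    PowerSeries.map φ completeSeries = (PowerSeries.exp ℚ).subst (PowerSeries.map φ xSeries) :=
  map_exp_subst (τ := Unit) φ constantCoeff_xSeries

theorem geomInv_eq_exp : geomInv = (PowerSeries.exp ℚ).subst
    (PowerSeries.rescale zInv (logSeries K)) := by
  rw [geomInv, ← exp_subst_logSeries, rescale_exp_subst _ constantCoeff_logSeries]

theorem map_shift_one_completeSeries : PowerSeries.map (shift 1) completeSeries =
    PowerSeries.map (HahnSeries.C : B →+* K) completeSeries * geomInv := by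
  rw [map_completeSeries, map_completeSeries, map_shift_xSeries, map_one, map_one, one_mul,
    geomInv_eq_exp]
  exact exp_subst_add (τ := Unit) (constantCoeff_map_xSeries _) (constantCoeff_rescale_logSeries _)

theorem map_shift_neg_one_completeSeries :
    PowerSeries.map (shift (-1)) completeSeries * geomInv =
      PowerSeries.map (HahnSeries.C : B →+* K) completeSeries := by
  rw [map_completeSeries, map_completeSeries, geomInv_eq_exp]
  refine Eq.trans (exp_subst_add (τ := Unit) (constantCoeff_map_xSeries _)
    (constantCoeff_rescale_logSeries _)).symm ?_
  congr 1
  change PowerSeries.map (shift (-1)) xSeries + PowerSeries.rescale _ (logSeries K) = _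
  rw [map_shift_xSeries, map_neg, map_one, map_neg, map_one]
  ring

theorem coeff_one_sub_mul_map (φ : B →+* K) (k : ℤ) :
    φ (complete k) - zInv * φ (complete (k - 1)) =
      if 0 ≤ k then PowerSeries.coeff k.toNat
        ((1 - PowerSeries.C zInv * PowerSeries.X) *
          PowerSeries.map φ completeSeries) else 0 := by
  split_ifs with h
  · obtain ⟨n, rfl⟩ := Int.eq_ofNat_of_zero_le h
    rw [sub_mul, one_mul, map_sub, mul_assoc, PowerSeries.coeff_C_mul, Int.toNat_natCast,
      PowerSeries.coeff_map, ← complete_natCast]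
    congr 2
    rcases n with _ | n
    · rw [complete_of_neg (by omega)]
      simp
    · rw [PowerSeries.coeff_succ_X_mul, PowerSeries.coeff_map, ← complete_natCast]
      congr 2
      push_cast
      ring
  · rw [complete_of_neg (by omega), complete_of_neg (by omega)]
    simp

/-- The shift `xₙ ↦ xₙ + z⁻ⁿ / n` multiplies the generating series `∑ S_j(x) Zʲ` by
`(1 - Z / z)⁻¹`; this is the identity of coefficients after multiplication by `1 - Z / z`. -/
theorem shift_one_complete (k : ℤ) :
    shift 1 (complete k) - zInv * shift 1 (complete (k - 1)) =
      HahnSeries.C (complete k) := by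
  rw [coeff_one_sub_mul_map, map_shift_one_completeSeries, mul_left_comm, one_sub_mul_geomInv,
    mul_one, PowerSeries.coeff_map]
  split_ifs with h
  · obtain ⟨n, rfl⟩ := Int.eq_ofNat_of_zero_le h
    rw [Int.toNat_natCast, ← complete_natCast]
  · rw [complete_of_neg (by omega), map_zero]

/-- The shift `xₙ ↦ xₙ - z⁻ⁿ / n` multiplies the generating series `∑ S_j(x) Zʲ` by `1 - Z / z`. -/
theorem shift_neg_one_complete (k : ℤ) :
    shift (-1) (complete k) = HahnSeries.C (complete k) -
      zInv * HahnSeries.C (complete (k - 1)) := by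
  rw [coeff_one_sub_mul_map (HahnSeries.C : B →+* K), ← map_shift_neg_one_completeSeries,
    mul_left_comm, one_sub_mul_geomInv, mul_one, PowerSeries.coeff_map]
  split_ifs with h
  · obtain ⟨n, rfl⟩ := Int.eq_ofNat_of_zero_le h
    rw [Int.toNat_natCast, ← complete_natCast]
  · rw [complete_of_neg (by omega), map_zero]

/-- `S_k(x₁ + z⁻¹, x₂ + z⁻²/2, …) = ∑_{l ≥ 0} S_{k-l}(x) z⁻ˡ`. -/
theorem shift_one_complete_coeff (k i : ℤ) :
    (shift 1 (complete k)).coeff i = if i ≤ 0 then complete (k + i) else 0 := by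
  have key : ∀ (n : ℕ) (k i : ℤ), k < n →
      (shift 1 (complete k)).coeff i = if i ≤ 0 then complete (k + i) else 0 := by
    intro n
    induction n with
    | zero =>
      intro k i hk
      rw [complete_of_neg hk, map_zero, HahnSeries.coeff_zero]
      split_ifs
      · rw [complete_of_neg (by omega)]
      · rfl
    | succ n ih =>
      intro k i hk
      rw [← sub_add_cancel (shift 1 (complete k)) (zInv * shift 1 (complete (k - 1))),
        shift_one_complete, HahnSeries.coeff_add, zInv, HahnSeries.coeff_single_mul, one_mul,
        ih _ _ (by push_cast at hk; omega), HahnSeries.C_apply, HahnSeries.coeff_single]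
      rcases lt_trichotomy i 0 with h | rfl | h
      · rw [if_neg h.ne, if_pos (by omega), if_pos h.le, zero_add]
        congr 1
        ring
      · simp
      · rw [if_neg h.ne', if_neg (by omega), if_neg (by omega), add_zero]
  exact key (k.toNat + 1) k i (by omega)

/-! ### Creation and annihilation of a fermion on determinants -/

theorem hdet_eq_transpose (N : ℕ) (c : Fin N → ℤ) :
    hdet N c = Matrix.det (Matrix.of fun i j : Fin N => complete (c i + (j : ℤ))) := by
  rw [hdet, ← Matrix.det_transpose]
  rfl

/-- If all rows but the first are constant in `z`, the coefficients of a determinant are found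
by taking coefficients in the first row. -/
theorem coeff_det_cons {N : ℕ} (x : Fin (N + 1) → K) (a : Fin N → Fin (N + 1) → B) (i : ℤ) :
    (Matrix.det (Matrix.of (Fin.cons x (fun k l => HahnSeries.C (a k l)) :
      Fin (N + 1) → Fin (N + 1) → K))).coeff i =
      Matrix.det (Matrix.of (Fin.cons (fun l => (x l).coeff i) a :
        Fin (N + 1) → Fin (N + 1) → B)) := by
  rw [Matrix.det_succ_row_zero, Matrix.det_succ_row_zero, HahnSeries.coeff_sum]
  refine Finset.sum_congr rfl fun j _ => ?_
  simp only [Matrix.of_apply, Fin.cons_zero]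
  have h : ((Matrix.of (Fin.cons x (fun k l => HahnSeries.C (a k l)) :
      Fin (N + 1) → Fin (N + 1) → K)).submatrix Fin.succ j.succAbove) =
      (HahnSeries.C : B →+* K).mapMatrix (((Matrix.of (Fin.cons (fun l => (x l).coeff i) a :
        Fin (N + 1) → Fin (N + 1) → B)).submatrix Fin.succ j.succAbove)) := by
    ext1 k l
    simp [Fin.cons_succ]
  have hs : ((-1 : K) ^ (j : ℕ)) = HahnSeries.C ((-1 : B) ^ (j : ℕ)) := by
    rw [map_pow, map_neg, map_one]
  rw [h, ← RingHom.map_det, hs, mul_assoc, HahnSeries.C_apply, HahnSeries.C_apply,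
    HahnSeries.coeff_single_mul, HahnSeries.coeff_mul_single, sub_zero, sub_zero, mul_assoc]

theorem det_cons_cons_zero {A : Type*} [CommRing A] {N : ℕ} (s : A) (u : Fin N → A)
    (v : Fin N → Fin N → A) :
    Matrix.det (Matrix.of (Fin.cons (Fin.cons s fun _ => 0) (fun l => Fin.cons (u l) (v l)) :
      Fin (N + 1) → Fin (N + 1) → A)) = s * Matrix.det (Matrix.of v) := by
  rw [Matrix.det_succ_row_zero, Finset.sum_eq_single 0]
  · rw [Fin.val_zero, pow_zero, one_mul]
    rfl
  · intro j _ hj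
    obtain ⟨j', rfl⟩ := Fin.exists_succ_eq.mpr hj
    rw [Matrix.of_apply, Fin.cons_zero, Fin.cons_succ, mul_zero, zero_mul]
  · simp

/-- Column operations that turn the first row into `(s, 0, …, 0)`. -/
theorem det_cons_pow {A : Type*} [CommRing A] {N : ℕ} (s z : A) (x y : ℤ → A)
    (hxy : ∀ k, y k = x k - z * x (k - 1)) (c : Fin N → ℤ) :
    Matrix.det (Matrix.of (Fin.cons (fun a : Fin (N + 1) => z ^ (a : ℕ) * s)
      (fun l a => x (c l + (a : ℕ))) : Fin (N + 1) → Fin (N + 1) → A)) =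
      s * Matrix.det (Matrix.of fun l a : Fin N => y (c l + 1 + (a : ℕ))) := by
  rw [← det_cons_cons_zero s (fun l => x (c l))]
  refine Matrix.det_eq_of_forall_col_eq_smul_add_pred (fun _ => z) ?_ ?_
  · intro k
    refine Fin.cases ?_ (fun l => ?_) k
    · simp
    · simp [Fin.cons_succ]
  · intro k j
    refine Fin.cases ?_ (fun l => ?_) k
    · simp only [Matrix.of_apply, Fin.cons_zero, Fin.cons_succ, zero_add,
        Fin.val_succ, Fin.val_castSucc]
      rw [pow_succ', mul_assoc]
    · simp only [Matrix.of_apply, Fin.cons_succ, Fin.val_succ, Fin.val_castSucc]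
      have h1 : c l + ((j : ℕ) + 1 : ℕ) = c l + 1 + (j : ℕ) := by push_cast; ring
      have h2 : c l + 1 + (j : ℕ) - 1 = c l + (j : ℕ) := by ring
      rw [h1, hxy, h2, sub_add_cancel]

/-- Putting `Xⁱ` in front of a semi-infinite monomial amounts to the operator
`exp (∑ xₙ zⁿ) exp (-∑ (z⁻ⁿ / n) ∂/∂xₙ)`. -/
theorem coeff_sigma_mul_shift (N : ℕ) (c : Fin N → ℤ) (i : ℤ) :
    (sigma * shift (-1) (hdet N fun l => c l + 1)).coeff i =
      hdet (N + 1) (Fin.cons i c : Fin (N + 1) → ℤ) := by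
  have h1 : sigma * shift (-1) (hdet N fun l => c l + 1) =
      Matrix.det (Matrix.of (Fin.cons (fun a : Fin (N + 1) => zInv ^ (a : ℕ) * sigma)
        (fun l a => HahnSeries.C (complete (c l + (a : ℕ)))) : Fin (N + 1) → Fin (N + 1) → K)) := by
    rw [det_cons_pow sigma zInv (fun k => HahnSeries.C (complete k))
      (fun k => shift (-1) (complete k)) shift_neg_one_complete, hdet_eq_transpose, RingHom.map_det]
    rfl
  rw [h1, coeff_det_cons, hdet_eq_transpose]
  congr 1
  ext1 k a
  refine Fin.cases ?_ (fun l => ?_) k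
  · simp only [Matrix.of_apply, Fin.cons_zero]
    rw [zInv_pow, HahnSeries.coeff_single_mul, one_mul, sub_neg_eq_add, sigma_coeff]
  · simp [Fin.cons_succ]

/-- The matrix whose first row is `x` and whose other rows are the rows `1, …, N` of
`(S_{c_j + a})`. -/
def rowMatrix {N : ℕ} (c : Fin (N + 1) → ℤ) (x : Fin (N + 1) → K) :
    Matrix (Fin (N + 1)) (Fin (N + 1)) K :=
  Matrix.of (Fin.cons x fun a j => HahnSeries.C (complete (c j + ((a : ℕ) + 1 : ℕ))))

theorem det_rowMatrix_add {N : ℕ} (c : Fin (N + 1) → ℤ) (x y : Fin (N + 1) → K) :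
    (rowMatrix c (x + y)).det = (rowMatrix c x).det + (rowMatrix c y).det := by
  simp only [rowMatrix, Matrix.det_succ_row_zero, Matrix.of_apply, Fin.cons_zero, Pi.add_apply,
    mul_add, add_mul, Finset.sum_add_distrib]
  rfl

theorem det_rowMatrix_smul {N : ℕ} (c : Fin (N + 1) → ℤ) (a : K) (x : Fin (N + 1) → K) :
    (rowMatrix c (fun j => a * x j)).det = a * (rowMatrix c x).det := by
  simp only [rowMatrix, Matrix.det_succ_row_zero, Matrix.of_apply, Fin.cons_zero, Finset.mul_sum]
  refine Finset.sum_congr rfl fun j _ => ?_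
  change _ * (a * x j) * Matrix.det _ = a * (_ * x j * Matrix.det _)
  ring_nf
  rfl

/-- Below the first row, `shift 1` can be undone by subtracting from each row `z⁻¹` times the
preceding one. -/
theorem shift_one_hdet {N : ℕ} (c : Fin (N + 1) → ℤ) :
    shift 1 (hdet (N + 1) c) = (rowMatrix c fun j => shift 1 (complete (c j))).det := by
  rw [hdet, RingHom.map_det]
  refine Matrix.det_eq_of_forall_row_eq_smul_add_pred (fun _ => zInv) ?_ ?_
  · intro j
    simp [rowMatrix]
  · intro a j
    simp only [RingHom.mapMatrix_apply, Matrix.map_apply, Matrix.of_apply, rowMatrix, Fin.cons_succ,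
      Fin.val_succ, Fin.val_castSucc]
    rw [← shift_one_complete]
    have : c j + ((a : ℕ) + 1 : ℕ) - 1 = c j + (a : ℕ) := by push_cast; ring
    rw [this]
    ring

/-- Removing a factor from a semi-infinite monomial amounts to the operator
`exp (-∑ xₙ wⁿ) exp (∑ (w⁻ⁿ / n) ∂/∂xₙ)`. The `N + 1` leading factors determine the coefficients up
to `w^N`. -/
theorem coeff_sigmaInv_mul_shift {N : ℕ} (c : Fin (N + 1) → ℤ) {i : ℤ} (hi : i ≤ N) :
    (sigmaInv * shift 1 (hdet (N + 1) c)).coeff i =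
      ∑ j : Fin (N + 1), if c j = -i then
        (-1) ^ (j : ℕ) * hdet N (fun l => c (j.succAbove l) + 1) else 0 := by
  set G := (rowMatrix c fun j => HahnSeries.single (-c j) 1).det with hG
  set Err := (rowMatrix c fun j => shift 1 (complete (c j)) -
    sigma * HahnSeries.single (-c j) 1).det with hErr
  -- `∑_{l ≥ 0} S_{c-l} w⁻ˡ` is the part of `exp (∑ xₙ wⁿ) w⁻ᶜ` without positive powers of `w`
  have hsplit : shift 1 (hdet (N + 1) c) = sigma * G + Err := by
    rw [shift_one_hdet, hG, ← det_rowMatrix_smul, hErr, ← det_rowMatrix_add]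
    congr 2
    funext j
    simp
  have hErr0 : ∀ m : ℤ, m ≤ N → Err.coeff m = 0 := by
    intro m hm
    rw [hErr, rowMatrix, coeff_det_cons]
    have hx : ∀ j, (shift 1 (complete (c j)) - sigma * HahnSeries.single (-c j) 1).coeff m =
        if m ≤ 0 then 0 else -complete (c j + m) := by
      intro j
      rw [HahnSeries.coeff_sub, shift_one_complete_coeff, HahnSeries.coeff_mul_single, mul_one,
        sigma_coeff, sub_neg_eq_add, add_comm m]
      split_ifs <;> simp
    simp only [hx]
    split_ifs with h0
    · exact Matrix.det_eq_zero_of_row_eq_zero 0 fun j => by simp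
    · -- the first row is the negative of the row with index `m`
      obtain ⟨a, ha⟩ : ∃ a : Fin N, m = ((a : ℕ) + 1 : ℕ) :=
        ⟨⟨(m - 1).toNat, by omega⟩, by push_cast; omega⟩
      rw [Matrix.det_succ_row_zero]
      have h2 := Matrix.det_zero_of_row_eq (M := Matrix.of (Fin.cons
        (fun j => complete (c j + m))
        fun (a : Fin N) j => complete (c j + ((a : ℕ) + 1 : ℕ)) :
        Fin (N + 1) → Fin (N + 1) → B)) (i := 0) (j := a.succ) (Fin.succ_ne_zero a).symm
        (by funext j; simp [Fin.cons_succ, ha])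
      rw [Matrix.det_succ_row_zero, ← neg_eq_zero, ← Finset.sum_neg_distrib] at h2
      rw [← h2]
      refine Finset.sum_congr rfl fun j _ => ?_
      simp only [Matrix.of_apply, Fin.cons_zero, mul_neg, neg_mul]
      rfl
  -- `sigmaInv` has no negative powers, so `Err` contributes only beyond degree `N`
  have hcoeff : (sigmaInv * Err).coeff i = 0 := by
    rw [HahnSeries.coeff_mul]
    refine Finset.sum_eq_zero fun p hp => ?_
    have hp' := (Finset.mem_antidiagonal.mp hp).2.2
    by_cases h1 : 0 ≤ p.1
    · rw [hErr0 p.2 (by omega), mul_zero]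
    · rw [sigmaInv, coeff_ofPowerSeries, if_neg h1, zero_mul]
  rw [hsplit, mul_add, HahnSeries.coeff_add, hcoeff, add_zero, ← mul_assoc, sigmaInv_mul, one_mul,
    hG, rowMatrix, coeff_det_cons, Matrix.det_succ_row_zero]
  refine Finset.sum_congr rfl fun j _ => ?_
  simp only [Matrix.of_apply, Fin.cons_zero]
  by_cases h : c j = -i
  · rw [if_pos h, h, neg_neg, HahnSeries.coeff_single_same, mul_one, hdet]
    congr 2
    ext1 a l
    simp [Fin.cons_succ, add_assoc, add_comm (1 : ℤ)]
  · rw [if_neg h, HahnSeries.coeff_single_of_ne (by omega)]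
    ring

/-! ### The action on semi-infinite monomials in terms of determinants -/

/-- The exponents `λ_k - k` of the monomial of a partition. -/
def Ptn.exponent (lam : Ptn) (k : ℕ) : ℤ := (lam.1 k : ℤ) - (k : ℤ)

theorem Ptn.exponent_strictAnti (lam : Ptn) : StrictAnti lam.exponent := fun a b hab => by
  have := lam.2 hab.le
  unfold Ptn.exponent
  omega

theorem Ptn.exponents_eq {lam : Ptn} {N : ℕ} (h : lam.length ≤ N) :
    lam.exponents = Set.range (fun j : Fin N => lam.exponent j) ∪ Set.Iic (-(N : ℤ)) := by
  ext a
  simp only [Ptn.exponents, Set.mem_range, Set.mem_union, Set.mem_Iic]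
  constructor
  · rintro ⟨k, rfl⟩
    by_cases hk : k < N
    · exact Or.inl ⟨⟨k, hk⟩, rfl⟩
    · right
      rw [lam.apply_eq_zero (h.trans (not_lt.mp hk))]
      omega
  · rintro (⟨j, rfl⟩ | ha)
    · exact ⟨j, rfl⟩
    · refine ⟨(-a).toNat, ?_⟩
      rw [lam.apply_eq_zero (by omega)]
      omega

theorem Ptn.above_exponent (lam : Ptn) (k : ℕ) : lam.maya.above (lam.exponent k) = k := by
  have : lam.maya.1 ∩ Set.Ioi (lam.exponent k) = lam.exponent '' Set.Iio k := by
    ext a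
    simp only [Ptn.maya, Ptn.exponents, Set.mem_inter_iff, Set.mem_range, Set.mem_Ioi, Set.mem_image,
      Set.mem_Iio]
    constructor
    · rintro ⟨⟨l, rfl⟩, h⟩
      exact ⟨l, lam.exponent_strictAnti.lt_iff_gt.mp h, rfl⟩
    · rintro ⟨l, hl, rfl⟩
      exact ⟨⟨l, rfl⟩, lam.exponent_strictAnti hl⟩
  rw [Maya.above, this, Set.ncard_image_of_injective _ lam.exponent_strictAnti.injective,
    Set.ncard_eq_toFinset_card']
  simp

theorem bosonize_single (lam : Ptn) (q : ℚ) :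
    bosonize (Finsupp.single lam.maya q) = q • schurB lam := by
  have h : ∃ mu : Ptn, mu.maya = lam.maya := ⟨lam, rfl⟩
  rw [bosonize, Finsupp.linearCombination_single, dif_pos h, Ptn.maya_injective h.choose_spec]

/-- Sorting a new column into place costs one sign for each column it passes. -/
theorem hdet_insertNth {N : ℕ} (p : Fin (N + 1)) (i : ℤ) (c : Fin N → ℤ) :
    hdet (N + 1) (Fin.insertNth (α := fun _ => ℤ) p i c) =
      (-1) ^ (p : ℕ) * hdet (N + 1) (Fin.cons i c : Fin (N + 1) → ℤ) := by
  rw [hdet, hdet, Matrix.det_succ_column _ p, Matrix.det_succ_column_zero, Finset.mul_sum]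
  refine Finset.sum_congr rfl fun a _ => ?_
  have h : (Matrix.of fun a j : Fin (N + 1) => complete
      ((Fin.insertNth (α := fun _ => ℤ) p i c) j + (a : ℤ))).submatrix a.succAbove p.succAbove =
      (Matrix.of fun a j : Fin (N + 1) => complete
      ((Fin.cons i c : Fin (N + 1) → ℤ) j + (a : ℤ))).submatrix a.succAbove Fin.succ := by
    ext1 k l
    simp
  rw [h]
  simp only [Matrix.of_apply, Fin.insertNth_apply_same, Fin.cons_zero]
  rw [pow_add]
  ring

/-- Putting `Xⁱ` in front of the monomial with the exponents `c` followed by `-N - 1, -N - 2, …`. -/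
theorem bosonize_wedge {N : ℕ} {c : Fin N → ℤ} (hc : StrictAnti c) (hlow : ∀ l, -(N : ℤ) ≤ c l)
    {M : Maya} (hM : M.1 = Set.range c ∪ Set.Iic (-((N + 1 : ℕ) : ℤ))) {i : ℤ}
    (hi : -(N : ℤ) ≤ i) (q : ℚ) :
    bosonize (wedge i (Finsupp.single M q)) =
      q • hdet (N + 1) (Fin.cons i c : Fin (N + 1) → ℤ) := by
  classical
  rw [wedge, Finsupp.linearCombination_single]
  by_cases hiM : i ∈ M.1
  · rw [if_pos hiM, smul_zero, map_zero]
    rw [hM] at hiM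
    rcases hiM with ⟨l, hl⟩ | h
    · rw [hdet_of_eq _ (Fin.succ_ne_zero l).symm (by simp [hl]), smul_zero]
    · rw [Set.mem_Iic] at h
      push_cast at h
      omega
  rw [if_neg hiM]
  -- `p` is the position of `i` among the exponents
  have hex : ∃ n, ∀ h : n < N, c ⟨n, h⟩ < i :=
    ⟨N, fun h => absurd h (lt_irrefl _)⟩
  obtain ⟨p, hpN, hp1, hp2⟩ : ∃ p : ℕ, p ≤ N ∧ (∀ l : Fin N, (l : ℕ) < p → i < c l) ∧
      (∀ l : Fin N, p ≤ l → c l < i) := by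
    refine ⟨Nat.find hex, Nat.find_min' hex fun h => absurd h (lt_irrefl _), fun l hl => ?_,
      fun l hl => ?_⟩
    · have h1 := Nat.find_min hex hl
      push Not at h1
      obtain ⟨h2, h3⟩ := h1
      refine lt_of_le_of_ne h3 fun h => hiM ?_
      rw [hM, h]
      exact Or.inl ⟨l, rfl⟩
    · exact lt_of_le_of_lt (hc.antitone (show (⟨Nat.find hex, by omega⟩ : Fin N) ≤ l from hl))
        (Nat.find_spec hex (by omega))
  have habove : M.above i = p := by
    have : M.1 ∩ Set.Ioi i = c '' {l | (l : ℕ) < p} := by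
      ext a
      rw [hM]
      simp only [Set.mem_inter_iff, Set.mem_union, Set.mem_range, Set.mem_Iic, Set.mem_Ioi,
        Set.mem_image, Set.mem_ofPred_eq]
      constructor
      · rintro ⟨⟨l, rfl⟩ | h, hl⟩
        · refine ⟨l, ?_, rfl⟩
          by_contra hlp
          exact absurd (hp2 l (not_lt.mp hlp)) (not_lt.mpr hl.le)
        · push_cast at h
          omega
      · rintro ⟨l, hl, rfl⟩
        exact ⟨Or.inl ⟨l, rfl⟩, hp1 l hl⟩
    rw [Maya.above, this, Set.ncard_image_of_injective _ hc.injective,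
      Set.ncard_eq_toFinset_card']
    simp [Fin.card_filter_val_lt, hpN]
  set P : Fin (N + 1) := ⟨p, by omega⟩ with hP
  have hanti : StrictAnti (Fin.insertNth (α := fun _ => ℤ) P i c) := by
    intro a b hab
    rcases Fin.eq_self_or_eq_succAbove P a with rfl | ⟨a', rfl⟩ <;>
      rcases Fin.eq_self_or_eq_succAbove P b with hb | ⟨b', rfl⟩
    · exact absurd hab (by rw [hb]; exact lt_irrefl _)
    · rw [Fin.insertNth_apply_same, Fin.insertNth_apply_succAbove]
      have := Fin.lt_succAbove_iff_le_castSucc _ _ |>.mp hab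
      exact hp2 b' this
    · rw [hb, Fin.insertNth_apply_same, Fin.insertNth_apply_succAbove]
      rw [hb] at hab
      have := Fin.succAbove_lt_iff_castSucc_lt _ _ |>.mp hab
      exact hp1 a' this
    · rw [Fin.insertNth_apply_succAbove, Fin.insertNth_apply_succAbove]
      exact hc (Fin.succAbove_lt_succAbove_iff.mp hab)
  obtain ⟨mu, hmu, hmue⟩ := Ptn.exists_of_strictAnti _ hanti (by
    intro j
    push_cast
    rcases Fin.eq_self_or_eq_succAbove P j with rfl | ⟨j', rfl⟩
    · rw [Fin.insertNth_apply_same]; omega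
    · rw [Fin.insertNth_apply_succAbove]
      have := hlow j'
      omega)
  have hmaya : M.insert i = mu.maya := by
    apply Subtype.ext
    change insert i M.1 = mu.exponents
    rw [Ptn.exponents_eq hmu, hM]
    have : (fun j : Fin (N + 1) => mu.exponent j) = Fin.insertNth (α := fun _ => ℤ) P i c := by
      funext j
      rw [hmue]
      rfl
    rw [this]
    ext a
    simp only [Set.mem_insert_iff, Set.mem_union, Set.mem_range, Fin.exists_iff_succAbove P,
      Fin.insertNth_apply_same, Fin.insertNth_apply_succAbove, eq_comm (a := i), or_assoc]
  have hS : schurB mu = (-1) ^ p * hdet (N + 1) (Fin.cons i c : Fin (N + 1) → ℤ) := by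
    rw [schurB_eq_hdet hmu, ← hdet_insertNth P]
    congr 1
    funext j
    rw [hmue]
  rw [hmaya, map_smul, bosonize_single, habove, hS]
  rcases Nat.even_or_odd p with h | h <;> simp [h.neg_one_pow]

/-- The matrix element of `Xⁱ ⊗ ∂ʲ` as an alternating sum over the factors of the monomial. -/
theorem glAct_eq {lam : Ptn} {N : ℕ} (hlam : lam.length ≤ N + 1) {i j : ℤ} (hi : -(N : ℤ) ≤ i)
    (hj : -(N : ℤ) ≤ j) :
    glAct i j lam = ∑ k : Fin (N + 1), if lam.exponent k = j then
      (-1) ^ (k : ℕ) * hdet (N + 1) (Fin.cons i fun l => lam.exponent (k.succAbove l)) else 0 := by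
  classical
  rw [glAct, contract, fockVec, Finsupp.linearCombination_single, one_smul]
  by_cases hjM : j ∈ lam.maya.1
  · rw [if_pos hjM]
    obtain ⟨k, hk⟩ := hjM
    change lam.exponent k = j at hk
    have hkN : k < N + 1 := by
      by_contra h
      rw [Ptn.exponent, lam.apply_eq_zero (hlam.trans (not_lt.mp h))] at hk
      omega
    set k' : Fin (N + 1) := ⟨k, hkN⟩ with hk'
    rw [Finset.sum_eq_single k']
    · rw [if_pos hk, bosonize_wedge (N := N) (c := fun l => lam.exponent (k'.succAbove l)) ?_ ?_ ?_ hi]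
      · rw [← hk, Ptn.above_exponent]
        rcases Nat.even_or_odd k with h | h <;> simp [k', h.neg_one_pow]
      · intro a b hab
        exact lam.exponent_strictAnti (Fin.succAbove_lt_succAbove_iff.mpr hab)
      · intro l
        have := (k'.succAbove l).2
        unfold Ptn.exponent
        omega
      · change lam.exponents \ {j} = _
        rw [Ptn.exponents_eq hlam]
        ext a
        simp only [Set.mem_sdiff, Set.mem_union, Set.mem_range, Set.mem_Iic, Set.mem_singleton_iff,
          Fin.exists_iff_succAbove k']
        have hka : lam.exponent k' = j := hk
        constructor
        · rintro ⟨(h | h) | h, h2⟩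
          · exact absurd (h.symm.trans hka) h2
          · exact Or.inl h
          · exact Or.inr h
        · rintro (⟨l, rfl⟩ | h)
          · refine ⟨Or.inl (Or.inr ⟨l, rfl⟩), fun h => ?_⟩
            have := lam.exponent_strictAnti.injective (h.trans hka.symm)
            exact Fin.succAbove_ne k' l (Fin.ext this)
          · refine ⟨Or.inr h, ?_⟩
            push_cast at h
            omega
    · intro l _ hl
      rw [if_neg]
      intro h
      exact hl (Fin.ext (lam.exponent_strictAnti.injective (h.trans hk.symm)))
    · simp
  · rw [if_neg hjM, map_zero, map_zero]
    symm
    refine Finset.sum_eq_zero fun k _ => if_neg ?_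
    intro h
    exact hjM ⟨k, h⟩

/-! ### The vertex operator and the action of `gl(ℚ[X, X⁻¹])` -/

/-- Series in `w` alone, as series in `z` and `w`. -/
abbrev constZ : K →+* L := mapLaurent (HahnSeries.C : B →+* K)

theorem coeff_subst_X_zero_mul_subst_X_one (f g : PowerSeries B) (e : Fin 2 →₀ ℕ) :
    MvPowerSeries.coeff e (f.subst (MvPowerSeries.X 0 : MvPowerSeries (Fin 2) B) *
      g.subst (MvPowerSeries.X 1 : MvPowerSeries (Fin 2) B)) =
      PowerSeries.coeff (e 0) f * PowerSeries.coeff (e 1) g := by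
  have he : Finsupp.single 0 (e 0) + Finsupp.single 1 (e 1) = e := by
    ext i
    fin_cases i <;> simp
  rw [MvPowerSeries.coeff_mul,
    Finset.sum_eq_single (Finsupp.single 0 (e 0), Finsupp.single 1 (e 1))]
  · simp [PowerSeries.coeff_subst_single]
  · intro b hb hne
    by_contra h
    rcases ne_zero_and_ne_zero_of_mul h with ⟨h0, h1⟩
    rw [PowerSeries.coeff_subst_single] at h0 h1
    have e0 : b.1 = Finsupp.single 0 (b.1 0) := by_contra fun h => h0 (if_neg h)
    have e1 : b.2 = Finsupp.single 1 (b.2 1) := by_contra fun h => h1 (if_neg h)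
    apply hne
    rw [← Finset.HasAntidiagonal.mem_antidiagonal.mp hb, Prod.ext_iff, e0, e1]
    simp
  · intro h
    exact absurd (Finset.HasAntidiagonal.mem_antidiagonal.mpr he) h

theorem expMultiplication_eq :
    expMultiplication = HahnSeries.C sigma * constZ sigmaInv := by
  have h0 : MvPowerSeries.constantCoeff
      (xSeries.subst (MvPowerSeries.X 0 : MvPowerSeries (Fin 2) B)) = 0 :=
    PowerSeries.constantCoeff_subst_eq_zero (by simp) _ constantCoeff_xSeries
  have h1 : MvPowerSeries.constantCoeff
      ((-xSeries).subst (MvPowerSeries.X 1 : MvPowerSeries (Fin 2) B)) = 0 :=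
    PowerSeries.constantCoeff_subst_eq_zero (by simp) _
      (by rw [map_neg, constantCoeff_xSeries, neg_zero])
  have hX1 : PowerSeries.HasSubst (MvPowerSeries.X 1 : MvPowerSeries (Fin 2) B) :=
    PowerSeries.HasSubst.X _
  have hneg : (-xSeries).subst (MvPowerSeries.X 1 : MvPowerSeries (Fin 2) B) =
      -xSeries.subst (MvPowerSeries.X 1 : MvPowerSeries (Fin 2) B) := by
    rw [← PowerSeries.coe_substAlgHom hX1, map_neg]
  have key : (PowerSeries.exp ℚ).subst
    (xSeries.subst (MvPowerSeries.X 0 : MvPowerSeries (Fin 2) B) -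
      xSeries.subst (MvPowerSeries.X 1 : MvPowerSeries (Fin 2) B)) =
      completeSeries.subst (MvPowerSeries.X 0 : MvPowerSeries (Fin 2) B) *
        completeInv.subst (MvPowerSeries.X 1 : MvPowerSeries (Fin 2) B) := by
    rw [sub_eq_add_neg, ← hneg, exp_subst_add h0 h1, completeSeries, completeInv,
      exp_subst_subst_X _ constantCoeff_xSeries,
      exp_subst_subst_X _ (by rw [map_neg, constantCoeff_xSeries, neg_zero])]
  rw [expMultiplication, key]
  ext1
  funext j
  ext1
  funext i
  rw [ofPowerSeriesZW, coeff_ofPowerSeries, HahnSeries.C_apply, HahnSeries.coeff_single_mul,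
    sub_zero, mapLaurent_coeff, HahnSeries.C_apply, HahnSeries.coeff_mul_single, sub_zero, sigma,
    sigmaInv, coeff_ofPowerSeries, coeff_ofPowerSeries]
  by_cases hj : 0 ≤ j
  · rw [if_pos hj, if_pos hj, PowerSeries.coeff_mk, coeff_ofPowerSeries, PowerSeries.coeff_mk]
    split_ifs
    · rw [coeff_subst_X_zero_mul_subst_X_one]
      simp
    · rw [zero_mul]
  · rw [if_neg hj, if_neg hj, mul_zero, HahnSeries.coeff_zero]

theorem sigma_shift_neg_one : mapLaurent (shift (-1)) sigma = (1 - mono 1 (-1) 1) * constZ sigma := by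
  ext1
  funext n
  rw [sub_mul, one_mul, HahnSeries.coeff_sub, mono, HahnSeries.coeff_single_mul, mapLaurent_coeff,
    mapLaurent_coeff, mapLaurent_coeff, sigma_coeff, sigma_coeff, shift_neg_one_complete]
  rfl

/-- The factor `(1 - w/z)⁻¹` is what the multiplication operator `exp (-∑ xₙ wⁿ)` picks up when it is
moved past the shift `xₙ ↦ xₙ - z⁻ⁿ / n`. -/
theorem geom_mul_expMultiplication :
    geom * expMultiplication = HahnSeries.C sigma * mapLaurent (shift (-1)) sigmaInv := by
  have h1 : mapLaurent (shift (-1)) sigma * mapLaurent (shift (-1)) sigmaInv = 1 := by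
    rw [← map_mul, mul_comm, sigmaInv_mul, map_one]
  have h2 : constZ sigmaInv * constZ sigma = 1 := by
    rw [← map_mul, sigmaInv_mul, map_one]
  have h3 := one_sub_mul_geom
  rw [sigma_shift_neg_one] at h1
  rw [expMultiplication_eq]
  set u := 1 - mono 1 (-1) 1
  set a := mapLaurent (shift (-1)) sigmaInv
  set s := constZ sigma
  set t := constZ sigmaInv
  calc geom * (HahnSeries.C sigma * t) = geom * (HahnSeries.C sigma * t) * (u * s * a) := by
        rw [h1, mul_one]
    _ = (u * geom) * (t * s) * (HahnSeries.C sigma * a) := by ring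
    _ = _ := by rw [h2, h3, one_mul, one_mul]

/-- The boson-fermion correspondence turns `Xⁱ ⊗ ∂ʲ` into the coefficient of `zⁱ w⁻ʲ` in the vertex
operator `(1 - w/z)⁻¹ Γ(z, w)`. -/
theorem coeffL_geom_mul_vertexOp (lam : Ptn) (i j : ℤ) :
    coeffL (geom * vertexOp (schurB lam)) i (-j) = glAct i j lam := by
  obtain ⟨N, hN, hiN, hjN⟩ : ∃ N : ℕ, lam.length ≤ N + 1 ∧ -(N : ℤ) ≤ i ∧ -(N : ℤ) ≤ j :=
    ⟨lam.length + i.natAbs + j.natAbs, by omega, by omega, by omega⟩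
  rw [vertexOp_eq, ← mul_assoc, geom_mul_expMultiplication, doubleShift, RingHom.comp_apply,
    mul_assoc, ← map_mul, schurB_eq_hdet hN, coeffL, HahnSeries.C_apply,
    HahnSeries.coeff_single_mul, sub_zero, mapLaurent_coeff]
  change (sigma * shift (-1) ((sigmaInv * shift 1 (hdet (N + 1)
    fun k => lam.exponent k)).coeff (-j))).coeff i = _
  rw [coeff_sigmaInv_mul_shift _ (by omega), glAct_eq hN hiN hjN, map_sum, Finset.mul_sum,
    HahnSeries.coeff_sum]
  refine Finset.sum_congr rfl fun k _ => ?_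
  rw [neg_neg]
  split_ifs with h
  · rw [← coeff_sigma_mul_shift, map_mul, mul_left_comm]
    rw [map_pow, map_neg, map_one]
    have hs : ((-1 : K) ^ (k : ℕ)) = HahnSeries.C ((-1 : B) ^ (k : ℕ)) := by
      rw [map_pow, map_neg, map_one]
    rw [hs, HahnSeries.C_apply, HahnSeries.coeff_single_mul, sub_zero]
  · rw [map_zero, mul_zero, HahnSeries.coeff_zero]

/-! ### The weight filtration -/

theorem map_algebraMap_mul {A M : Type*} [CommRing A] [Algebra ℚ A] [AddCommGroup M] [Module ℚ M]
    (φ : A →+ M) (q : ℚ) (x : A) : φ (algebraMap ℚ A q * x) = q • φ x := by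
  rw [← Algebra.smul_def, map_rat_smul φ]

/-- The coefficient of `zⁱ wʲ` as an additive map. -/
def coeffLHom (i j : ℤ) : L →+ B where
  toFun F := coeffL F i j
  map_zero' := rfl
  map_add' _ _ := rfl

/-- The coefficient of `zⁱ wʲ t^β` as an additive map. -/
def coeffRHom (i j : ℤ) (β : ℕ →₀ ℕ) : R →+ B where
  toFun F := coeffR F i j β
  map_zero' := rfl
  map_add' _ _ := rfl

theorem R_smul_eq (q : ℚ) (F : R) : q • F = algebraMap ℚ R q * F := Algebra.smul_def q F

theorem coeffR_algebraMap_mul (q : ℚ) (F : R) (i j : ℤ) (β : ℕ →₀ ℕ) :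
    coeffR (algebraMap ℚ R q * F) i j β = q • coeffR F i j β :=
  map_algebraMap_mul (A := R) (coeffRHom i j β) q F

theorem coeffR_rat_smul (q : ℚ) (F : R) (i j : ℤ) (β : ℕ →₀ ℕ) :
    coeffR (q • F) i j β = q • coeffR F i j β := by
  rw [R_smul_eq, coeffR_algebraMap_mul]

theorem coeffL_mul_algebraMap (a : L) (q : ℚ) (i j : ℤ) :
    coeffL (a * algebraMap ℚ L q) i j = q • coeffL a i j := by
  have h := mul_comm a (algebraMap ℚ L q)
  exact (congrArg (fun x => coeffL x i j) h).trans
    (map_algebraMap_mul (A := L) (coeffLHom i j) q a)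

theorem coeffR_C (x : L) (i j : ℤ) (β : ℕ →₀ ℕ) :
    coeffR (MvPowerSeries.C x) i j β = if β = 0 then coeffL x i j else 0 := by
  classical
  rw [coeffR, MvPowerSeries.coeff_C]
  split_ifs <;> rfl

theorem coeffR_C_mul_ofT (x : L) (s : MvPowerSeries ℕ ℚ) (i j : ℤ) (β : ℕ →₀ ℕ) :
    coeffR (MvPowerSeries.C x * ofT s) i j β =
      MvPowerSeries.coeff β s • coeffL x i j := by
  rw [coeffR, MvPowerSeries.coeff_C_mul, ofT, MvPowerSeries.coeff_map, coeffL_mul_algebraMap]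

theorem exists_of_coeffL_mul_ne_zero {x y : L} {i j : ℤ} (h : coeffL (x * y) i j ≠ 0) :
    ∃ i₁ i₂ j₁ j₂, i₁ + i₂ = i ∧ j₁ + j₂ = j ∧ coeffL x i₁ j₁ ≠ 0 ∧ coeffL y i₂ j₂ ≠ 0 := by
  rw [coeffL, HahnSeries.coeff_mul, HahnSeries.coeff_sum] at h
  obtain ⟨p, hp, h⟩ := Finset.exists_ne_zero_of_sum_ne_zero h
  rw [HahnSeries.coeff_mul] at h
  obtain ⟨q, hq, h⟩ := Finset.exists_ne_zero_of_sum_ne_zero h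
  exact ⟨q.1, q.2, p.1, p.2, (Finset.mem_antidiagonal.mp hq).2.2,
    (Finset.mem_antidiagonal.mp hp).2.2, left_ne_zero_of_mul h, right_ne_zero_of_mul h⟩

theorem exists_of_coeffR_mul_ne_zero {F G : R} {i j : ℤ} {β : ℕ →₀ ℕ}
    (h : coeffR (F * G) i j β ≠ 0) :
    ∃ i₁ i₂ j₁ j₂ β₁ β₂, i₁ + i₂ = i ∧ j₁ + j₂ = j ∧ β₁ + β₂ = β ∧
      coeffR F i₁ j₁ β₁ ≠ 0 ∧ coeffR G i₂ j₂ β₂ ≠ 0 := by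
  classical
  rw [coeffR, MvPowerSeries.coeff_mul] at h
  change coeffLHom i j _ ≠ 0 at h
  rw [map_sum] at h
  obtain ⟨p, hp, h⟩ := Finset.exists_ne_zero_of_sum_ne_zero h
  obtain ⟨i₁, i₂, j₁, j₂, hi, hj, h1, h2⟩ := exists_of_coeffL_mul_ne_zero h
  exact ⟨i₁, i₂, j₁, j₂, p.1, p.2, hi, hj, Finset.HasAntidiagonal.mem_antidiagonal.mp hp, h1, h2⟩

/-- The weight of the monomial `zⁱ wʲ t^β`. The weights `1`, `2`, `3` of `z`, `w` and the `tᵢ` make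
`z`, `w`, `w/z`, `tᵢ/z` and `tᵢ/w` all positive. -/
def weight (i j : ℤ) (β : ℕ →₀ ℕ) : ℤ := i + 2 * j + 3 * (β.degree : ℕ)

/-- The filtration of `B((z))((w))⟦t⟧` by the weight. -/
def weightFiltration : MulFiltration R where
  step n :=
    { carrier := {F | ∀ i j β, weight i j β < n → coeffR F i j β = 0}
      add_mem' := fun {a b} ha hb i j β h => by
        change coeffR a i j β + coeffR b i j β = 0
        rw [ha i j β h, hb i j β h, add_zero]
      zero_mem' := fun i j β _ => rfl
      neg_mem' := fun {a} ha i j β h => by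
        change -coeffR a i j β = 0
        rw [ha i j β h, neg_zero] }
  algebraMap_mul_mem q x hx := fun i j β h => by
    rw [coeffR_algebraMap_mul, hx i j β h, smul_zero]
  antitone m n h x hx i j β hw := hx i j β (lt_of_lt_of_le hw (by exact_mod_cast h))
  one_mem i j β hw := by
    have h1 : (1 : R) = MvPowerSeries.C 1 := (map_one _).symm
    rw [h1, coeffR_C]
    split_ifs with h
    · have h2 : (1 : L) = mono 1 0 0 := rfl
      rw [h2, coeffL, mono]
      by_cases hj : j = 0
      · rw [hj, HahnSeries.coeff_single_same, HahnSeries.coeff_single_of_ne]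
        rintro rfl
        simp [weight, h, hj] at hw
      · rw [HahnSeries.coeff_single_of_ne hj, HahnSeries.coeff_zero]
    · rfl
  mul_mem {m n x y} hx hy i j β hw := by
    by_contra h
    obtain ⟨i₁, i₂, j₁, j₂, β₁, β₂, rfl, rfl, rfl, h1, h2⟩ := exists_of_coeffR_mul_ne_zero h
    have a1 := not_lt.mp fun h => h1 (hx i₁ j₁ β₁ h)
    have a2 := not_lt.mp fun h => h2 (hy i₂ j₂ β₂ h)
    simp only [weight, map_add] at a1 a2 hw
    push_cast at hw
    omega

/-- Powers of an element of positive filtration have weight tending to infinity, so each coefficient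
of the exponential is a finite sum. -/
theorem IsExp.formalHasExp {A E : R} (h : weightFiltration.IsExp A E) : FormalHasExp A E := by
  intro i j β
  have hzero : ∀ k : ℕ, weight i j β < k →
      coeffR (((k.factorial : ℚ)⁻¹) • A ^ k) i j β = 0 := fun k hk => by
    rw [coeffR_rat_smul, weightFiltration.pow_mem h.1 k i j β hk, smul_zero]
  set n := (weight i j β).toNat + 1 with hn
  have hsupp : {k : ℕ | coeffR (((k.factorial : ℚ)⁻¹) • A ^ k) i j β ≠ 0} ⊆ Finset.range n := by
    intro k hk
    rw [Finset.coe_range, Set.mem_Iio]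
    by_contra hkn
    exact hk (hzero k (by omega))
  refine ⟨(Finset.range n).finite_toSet.subset hsupp, ?_⟩
  rw [finsum_eq_sum_of_support_subset _ hsupp]
  have h1 := h.2 n i j β (by omega)
  have h2 : coeffRHom i j β (E - MulFiltration.expSum A n) = 0 := h1
  rw [map_sub, MulFiltration.expSum, map_sum, sub_eq_zero] at h2
  refine Eq.trans h2 (Finset.sum_congr rfl fun k _ => ?_)
  rw [R_smul_eq]
  rfl

/-- A ring homomorphism into `B((z))((w))⟦t⟧` is local if each coefficient of the image of a power
series depends only on finitely many orders of that series. -/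
def IsLocal {τ A : Type*} [CommRing A] (Ψ : MvPowerSeries τ A →+* R) : Prop :=
  ∀ i j β, ∃ K : ℕ, ∀ y : MvPowerSeries τ A, (K : ℕ∞) ≤ y.order → coeffR (Ψ y) i j β = 0

/-- Local homomorphisms commute with the exponential. -/
theorem IsLocal.isExp {τ A : Type*} [CommRing A] [Algebra ℚ A] {Ψ : MvPowerSeries τ A →+* R}
    (hΨ : IsLocal Ψ) {g : MvPowerSeries τ A} (hg : MvPowerSeries.constantCoeff g = 0)
    (hg1 : Ψ g ∈ weightFiltration.step 1) :
    weightFiltration.IsExp (Ψ g) (Ψ ((PowerSeries.exp ℚ).subst g)) := by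
  refine ⟨hg1, fun n i j β hw => ?_⟩
  obtain ⟨K₀, hK₀⟩ := hΨ i j β
  have h1 := hK₀ _ (le_trans (by exact_mod_cast le_max_left K₀ n)
    (mem_orderFiltration.mp ((isExp_subst hg).2 (max K₀ n))))
  have h2 := MulFiltration.expSum_sub_mem hg1 (le_max_right K₀ n) i j β hw
  have e : MulFiltration.expSum (Ψ g) (max K₀ n) = Ψ (MulFiltration.expSum g (max K₀ n)) := by
    rw [MulFiltration.expSum, MulFiltration.expSum, map_sum]
    refine Finset.sum_congr rfl fun k _ => ?_
    rw [← map_pow, map_mul]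
    exact congrArg (fun x => x * Ψ (g ^ k)) (map_algebraMap_rat (A' := R) Ψ _).symm
  have h3 : coeffRHom i j β (Ψ ((PowerSeries.exp ℚ).subst g) - MulFiltration.expSum (Ψ g) n) =
      coeffRHom i j β (Ψ ((PowerSeries.exp ℚ).subst g - MulFiltration.expSum g (max K₀ n))) +
      coeffRHom i j β (MulFiltration.expSum (Ψ g) (max K₀ n) - MulFiltration.expSum (Ψ g) n) := by
    rw [← map_add, map_sub Ψ, e]
    congr 1
    ring
  exact h3.trans (by rw [show coeffRHom i j β _ = 0 from h1, show coeffRHom i j β _ = 0 from h2,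
    add_zero])

/-! ### Formal sums -/

theorem FormalHasSum.add {ι : Type*} {f g : ι → R} {F G : R} (hf : FormalHasSum f F)
    (hg : FormalHasSum g G) : FormalHasSum (fun k => f k + g k) (F + G) := by
  intro i j β
  have hadd : ∀ x y : R, coeffR (x + y) i j β = coeffR x i j β + coeffR y i j β := fun _ _ => rfl
  refine ⟨((hf i j β).1.union (hg i j β).1).subset fun k hk => ?_, ?_⟩
  · by_contra h
    simp only [Set.mem_union, Set.mem_ofPred_eq, not_or, not_not] at h
    exact hk (by rw [hadd, h.1, h.2, add_zero])
  · rw [hadd, (hf i j β).2, (hg i j β).2, ← finsum_add_distrib (hf i j β).1 (hg i j β).1]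
    rfl

theorem formalHasSum_zero {ι : Type*} : FormalHasSum (fun _ : ι => (0 : R)) 0 := by
  intro i j β
  have h : coeffR (0 : R) i j β = 0 := rfl
  simp [h]

theorem FormalHasSum.sum {ι κ : Type*} (s : Finset κ) {f : κ → ι → R} {F : κ → R}
    (h : ∀ a ∈ s, FormalHasSum (f a) (F a)) :
    FormalHasSum (fun k => ∑ a ∈ s, f a k) (∑ a ∈ s, F a) := by
  classical
  induction s using Finset.induction_on with
  | empty => simpa using formalHasSum_zero
  | insert a s ha ih =>
    simp_rw [Finset.sum_insert ha]
    exact (h a (Finset.mem_insert_self _ _)).add (ih fun b hb => h b (Finset.mem_insert_of_mem hb))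

/-- Local homomorphisms preserve the expansion of a power series into monomials. -/
theorem IsLocal.formalHasSum {A : Type*} [CommRing A] {Ψ : PowerSeries A →+* R}
    (hΨ : IsLocal (τ := Unit) Ψ) {g : PowerSeries A} (hg : PowerSeries.constantCoeff g = 0) :
    FormalHasSum (fun n : ℕ+ => Ψ (PowerSeries.monomial n (PowerSeries.coeff n g))) (Ψ g) := by
  classical
  intro i j β
  obtain ⟨K, hK⟩ := hΨ i j β
  have horder : ∀ (y : PowerSeries A), (∀ m < K, PowerSeries.coeff m y = 0) →
      coeffR (Ψ y) i j β = 0 := by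
    intro y hy
    refine hK y (MvPowerSeries.nat_le_order fun d hd => ?_)
    obtain ⟨k, rfl⟩ : ∃ k, d = Finsupp.single () k := ⟨d (), by ext; simp⟩
    exact hy k (by simpa using hd)
  set f : ℕ+ → R := fun n => Ψ (PowerSeries.monomial n (PowerSeries.coeff n g)) with hf
  have hsupp : {n : ℕ+ | coeffR (f n) i j β ≠ 0} ⊆
      ((Finset.range K).preimage (fun n : ℕ+ => (n : ℕ)) PNat.coe_injective.injOn) := by
    intro n hn
    simp only [Finset.coe_preimage, Finset.coe_range, Set.mem_preimage, Set.mem_Iio]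
    by_contra h
    refine hn (horder _ fun m hm => ?_)
    rw [PowerSeries.coeff_monomial, if_neg (by omega)]
  refine ⟨(Finset.finite_toSet _).subset hsupp, ?_⟩
  rw [finsum_eq_sum_of_support_subset _ hsupp]
  have h1 : coeffRHom i j β (Ψ (g - ∑ n ∈ (Finset.range K).preimage (fun n : ℕ+ => (n : ℕ))
      PNat.coe_injective.injOn, PowerSeries.monomial n (PowerSeries.coeff n g))) = 0 := by
    refine horder _ fun m hm => ?_
    rw [map_sub, map_sum, sub_eq_zero]
    rcases m with _ | m
    · rw [PowerSeries.coeff_zero_eq_constantCoeff_apply, hg]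
      symm
      refine Finset.sum_eq_zero fun n _ => ?_
      rw [PowerSeries.coeff_monomial, if_neg n.ne_zero.symm]
    · rw [Finset.sum_eq_single ⟨m + 1, m.succ_pos⟩]
      · rw [PowerSeries.coeff_monomial, PNat.mk_coe, if_pos rfl]
      · intro n _ hn
        rw [PowerSeries.coeff_monomial, if_neg]
        intro h
        exact hn (PNat.coe_injective h.symm)
      · intro h
        refine absurd ?_ h
        exact Finset.mem_preimage.mpr (Finset.mem_range.mpr hm)
  rw [map_sub, map_sub, sub_eq_zero, map_sum, map_sum] at h1
  exact h1

/-! ### Series in one of the variables -/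

/-- Series in `z`. -/
def zHom : PowerSeries B →+* R :=
  MvPowerSeries.C.comp ((HahnSeries.C : K →+* L).comp (HahnSeries.ofPowerSeries ℤ B))

/-- Series in `w` with coefficients in `B((z))`. -/
def wHom : PowerSeries K →+* R := MvPowerSeries.C.comp (HahnSeries.ofPowerSeries ℤ K)

/-- Series in `tₖ` with coefficients in `A`. -/
def tHomOf (A : Type*) [CommRing A] (k : ℕ) : PowerSeries A →+* MvPowerSeries ℕ A :=
  (PowerSeries.substAlgHom (R := A) (S := A) (a := (MvPowerSeries.X k : MvPowerSeries ℕ A))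
    (PowerSeries.HasSubst.X k)).toRingHom

theorem tHomOf_apply {A : Type*} [CommRing A] (k : ℕ) (f : PowerSeries A) :
    tHomOf A k f = f.subst (MvPowerSeries.X k : MvPowerSeries ℕ A) := by
  change PowerSeries.substAlgHom (R := A) (S := A) (PowerSeries.HasSubst.X k) f = _
  rw [PowerSeries.coe_substAlgHom]

theorem coeff_tHomOf {A : Type*} [CommRing A] (k : ℕ) (f : PowerSeries A) (β : ℕ →₀ ℕ) :
    MvPowerSeries.coeff β (tHomOf A k f) =
      if β = Finsupp.single k (β k) then PowerSeries.coeff (β k) f else 0 := by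
  rw [tHomOf_apply, PowerSeries.coeff_subst_single]

/-- Series in `tₖ` with coefficients in `B((z))((w))`. -/
def tHom (k : ℕ) : PowerSeries L →+* R := tHomOf L k

theorem coeffR_zHom (f : PowerSeries B) (i j : ℤ) (β : ℕ →₀ ℕ) : coeffR (zHom f) i j β =
    if β = 0 ∧ j = 0 ∧ 0 ≤ i then PowerSeries.coeff i.toNat f else 0 := by
  change coeffR (MvPowerSeries.C (HahnSeries.C (HahnSeries.ofPowerSeries ℤ B f))) i j β = _
  rw [coeffR_C]
  by_cases hβ : β = 0
  · rw [if_pos hβ, coeffL, HahnSeries.C_apply]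
    by_cases hj : j = 0
    · rw [hj, HahnSeries.coeff_single_same, coeff_ofPowerSeries]
      simp [hβ]
    · rw [HahnSeries.coeff_single_of_ne hj, HahnSeries.coeff_zero, if_neg (by tauto)]
  · rw [if_neg hβ, if_neg (by tauto)]

theorem coeffR_wHom (f : PowerSeries K) (i j : ℤ) (β : ℕ →₀ ℕ) : coeffR (wHom f) i j β =
    if β = 0 ∧ 0 ≤ j then (PowerSeries.coeff j.toNat f).coeff i else 0 := by
  change coeffR (MvPowerSeries.C (HahnSeries.ofPowerSeries ℤ K f)) i j β = _
  rw [coeffR_C]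
  by_cases hβ : β = 0
  · rw [if_pos hβ, coeffL, coeff_ofPowerSeries]
    by_cases hj : 0 ≤ j
    · simp [hβ, hj]
    · simp [hj]
  · rw [if_neg hβ, if_neg (by tauto)]

theorem coeffR_tHom (k : ℕ) (f : PowerSeries L) (i j : ℤ) (β : ℕ →₀ ℕ) : coeffR (tHom k f) i j β =
    if β = Finsupp.single k (β k) then coeffL (PowerSeries.coeff (β k) f) i j else 0 := by
  rw [coeffR]
  refine (congrArg (fun x => coeffL x i j) (coeff_tHomOf k f β)).trans ?_
  split_ifs <;> rfl

theorem coeff_eq_zero_of_lt_order {A : Type*} [CommRing A] {y : MvPowerSeries Unit A} {K m : ℕ}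
    (h : (K : ℕ∞) ≤ y.order) (hm : m < K) : PowerSeries.coeff m (y : PowerSeries A) = 0 := by
  refine MvPowerSeries.coeff_of_lt_order (lt_of_lt_of_le ?_ h)
  simpa using hm

theorem isLocal_zHom : IsLocal (τ := Unit) zHom := fun i j β => by
  refine ⟨i.toNat + 1, fun y hy => ?_⟩
  rw [coeffR_zHom, coeff_eq_zero_of_lt_order hy (Nat.lt_succ_self _), ite_self]

theorem isLocal_wHom : IsLocal (τ := Unit) wHom := fun i j β => by
  refine ⟨j.toNat + 1, fun y hy => ?_⟩
  rw [coeffR_wHom, coeff_eq_zero_of_lt_order hy (Nat.lt_succ_self _), HahnSeries.coeff_zero,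
    ite_self]

theorem isLocal_tHom (k : ℕ) : IsLocal (τ := Unit) (A := L) (tHom k) := fun i j β => by
  refine ⟨β k + 1, fun y hy => ?_⟩
  rw [coeffR_tHom, coeff_eq_zero_of_lt_order hy (Nat.lt_succ_self _)]
  exact ite_self _

theorem coeff_xSeries_zero : PowerSeries.coeff 0 xSeries = 0 := by
  rw [PowerSeries.coeff_zero_eq_constantCoeff_apply, constantCoeff_xSeries]

theorem coeff_xSeries (n : ℕ+) : PowerSeries.coeff n xSeries = MvPolynomial.X n := by
  rw [xSeries, PowerSeries.coeff_mk, dif_pos n.pos]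
  rfl

theorem zHom_xSeries_mem : zHom xSeries ∈ weightFiltration.step 1 := by
  intro i j β hw
  rw [coeffR_zHom]
  split_ifs with h
  · obtain ⟨rfl, rfl, hi⟩ := h
    simp only [weight, map_zero, Nat.cast_zero, Nat.cast_one] at hw
    obtain rfl : i = 0 := by omega
    exact coeff_xSeries_zero
  · rfl

theorem wHom_xSeries_mem :
    wHom (PowerSeries.map (HahnSeries.C : B →+* K) (-xSeries)) ∈ weightFiltration.step 1 := by
  intro i j β hw
  rw [coeffR_wHom]
  split_ifs with h
  · obtain ⟨rfl, hj⟩ := h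
    simp only [weight, map_zero, Nat.cast_zero, Nat.cast_one] at hw
    rw [PowerSeries.coeff_map, HahnSeries.C_apply]
    by_cases hi : i = 0
    · obtain rfl : j = 0 := by omega
      rw [hi, HahnSeries.coeff_single_same, map_neg, Int.toNat_zero, coeff_xSeries_zero, neg_zero]
    · rw [HahnSeries.coeff_single_of_ne hi]
  · rfl

theorem wHom_logSeries_mem :
    wHom (PowerSeries.rescale zInv (logSeries K)) ∈ weightFiltration.step 1 := by
  intro i j β hw
  rw [coeffR_wHom]
  split_ifs with h
  · obtain ⟨rfl, hj⟩ := h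
    simp only [weight, map_zero, Nat.cast_zero, Nat.cast_one] at hw
    rw [PowerSeries.coeff_rescale, zInv_pow, HahnSeries.coeff_single_mul, one_mul]
    by_cases hi : i = -j
    · obtain rfl : j = 0 := by omega
      rw [Int.toNat_zero, PowerSeries.coeff_zero_eq_constantCoeff_apply, constantCoeff_logSeries,
        HahnSeries.coeff_zero]
    · rw [logSeries, PowerSeries.coeff_mk]
      have : algebraMap ℚ K ((j.toNat : ℚ))⁻¹ =
          HahnSeries.C (algebraMap ℚ B ((j.toNat : ℚ))⁻¹) :=
        (map_algebraMap_rat (A := B) (A' := K) HahnSeries.C _).symm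
      rw [this, HahnSeries.C_apply, HahnSeries.coeff_single_of_ne (by omega)]
  · rfl

theorem coeffL_doubleShift_X {n : ℕ+} {i j : ℤ} (h : i + 2 * j + 2 * n < 0) :
    coeffL (doubleShift (MvPolynomial.X n)) i j = 0 := by
  have hn := n.pos
  have hm : ∀ (b : B) (i' j' : ℤ), 0 ≤ i' + 2 * j' + 2 * n → coeffL (mono b i' j') i j = 0 := by
    intro b i' j' h'
    rw [coeffL, mono]
    by_cases hj : j = j'
    · rw [hj, HahnSeries.coeff_single_same, HahnSeries.coeff_single_of_ne (by omega)]
    · rw [HahnSeries.coeff_single_of_ne hj, HahnSeries.coeff_zero]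
  have h1 : ∀ x y : L, coeffL (x - y) i j = coeffL x i j - coeffL y i j :=
    fun x y => map_sub (coeffLHom i j) x y
  have h2 : ∀ (q : ℚ) (x : L), coeffL (q • x) i j = q • coeffL x i j := fun _ _ => rfl
  rw [doubleShift_X, h1, h2, h1, hm _ _ _ (by omega), hm _ _ _ (by omega), hm _ _ _ (by omega)]
  simp

theorem tHom_xSeries_mem (k : ℕ) :
    tHom k (PowerSeries.map doubleShift xSeries) ∈ weightFiltration.step 1 := by
  intro i j β hw
  rw [coeffR_tHom]
  split_ifs with h
  · rw [PowerSeries.coeff_map]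
    by_cases h0 : β k = 0
    · rw [h0, coeff_xSeries_zero, map_zero]
      rfl
    · have hc := coeff_xSeries ⟨β k, Nat.pos_of_ne_zero h0⟩
      rw [PNat.mk_coe] at hc
      rw [hc]
      apply coeffL_doubleShift_X
      rw [PNat.mk_coe]
      rw [weight, h, Finsupp.degree_single] at hw
      push_cast at hw
      omega
  · rfl

/-! ### The exponent and its exponential for finitely many variables -/

/-- The exponent for `N` variables `tᵢ`. -/
def exponent (N : ℕ) : R :=
  zHom xSeries + wHom (PowerSeries.map (HahnSeries.C : B →+* K) (-xSeries)) +
    wHom (PowerSeries.rescale zInv (logSeries K)) +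
    ∑ k : Fin N, tHom k (PowerSeries.map doubleShift xSeries)

/-- Its exponential. -/
def exponential (N : ℕ) : R :=
  MvPowerSeries.C (geom * expMultiplication) *
    ∏ k : Fin N, tHom k (PowerSeries.map doubleShift completeSeries)

theorem ofPowerSeries_geomInv : HahnSeries.ofPowerSeries ℤ K geomInv = geom := by
  rw [geom, geomInv]
  congr 1
  ext1 n
  rw [PowerSeries.coeff_rescale, PowerSeries.coeff_mk, PowerSeries.coeff_mk, zInv_pow, mul_one]

theorem constZ_ofPowerSeries (f : PowerSeries B) :
    constZ (HahnSeries.ofPowerSeries ℤ B f) =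
      HahnSeries.ofPowerSeries ℤ K (PowerSeries.map (HahnSeries.C : B →+* K) f) := by
  ext1
  funext j
  rw [mapLaurent_coeff, coeff_ofPowerSeries, coeff_ofPowerSeries, PowerSeries.coeff_map]
  split_ifs
  · rfl
  · exact map_zero _

theorem exp_wHom_xSeries : HahnSeries.ofPowerSeries ℤ K ((PowerSeries.exp ℚ).subst
    (PowerSeries.map (HahnSeries.C : B →+* K) (-xSeries))) = constZ sigmaInv := by
  have h : MvPowerSeries.constantCoeff (-xSeries) = 0 := by
    rw [map_neg]
    exact neg_eq_zero.mpr constantCoeff_xSeries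
  rw [sigmaInv, constZ_ofPowerSeries, completeInv]
  exact congrArg _ (map_exp_subst (τ := Unit) (HahnSeries.C : B →+* K) h).symm

theorem constantCoeff_map_neg_xSeries : PowerSeries.constantCoeff
    (PowerSeries.map (HahnSeries.C : B →+* K) (-xSeries)) = 0 := by
  rw [map_neg, map_neg, constantCoeff_map_xSeries, neg_zero]

theorem constantCoeff_map_doubleShift_xSeries :
    PowerSeries.constantCoeff (PowerSeries.map doubleShift xSeries) = 0 := by
  rw [← PowerSeries.coeff_zero_eq_constantCoeff_apply, PowerSeries.coeff_map, coeff_xSeries_zero,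
    map_zero]

theorem map_doubleShift_completeSeries : PowerSeries.map doubleShift completeSeries =
    (PowerSeries.exp ℚ).subst (PowerSeries.map doubleShift xSeries) := by
  have h := map_completeSeries (A := L) doubleShift
  exact h

/-- The four kinds of terms of the exponent have the exponentials `exp (∑ xₙ zⁿ)`,
`exp (-∑ xₙ wⁿ)`, `(1 - w/z)⁻¹` and `∑_j S_j(x) t_kʲ` with shifted `x`. -/
theorem isExp_exponent (N : ℕ) : weightFiltration.IsExp (exponent N) (exponential N) := by
  have h1 := isLocal_zHom.isExp constantCoeff_xSeries zHom_xSeries_mem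
  have h2 := isLocal_wHom.isExp constantCoeff_map_neg_xSeries wHom_xSeries_mem
  have h3 := isLocal_wHom.isExp (constantCoeff_rescale_logSeries zInv) wHom_logSeries_mem
  have h4 : ∀ k : ℕ, weightFiltration.IsExp (tHom k (PowerSeries.map doubleShift xSeries))
      (tHom k ((PowerSeries.exp ℚ).subst (PowerSeries.map doubleShift xSeries))) := fun k =>
    (isLocal_tHom k).isExp constantCoeff_map_doubleShift_xSeries (tHom_xSeries_mem k)
  have h5 := MulFiltration.IsExp.sum (F := weightFiltration) (Finset.univ : Finset (Fin N))
    (f := fun k => tHom k (PowerSeries.map doubleShift xSeries))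
    (E := fun k => tHom k ((PowerSeries.exp ℚ).subst (PowerSeries.map doubleShift xSeries)))
    fun k _ => h4 k
  have e1 : zHom ((PowerSeries.exp ℚ).subst xSeries) =
      MvPowerSeries.C (HahnSeries.C sigma : L) := rfl
  have e2 : wHom ((PowerSeries.exp ℚ).subst
      (PowerSeries.map (HahnSeries.C : B →+* K) (-xSeries))) =
      MvPowerSeries.C (constZ sigmaInv) := congrArg (MvPowerSeries.C : L →+* R) exp_wHom_xSeries
  have e3 : wHom ((PowerSeries.exp ℚ).subst (PowerSeries.rescale zInv (logSeries K))) =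
      MvPowerSeries.C geom := by
    rw [← geomInv_eq_exp, ← ofPowerSeries_geomInv]
    rfl
  have e4 : exponential N = MvPowerSeries.C (HahnSeries.C sigma : L) *
      MvPowerSeries.C (constZ sigmaInv) * MvPowerSeries.C geom *
      ∏ k : Fin N, tHom k ((PowerSeries.exp ℚ).subst (PowerSeries.map doubleShift xSeries)) := by
    rw [exponential, expMultiplication_eq, map_doubleShift_completeSeries, mul_comm geom]
    congr 1
    rw [← map_mul, ← map_mul]
  rw [e4, ← e1, ← e2, ← e3]
  exact ((h1.add h2).add h3).add h5

/-! ### The expansion of the exponent -/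

theorem mono_mul_mono (a b : B) (i j i' j' : ℤ) :
    mono a i j * mono b i' j' = mono (a * b) (i + i') (j + j') := by
  rw [mono, mono, HahnSeries.single_mul_single, HahnSeries.single_mul_single, mono]

theorem algebraMap_R (q : ℚ) : algebraMap ℚ R q = MvPowerSeries.C (algebraMap ℚ L q) :=
  (map_algebraMap_rat (A := L) (A' := R) MvPowerSeries.C q).symm

/-- The part of the `n`-th term of the exponent that does not contain `t`. -/
def baseTerm (n : ℕ+) : L :=
  algebraMap ℚ L (1 / (n : ℚ)) * mono 1 (-(n : ℤ)) n + mono (MvPolynomial.X n) n 0 -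
    mono (MvPolynomial.X n) 0 n

theorem map_combination {A A' : Type*} [CommRing A] [CommRing A'] (φ : A →+* A')
    (q a b c x d e : A) (s : A') :
    φ q * (φ a - φ b * s + φ c * s) + φ x * (φ d - φ e + s) =
      φ (q * a + x * d - x * e) + φ (x - q * (b - c)) * s := by
  simp only [map_add, map_sub, map_mul]
  ring

theorem baseTerm_eq (n : ℕ+) : baseTerm n = mono (PowerSeries.coeff n xSeries) n 0 +
    HahnSeries.single (n : ℤ) (PowerSeries.coeff n
      (PowerSeries.map (HahnSeries.C : B →+* K) (-xSeries))) +
    HahnSeries.single (n : ℤ) (PowerSeries.coeff n (PowerSeries.rescale zInv (logSeries K))) := by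
  have h1 : HahnSeries.single (n : ℤ) (PowerSeries.coeff n
      (PowerSeries.map (HahnSeries.C : B →+* K) (-xSeries))) =
      (-mono (MvPolynomial.X n) 0 n : L) := by
    rw [map_neg, map_neg, PowerSeries.coeff_map, coeff_xSeries, HahnSeries.single_neg]
    rfl
  have h2 : algebraMap ℚ L (1 / (n : ℚ)) = HahnSeries.C (algebraMap ℚ K (1 / (n : ℚ))) :=
    (map_algebraMap_rat (A := K) (A' := L) HahnSeries.C _).symm
  have h3 : HahnSeries.single (n : ℤ)
      (PowerSeries.coeff n (PowerSeries.rescale zInv (logSeries K))) =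
      algebraMap ℚ L (1 / (n : ℚ)) * mono 1 (-(n : ℤ)) n := by
    rw [h2, HahnSeries.C_apply, mono, HahnSeries.single_mul_single, zero_add,
      PowerSeries.coeff_rescale, zInv_pow, logSeries, PowerSeries.coeff_mk, one_div, mul_comm]
  rw [h1, h3, coeff_xSeries, baseTerm]
  ring

theorem exponentTerm_eq (r : ℕ∞) (n : ℕ+) : exponentTerm r n =
    MvPowerSeries.C (baseTerm n) +
      MvPowerSeries.C (doubleShift (MvPolynomial.X n)) * ofT (powerSum r n) := by
  have h1 : (mono (MvPolynomial.X n) n 0 : L) =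
      mono (MvPolynomial.X n) 0 0 * mono 1 (n : ℤ) 0 := by
    rw [mono_mul_mono, mul_one, zero_add, zero_add]
  have h2 : (mono (MvPolynomial.X n) 0 n : L) =
      mono (MvPolynomial.X n) 0 0 * mono 1 0 (n : ℤ) := by
    rw [mono_mul_mono, mul_one, zero_add, zero_add]
  have h3 := doubleShift_X n
  rw [L_smul_eq] at h3
  rw [exponentTerm, R_smul_eq, algebraMap_R, h3, baseTerm, h1, h2]
  have key := map_combination (A := L) (A' := R) MvPowerSeries.C (algebraMap ℚ L (1 / (n : ℚ)))
    (mono 1 (-(n : ℤ)) (n : ℤ)) (mono 1 (-(n : ℤ)) 0) (mono 1 0 (-(n : ℤ)))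
    (mono (MvPolynomial.X n) 0 0) (mono 1 (n : ℤ) 0) (mono 1 0 (n : ℤ)) (ofT (powerSum r n))
  exact key

theorem ofPowerSeries_monomial {A : Type*} [CommRing A] (n : ℕ) (a : A) :
    HahnSeries.ofPowerSeries ℤ A (PowerSeries.monomial n a) = HahnSeries.single (n : ℤ) a := by
  ext1
  funext i
  rw [coeff_ofPowerSeries, PowerSeries.coeff_monomial, HahnSeries.coeff_single]
  grind

theorem zHom_monomial (n : ℕ) (b : B) :
    zHom (PowerSeries.monomial n b) = MvPowerSeries.C (mono b n 0) := by
  have h := congrArg (fun x : K => (MvPowerSeries.C (HahnSeries.C x : L) : R))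
    (ofPowerSeries_monomial n b)
  exact h

theorem wHom_monomial (n : ℕ) (b : K) :
    wHom (PowerSeries.monomial n b) = MvPowerSeries.C (HahnSeries.single (n : ℤ) b : L) := by
  have h := congrArg (fun x : L => (MvPowerSeries.C x : R)) (ofPowerSeries_monomial n b)
  exact h

theorem tHom_monomial (k n : ℕ) (x : L) : tHom k (PowerSeries.monomial n x) =
    MvPowerSeries.C x * ofT (MvPowerSeries.monomial (Finsupp.single k n) 1) := by
  classical
  ext1 β
  rw [MvPowerSeries.coeff_C_mul, ofT, MvPowerSeries.coeff_map, MvPowerSeries.coeff_monomial]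
  refine (coeff_tHomOf k _ β).trans ?_
  rw [PowerSeries.coeff_monomial]
  by_cases h : β = Finsupp.single k n
  · rw [if_pos h, h, Finsupp.single_eq_same, if_pos rfl, if_pos rfl, map_one, mul_one]
  · rw [if_neg h, map_zero, mul_zero]
    split_ifs with h1 h2
    · rw [h2] at h1
      exact absurd h1 h
    · rfl
    · rfl

theorem powerSum_natCast (N : ℕ) (n : ℕ+) : powerSum N n =
    ∑ k : Fin N, MvPowerSeries.monomial (Finsupp.single (k : ℕ) (n : ℕ)) 1 := by
  classical
  ext1 β
  rw [map_sum]
  simp_rw [MvPowerSeries.coeff_monomial]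
  change (if _ then _ else _) = _
  split_ifs with h
  · obtain ⟨i, hi, rfl⟩ := h
    rw [Nat.cast_lt] at hi
    rw [Finset.sum_eq_single ⟨i, hi⟩]
    · rw [if_pos rfl]
    · intro k _ hk
      rw [if_neg]
      intro h
      have h' := (Finsupp.single_left_inj n.ne_zero).mp h
      exact hk (Fin.ext h'.symm)
    · intro h
      exact absurd (Finset.mem_univ _) h
  · symm
    refine Finset.sum_eq_zero fun k _ => if_neg fun hk => h ⟨k, ?_, hk⟩
    exact_mod_cast k.2

theorem FormalHasSum.congr {ι : Type*} {f g : ι → R} {F : R} (h : ∀ k, g k = f k)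
    (hf : FormalHasSum f F) : FormalHasSum g F := by
  rwa [funext h]

theorem formalHasSum_exponent_natCast (N : ℕ) :
    FormalHasSum (fun n : ℕ+ => exponentTerm N n) (exponent N) := by
  have h1 := isLocal_zHom.formalHasSum constantCoeff_xSeries
  have h2 := isLocal_wHom.formalHasSum constantCoeff_map_neg_xSeries
  have h3 := isLocal_wHom.formalHasSum (constantCoeff_rescale_logSeries zInv)
  have h4 := fun k : ℕ => IsLocal.formalHasSum (A := L) (isLocal_tHom k)
    constantCoeff_map_doubleShift_xSeries
  have h5 := FormalHasSum.sum (Finset.univ : Finset (Fin N)) fun k _ => h4 k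
  have h6 := ((h1.add h2).add h3).add h5
  refine FormalHasSum.congr (fun n => ?_) h6
  have ht : ofT (∑ k : Fin N, MvPowerSeries.monomial (Finsupp.single (k : ℕ) (n : ℕ)) 1) =
      ∑ k : Fin N, ofT (MvPowerSeries.monomial (Finsupp.single (k : ℕ) (n : ℕ)) 1) :=
    map_sum _ _ _
  rw [exponentTerm_eq, powerSum_natCast, ht, Finset.mul_sum, zHom_monomial, wHom_monomial,
    wHom_monomial, baseTerm_eq, map_add, map_add]
  congr 1
  refine Finset.sum_congr rfl fun k _ => ?_
  rw [tHom_monomial, PowerSeries.coeff_map, coeff_xSeries]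

/-! ### Passage to an arbitrary number of variables -/

theorem coeff_exponent_succ {N : ℕ} {β : ℕ →₀ ℕ} (hβ : β N = 0) :
    MvPowerSeries.coeff β (exponent (N + 1)) = MvPowerSeries.coeff β (exponent N) := by
  have h1 : MvPowerSeries.coeff β (tHom N (PowerSeries.map doubleShift xSeries)) = 0 := by
    refine (coeff_tHomOf N _ β).trans ?_
    rw [hβ, PowerSeries.coeff_map, coeff_xSeries_zero, map_zero, ite_self]
  have h2 : exponent (N + 1) =
      exponent N + tHom N (PowerSeries.map doubleShift xSeries) := by
    rw [exponent, Fin.sum_univ_castSucc, ← add_assoc]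
    rfl
  rw [h2, map_add, h1, add_zero]

/-- The coefficient of `t^β` in a symmetric series in `r` variables can be computed with the first
`N` variables: `N ≤ r`, and the remaining ones of the `r` variables do not occur in `t^β`. -/
def IsRank (r : ℕ∞) (N : ℕ) (β : ℕ →₀ ℕ) : Prop :=
  (N : ℕ∞) ≤ r ∧ ∀ k : ℕ, N ≤ k → (k : ℕ∞) < r → β k = 0

theorem IsRank.of_le {r : ℕ∞} {N : ℕ} {β γ : ℕ →₀ ℕ} (h : IsRank r N β) (hγ : γ ≤ β) :
    IsRank r N γ :=
  ⟨h.1, fun k hk hr => Nat.le_zero.mp ((hγ k).trans (h.2 k hk hr).le)⟩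

/-- A sequence of series that stabilizes coefficientwise has coefficients that do not depend on the
choice of the rank. -/
theorem coeff_eq_of_isRank {F : ℕ → R} (hF : ∀ (N : ℕ) (β : ℕ →₀ ℕ), β N = 0 →
      MvPowerSeries.coeff β (F (N + 1)) = MvPowerSeries.coeff β (F N))
    {r : ℕ∞} {M N : ℕ} {β : ℕ →₀ ℕ} (hM : IsRank r M β) (hN : IsRank r N β) :
    MvPowerSeries.coeff β (F M) = MvPowerSeries.coeff β (F N) := by
  wlog h : M ≤ N generalizing M N
  · exact (this hN hM (le_of_not_ge h)).symm
  obtain ⟨n, rfl⟩ := Nat.exists_eq_add_of_le h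
  clear h
  induction n with
  | zero => rfl
  | succ n ih =>
    have hlt : ((M + n : ℕ) : ℕ∞) < r := lt_of_lt_of_le (by exact_mod_cast Nat.lt_succ_self _) hN.1
    have h0 : β (M + n) = 0 := hM.2 _ (Nat.le_add_right M n) hlt
    rw [← add_assoc, hF _ _ h0]
    refine ih ⟨hlt.le, fun k hk hr => hM.2 k (by omega) hr⟩

/-- A number of variables that suffices for the coefficient of `t^β`, and for all partitions of
size at most the degree of `β`. -/
def rank (r : ℕ∞) (β : ℕ →₀ ℕ) : ℕ :=
  if r = ⊤ then β.support.sup Nat.succ + β.degree else r.toNat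

theorem apply_eq_zero_of_sup_le {β : ℕ →₀ ℕ} {k : ℕ} (h : β.support.sup Nat.succ ≤ k) :
    β k = 0 := by
  by_contra hk
  have := Finset.le_sup (f := Nat.succ) (Finsupp.mem_support_iff.mpr hk)
  omega

theorem rank_top (β : ℕ →₀ ℕ) : rank ⊤ β = β.support.sup Nat.succ + β.degree := if_pos rfl

theorem rank_natCast (n : ℕ) (β : ℕ →₀ ℕ) : rank n β = n := by
  rw [rank, if_neg (ENat.natCast_ne_top n), ENat.toNat_natCast]

theorem isRank_rank (r : ℕ∞) (β : ℕ →₀ ℕ) : IsRank r (rank r β) β := by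
  induction r using ENat.recTopCoe with
  | top =>
    rw [rank_top]
    exact ⟨le_top, fun k hk _ => apply_eq_zero_of_sup_le (by omega)⟩
  | coe n =>
    rw [rank_natCast]
    exact ⟨le_rfl, fun k hk hr => absurd (Nat.cast_lt.mp hr) (not_lt.mpr hk)⟩

/-- The series in `r` variables whose coefficient at `t^β` is that of `F N`, the series in the first
`N` variables, for `N = rank r β`. -/
def limitSeries {A : Type*} [CommRing A] (r : ℕ∞) (F : ℕ → MvPowerSeries ℕ A) :
    MvPowerSeries ℕ A :=
  fun β => MvPowerSeries.coeff β (F (rank r β))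

theorem coeff_limitSeries {A : Type*} [CommRing A] (r : ℕ∞) (F : ℕ → MvPowerSeries ℕ A)
    (β : ℕ →₀ ℕ) :
    MvPowerSeries.coeff β (limitSeries r F) = MvPowerSeries.coeff β (F (rank r β)) := rfl

/-- The exponent for `r` variables. -/
def exponentT (r : ℕ∞) : R := limitSeries (A := L) r exponent

/-- The exponential of the exponent for `r` variables. -/
def exponentialT (r : ℕ∞) : R := limitSeries (A := L) r exponential

theorem coeff_exponentT_rank (r : ℕ∞) (β : ℕ →₀ ℕ) :
    MvPowerSeries.coeff β (exponentT r) = MvPowerSeries.coeff β (exponent (rank r β)) :=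
  coeff_limitSeries (A := L) r exponent β

theorem coeffR_exponentialT_rank (r : ℕ∞) (i j : ℤ) (β : ℕ →₀ ℕ) :
    coeffR (exponentialT r) i j β = coeffR (exponential (rank r β)) i j β :=
  congrArg (fun x => coeffL x i j) (coeff_limitSeries (A := L) r exponential β)

theorem coeffR_exponentT_rank (r : ℕ∞) (i j : ℤ) (β : ℕ →₀ ℕ) :
    coeffR (exponentT r) i j β = coeffR (exponent (rank r β)) i j β :=
  congrArg (fun x => coeffL x i j) (coeff_exponentT_rank r β)

theorem coeff_exponentT {r : ℕ∞} {N : ℕ} {β : ℕ →₀ ℕ} (h : IsRank r N β) :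
    MvPowerSeries.coeff β (exponentT r) = MvPowerSeries.coeff β (exponent N) := by
  rw [coeff_exponentT_rank]
  exact coeff_eq_of_isRank (fun _ _ => coeff_exponent_succ) (isRank_rank r β) h

/-- The coefficient of a power at `t^β` depends only on the coefficients at divisors of `t^β`. -/
theorem coeff_pow_congr {F G : R} {β : ℕ →₀ ℕ}
    (h : ∀ γ ≤ β, MvPowerSeries.coeff γ F = MvPowerSeries.coeff γ G) (k : ℕ) :
    ∀ γ ≤ β, MvPowerSeries.coeff γ (F ^ k) = MvPowerSeries.coeff γ (G ^ k) := by
  classical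
  induction k with
  | zero => exact fun γ _ => by rw [pow_zero, pow_zero]
  | succ k ih =>
    intro γ hγ
    rw [pow_succ, pow_succ, MvPowerSeries.coeff_mul, MvPowerSeries.coeff_mul]
    refine Finset.sum_congr rfl fun p hp => ?_
    have hp' := Finset.HasAntidiagonal.mem_antidiagonal.mp hp
    rw [ih p.1 ((le_self_add.trans hp'.le).trans hγ), h p.2 ((le_add_self.trans hp'.le).trans hγ)]

theorem formalHasExp_exponentT (r : ℕ∞) : FormalHasExp (exponentT r) (exponentialT r) := by
  intro i j β
  have h := IsExp.formalHasExp (isExp_exponent (rank r β)) i j β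
  have hpow : ∀ k : ℕ, coeffR (((k.factorial : ℚ)⁻¹) • exponentT r ^ k) i j β =
      coeffR (((k.factorial : ℚ)⁻¹) • exponent (rank r β) ^ k) i j β := fun k => by
    rw [coeffR_rat_smul, coeffR_rat_smul]
    have h1 := coeff_pow_congr (F := exponentT r) (G := exponent (rank r β)) (β := β)
      (fun γ hγ => coeff_exponentT ((isRank_rank r β).of_le hγ)) k β le_rfl
    have h2 : coeffR (exponentT r ^ k) i j β = coeffR (exponent (rank r β) ^ k) i j β :=
      congrArg (fun x => coeffL x i j) h1
    rw [h2]
  simp_rw [hpow]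
  rw [coeffR_exponentialT_rank]
  exact h

theorem coeff_powerSum {r : ℕ∞} {N : ℕ} {β : ℕ →₀ ℕ} (h : IsRank r N β) (n : ℕ+) :
    MvPowerSeries.coeff β (powerSum r n) = MvPowerSeries.coeff β (powerSum N n) := by
  classical
  refine if_congr ⟨?_, ?_⟩ rfl rfl
  · rintro ⟨i, hi, rfl⟩
    refine ⟨i, ?_, rfl⟩
    by_contra hlt
    have := h.2 i (not_lt.mp fun h => hlt (Nat.cast_lt.mpr h)) hi
    rw [Finsupp.single_eq_same] at this
    exact n.ne_zero this
  · rintro ⟨i, hi, rfl⟩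
    exact ⟨i, lt_of_lt_of_le hi h.1, rfl⟩

theorem formalHasSum_exponentTerm (r : ℕ∞) :
    FormalHasSum (fun n : ℕ+ => exponentTerm r n) (exponentT r) := by
  intro i j β
  have h := formalHasSum_exponent_natCast (rank r β) i j β
  have hterm : ∀ n : ℕ+, coeffR (exponentTerm r n) i j β =
      coeffR (exponentTerm (rank r β) n) i j β := fun n => by
    have hadd : ∀ x y : R, coeffR (x + y) i j β = coeffR x i j β + coeffR y i j β :=
      fun _ _ => rfl
    rw [exponentTerm_eq, exponentTerm_eq, hadd, hadd, coeffR_C_mul_ofT, coeffR_C_mul_ofT,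
      coeff_powerSum (isRank_rank r β)]
  simp_rw [hterm]
  rw [coeffR_exponentT_rank]
  exact h

/-! ### The generating function of the Schur basis -/

theorem schurT_top (lam : Ptn) : schurT ⊤ lam = schurInfinite lam := if_pos rfl

theorem schurT_natCast (n : ℕ) (lam : Ptn) :
    schurT n lam = (schurPoly n lam : MvPowerSeries ℕ ℚ) := by
  rw [schurT, if_neg (ENat.natCast_ne_top n), ENat.toNat_natCast]

theorem coeff_schurT_eq_zero {r : ℕ∞} {lam : Ptn} (hl : (lam.length : ℕ∞) ≤ r) {β : ℕ →₀ ℕ}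
    (hβ : β.degree < lam.size) : MvPowerSeries.coeff β (schurT r lam) = 0 := by
  induction r using ENat.recTopCoe with
  | top =>
    rw [schurT_top]
    exact coeff_schurPoly_eq_zero (le_max_left _ _) hβ
  | coe n =>
    rw [schurT_natCast, MvPolynomial.coeff_coe]
    exact coeff_schurPoly_eq_zero (Nat.cast_le.mp hl) hβ

theorem coeff_schurT {r : ℕ∞} {lam : Ptn} {β : ℕ →₀ ℕ} (hl : lam.length ≤ rank r β)
    (hβ : lam.size ≤ β.degree) :
    MvPowerSeries.coeff β (schurT r lam) = (schurPoly (rank r β) lam).coeff β := by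
  induction r using ENat.recTopCoe with
  | top =>
    rw [schurT_top, rank_top]
    have hs := lam.length_le_size
    refine (coeff_schurPoly_stable ?_ (le_max_left _ _) fun k hk =>
      apply_eq_zero_of_sup_le (le_trans (le_max_right _ _) hk)).symm
    exact max_le (by omega) (by omega)
  | coe n => rw [schurT_natCast, MvPolynomial.coeff_coe, rank_natCast]

theorem length_le_rank {r : ℕ∞} {lam : Ptn} (hl : (lam.length : ℕ∞) ≤ r) {β : ℕ →₀ ℕ}
    (hβ : lam.size ≤ β.degree) : lam.length ≤ rank r β := by
  induction r using ENat.recTopCoe with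
  | top =>
    rw [rank_top]
    have hs := lam.length_le_size
    omega
  | coe n =>
    rw [rank_natCast]
    exact Nat.cast_le.mp hl

/-- In a sum over partitions weighted by the coefficients of `t^β` in the Schur functions only
finitely many partitions contribute. -/
theorem finsum_schurT (r : ℕ∞) (β : ℕ →₀ ℕ) (a : Ptn → B) :
    {lam : {lam : Ptn // (lam.length : ℕ∞) ≤ r} |
      MvPowerSeries.coeff β (schurT r lam.1) • a lam.1 ≠ 0}.Finite ∧
    ∑ lam ∈ boundedPtns (rank r β) β.degree, (schurPoly (rank r β) lam).coeff β • a lam =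
      ∑ᶠ lam : {lam : Ptn // (lam.length : ℕ∞) ≤ r},
        MvPowerSeries.coeff β (schurT r lam.1) • a lam.1 := by
  classical
  have hsupp : {lam : {lam : Ptn // (lam.length : ℕ∞) ≤ r} |
      MvPowerSeries.coeff β (schurT r lam.1) • a lam.1 ≠ 0} ⊆
      ((boundedPtns (rank r β) β.degree).subtype fun lam => (lam.length : ℕ∞) ≤ r) := by
    intro lam hlam
    rw [Finset.mem_coe, Finset.mem_subtype, mem_boundedPtns]
    have hsize : lam.1.size ≤ β.degree := by
      by_contra h
      exact hlam (by rw [coeff_schurT_eq_zero lam.2 (not_le.mp h), zero_smul])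
    exact ⟨hsize, length_le_rank lam.2 hsize⟩
  refine ⟨(Finset.finite_toSet _).subset hsupp, ?_⟩
  rw [finsum_eq_sum_of_support_subset _ hsupp]
  rw [Finset.sum_subtype_of_mem (fun lam => MvPowerSeries.coeff β (schurT r lam) • a lam)]
  · refine Finset.sum_congr rfl fun lam hlam => ?_
    obtain ⟨h1, h2⟩ := mem_boundedPtns.mp hlam
    rw [coeff_schurT h2 h1]
  · intro lam hlam
    exact le_trans (Nat.cast_le.mpr (mem_boundedPtns.mp hlam).2) (isRank_rank r β).1

theorem prod_tHom (N : ℕ) : ∏ k : Fin N, tHom k (PowerSeries.map doubleShift completeSeries) =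
    MvPowerSeries.map doubleShift
      (∏ i : Fin N, completeSeries.subst (MvPowerSeries.X (i : ℕ) : MvPowerSeries ℕ B)) := by
  rw [map_prod]
  refine Finset.prod_congr rfl fun k _ => ?_
  ext1 β
  refine (coeff_tHomOf _ _ β).trans ?_
  rw [MvPowerSeries.coeff_map, PowerSeries.coeff_subst_single, PowerSeries.coeff_map]
  split_ifs
  · rfl
  · rw [map_zero]

/-- The Cauchy identity after application of the vertex operator. -/
theorem coeffR_exponential (N : ℕ) (i j : ℤ) (β : ℕ →₀ ℕ) : coeffR (exponential N) i j β =
    ∑ lam ∈ boundedPtns N β.degree, (schurPoly N lam).coeff β •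
      coeffL (geom * vertexOp (schurB lam)) i j := by
  have hs : ∀ lam : Ptn, geom * expMultiplication *
      doubleShift ((schurPoly N lam).coeff β • schurB lam) =
      geom * vertexOp (schurB lam) * algebraMap ℚ L ((schurPoly N lam).coeff β) := fun lam => by
    rw [Algebra.smul_def, map_mul, map_algebraMap_rat (A := B) (A' := L) doubleShift, vertexOp_eq]
    ring
  rw [coeffR, exponential, prod_tHom, MvPowerSeries.coeff_C_mul, MvPowerSeries.coeff_map,
    cauchy_identity N β le_rfl, map_sum, Finset.mul_sum]
  change coeffLHom i j _ = _
  rw [map_sum]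
  refine Finset.sum_congr rfl fun lam _ => ?_
  rw [hs]
  exact coeffL_mul_algebraMap _ _ _ _

theorem coeffR_exponentialT (r : ℕ∞) (i j : ℤ) (β : ℕ →₀ ℕ) :
    coeffR (exponentialT r) i j β =
    ∑ lam ∈ boundedPtns (rank r β) β.degree, (schurPoly (rank r β) lam).coeff β •
      coeffL (geom * vertexOp (schurB lam)) i j := by
  rw [coeffR_exponentialT_rank, coeffR_exponential]

theorem formalHasSum_exponentialT (r : ℕ∞) :
    FormalHasSum (fun lam : {lam : Ptn // (lam.length : ℕ∞) ≤ r} =>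
      MvPowerSeries.C (geom * vertexOp (schurB lam.1)) * ofT (schurT r lam.1))
      (exponentialT r) := by
  intro i j β
  simp_rw [coeffR_C_mul_ofT]
  rw [coeffR_exponentialT]
  exact finsum_schurT r β fun lam => coeffL (geom * vertexOp (schurB lam)) i j

end Bosonic

end

theorem theorem5p8 (r : ℕ∞) :
    ∃ A E : Bosonic.R,
      -- `A` is the exponent and `E` is its exponential
      Bosonic.FormalHasSum (fun n : ℕ+ => Bosonic.exponentTerm r n) A ∧
      Bosonic.FormalHasExp A E ∧
      -- `E` is `(1 - w/z)⁻¹ Γ(z, w)` applied to the generating function of the Schur basis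
      Bosonic.FormalHasSum
        (fun lam : {lam : Bosonic.Ptn // (lam.length : ℕ∞) ≤ r} =>
          MvPowerSeries.C (Bosonic.geom * Bosonic.vertexOp (Bosonic.schurB lam.1)) *
            Bosonic.ofT (Bosonic.schurT r lam.1)) E ∧
      -- `E` is the generating function of the products `(Xⁱ ⊗ ∂ʲ) ⋆ S_λ`
      ∀ (i j : ℤ) (β : ℕ →₀ ℕ),
        {lam : {lam : Bosonic.Ptn // (lam.length : ℕ∞) ≤ r} |
          MvPowerSeries.coeff β (Bosonic.schurT r lam.1) • Bosonic.glAct i j lam.1 ≠ 0}.Finite ∧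
        Bosonic.coeffR E i (-j) β =
          ∑ᶠ lam : {lam : Bosonic.Ptn // (lam.length : ℕ∞) ≤ r},
            MvPowerSeries.coeff β (Bosonic.schurT r lam.1) • Bosonic.glAct i j lam.1 := by
  refine ⟨Bosonic.exponentT r, Bosonic.exponentialT r, Bosonic.formalHasSum_exponentTerm r,
    Bosonic.formalHasExp_exponentT r, Bosonic.formalHasSum_exponentialT r, fun i j β => ?_⟩
  obtain ⟨hfin, hsum⟩ := Bosonic.finsum_schurT r β (Bosonic.glAct i j)
  refine ⟨hfin, ?_⟩
  rw [← hsum, Bosonic.coeffR_exponentialT]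
  simp_rw [Bosonic.coeffL_geom_mul_vertexOp]
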